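/- Conventions. All manifolds are smooth, finite-dimensional, without boundary, Hausdorff and second countable. A \emph{smooth groupoid} $G$ consists of manifolds $G_0$ (objects) and $G_1$ (arrows) with smooth source and target maps $s,t\colon G_1\to G_0$, $s$ a submersion, a smooth composition $(g,h)\mapsto gh$ defined on $\{(g,h)\in G_1\times G_1 : s(g)=t(h)\}$, smooth units $x\mapsto 1_x$ and smooth inverses, satisfying the groupoid axioms (with $s(gh)=s(h)$, $t(gh)=t(g)$). It is an \emph{orbifold groupoid} if $s$ is a local diffeomorphism and $(s,t)\colon G_1\to G_0\times G_0$ is proper. It is \emph{connected} if the quotient space $G_0/G$, in which two objects are identified when there is an arrow between them, is connected. In an orbifold groupoid each arrow $g\colon x\to y$ induces the germ at $x$ of the local diffeomorphism $t\circ(s|_U)^{-1}$ of $G_0$, where $U$ is a small neighbourhood of $g$ in $G_1$; the \emph{ineffective stabilizer group} $S^0_x$ at $x\in G_0$ is the group of arrows $g\colon x\to x$ whose germ is the germ of the identity. For a right action of a Lie group $K$ on a manifold $P$, the \emph{translation groupoid} $P\rtimes K$ has objects $P$, arrows $P\times K$, $t(x,k)=x$, $s(x,k)=xk$ and $(x,k)(xk,l)=(x,kl)$.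 Two smooth groupoids $G$ and $H$ are \emph{equivalent} (in the sense of Hilsum and Skandalis) if there is a manifold $Q$ with maps $s_Q\colon Q\to G_0$, $t_Q\colon Q\to H_0$ and commuting smooth actions of $G$ on the left along $s_Q$ and of $H$ on the right along $t_Q$, such that $s_Q$ is a principal right $H$-bundle and $t_Q$ is a principal left $G$-bundle; here $s_Q$ is principal if it is an $H$-invariant surjective submersion and $(q,h)\mapsto(q,qh)$ is a diffeomorphism from $\{(q,h)\in Q\times H_1 : t_Q(q)=t(h)\}$ onto $Q\times_{G_0}Q$, and similarly for $t_Q$. Theorem. Let $G$ be a connected orbifold groupoid such that for every $x\in G_0$ the ineffective stabilizer group $S^0_x$ has trivial center. Then there are a compact Lie group $K$, a manifold $P$ and a smooth right action of $K$ on $P$ such that $G$ is equivalent to the translation groupoid $P\rtimes K$. -/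

import Mathlib

open scoped Manifold ContDiff Topology

universe u

noncomputable section

namespace OrbifoldPresentation


section SmoothMaps

variable {E E' : Type*} [NormedAddCommGroup E] [NormedSpace ℝ E]
  [NormedAddCommGroup E'] [NormedSpace ℝ E']
  {H H' : Type*} [TopologicalSpace H] [TopologicalSpace H']
  (I : ModelWithCorners ℝ E H) (J : ModelWithCorners ℝ E' H')
  {M N : Type*} [TopologicalSpace M] [ChartedSpace H M] [TopologicalSpace N] [ChartedSpace H' N]

/-- A map defined on a subset `S` of a manifold is smooth if it is locally the restriction of a
smooth map defined on an open subset of the ambient manifold. When `S` is an embedded submanifold,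
such as a fibre product along a submersion, this is smoothness for the submanifold structure. -/
def SmoothOnSubset {S : Set M} (f : S → N) : Prop :=
  ∀ x : S, ∃ U : Set M, IsOpen U ∧ (x : M) ∈ U ∧
    ∃ F : M → N, ContMDiffOn I J ∞ F U ∧ ∀ y : S, (y : M) ∈ U → F y = f y

/-- A diffeomorphism between subsets (embedded submanifolds in all our uses) of two manifolds. -/
def IsDiffeoOfSubsets {S : Set M} {T : Set N} (f : S → T) : Prop :=
  SmoothOnSubset I J (fun x => (f x : N)) ∧
    ∃ f' : T → S, Function.LeftInverse f' f ∧ Function.RightInverse f' f ∧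
      SmoothOnSubset J I (fun y => (f' y : M))

end SmoothMaps

section Groupoids

variable {E₀ E₁ : Type*} [NormedAddCommGroup E₀] [NormedSpace ℝ E₀] [FiniteDimensional ℝ E₀]
  [NormedAddCommGroup E₁] [NormedSpace ℝ E₁] [FiniteDimensional ℝ E₁]
  {H₀ H₁ : Type*} [TopologicalSpace H₀] [TopologicalSpace H₁]
  (I₀ : ModelWithCorners ℝ E₀ H₀) [I₀.Boundaryless]
  (I₁ : ModelWithCorners ℝ E₁ H₁) [I₁.Boundaryless]
  (G₀ G₁ : Type*)
  [TopologicalSpace G₀] [ChartedSpace H₀ G₀] [IsManifold I₀ ∞ G₀] [T2Space G₀]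
  [SecondCountableTopology G₀]
  [TopologicalSpace G₁] [ChartedSpace H₁ G₁] [IsManifold I₁ ∞ G₁] [T2Space G₁]
  [SecondCountableTopology G₁]

/-- A smooth groupoid with manifold of objects `G₀` and manifold of arrows `G₁`. An arrow `g` goes
from `s g` to `t g`, and `comp g h _` is the composite `gh`, defined when `s g = t h`. -/
structure SmoothGroupoid where
  s : G₁ → G₀
  t : G₁ → G₀
  unit : G₀ → G₁
  inv : G₁ → G₁
  comp : ∀ g h : G₁, s g = t h → G₁
  smooth_s : ContMDiff I₁ I₀ ∞ s
  smooth_t : ContMDiff I₁ I₀ ∞ t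
  smooth_unit : ContMDiff I₀ I₁ ∞ unit
  smooth_inv : ContMDiff I₁ I₁ ∞ inv
  smooth_comp : SmoothOnSubset (I₁.prod I₁) I₁
    (fun p : {p : G₁ × G₁ | s p.1 = t p.2} => comp p.1.1 p.1.2 p.2)
  s_unit : ∀ x, s (unit x) = x
  t_unit : ∀ x, t (unit x) = x
  s_inv : ∀ g, s (inv g) = t g
  t_inv : ∀ g, t (inv g) = s g
  s_comp : ∀ g h (e : s g = t h), s (comp g h e) = s h
  t_comp : ∀ g h (e : s g = t h), t (comp g h e) = t g
  assoc : ∀ g h k (e : s g = t h) (e' : s h = t k),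
    comp g (comp h k e') (e.trans (t_comp h k e').symm) =
      comp (comp g h e) k ((s_comp g h e).trans e')
  comp_unit : ∀ g, comp g (unit (s g)) (t_unit (s g)).symm = g
  unit_comp : ∀ g, comp (unit (t g)) g (s_unit (t g)) = g
  inv_comp : ∀ g, comp (inv g) g (s_inv g) = unit (s g)
  comp_inv : ∀ g, comp g (inv g) (t_inv g).symm = unit (t g)
  submersion_s : Manifold.IsSubmersion I₁ I₀ ∞ s

/-- An orbifold groupoid is a proper étale smooth groupoid. -/
structure OrbifoldGroupoid extends SmoothGroupoid I₀ I₁ G₀ G₁ where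
  etale : IsLocalDiffeomorph I₁ I₀ ∞ s
  proper : IsProperMap (fun g => (s g, t g))

variable {I₀ I₁ G₀ G₁}

namespace SmoothGroupoid

variable (G : SmoothGroupoid I₀ I₁ G₀ G₁)

/-- Two objects are equivalent if there is an arrow between them. -/
def orbitSetoid : Setoid G₀ where
  r x y := ∃ g, G.s g = x ∧ G.t g = y
  iseqv :=
    { refl := fun x => ⟨G.unit x, G.s_unit x, G.t_unit x⟩
      symm := fun ⟨g, hs, ht⟩ => ⟨G.inv g, (G.s_inv g).trans ht, (G.t_inv g).trans hs⟩
      trans := fun ⟨g, hs, ht⟩ ⟨h, hs', ht'⟩ =>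
        ⟨G.comp h g (hs'.trans ht.symm), (G.s_comp _ _ _).trans hs, (G.t_comp _ _ _).trans ht'⟩ }

/-- The topological (coarse) quotient of a groupoid, with the quotient topology. -/
abbrev TopQuotient : Type _ := Quotient G.orbitSetoid

/-- A groupoid is connected if its topological quotient is connected. -/
def IsConnected : Prop := ConnectedSpace G.TopQuotient

/-- The stabilizer of an object `x`: all arrows from `x` to `x`. -/
def Stabilizer (x : G₀) : Type _ := {g : G₁ // G.s g = x ∧ G.t g = x}

instance (x : G₀) : Group (G.Stabilizer x) where
  mul g h := ⟨G.comp g.1 h.1 (g.2.1.trans h.2.2.symm),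
    (G.s_comp _ _ _).trans h.2.1, (G.t_comp _ _ _).trans g.2.2⟩
  one := ⟨G.unit x, G.s_unit x, G.t_unit x⟩
  inv g := ⟨G.inv g.1, (G.s_inv _).trans g.2.2, (G.t_inv _).trans g.2.1⟩
  mul_assoc g h k := Subtype.ext (G.assoc g.1 h.1 k.1 _ _).symm
  one_mul := by
    rintro ⟨g, rfl, ht⟩
    refine Subtype.ext ?_
    have := G.unit_comp g
    simp only [ht] at this
    exact this
  mul_one := by
    rintro ⟨g, rfl, ht⟩
    exact Subtype.ext (G.comp_unit g)
  inv_mul_cancel := by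
    rintro ⟨g, rfl, ht⟩
    exact Subtype.ext (G.inv_comp g)

/-- In an étale groupoid an arrow `g : x → y` induces the germ at `x` of the diffeomorphism
`t ∘ (s|_U)⁻¹`, where `U` is a neighbourhood of `g` on which `s` is a diffeomorphism onto an open
set; the germ does not depend on `U`. -/
def arrowGerm (hG : IsLocalDiffeomorph I₁ I₀ ∞ G.s) (g : G₁) : (𝓝 (G.s g)).Germ G₀ :=
  ((G.t ∘ (hG g).localInverse : G₀ → G₀) : (𝓝 (G.s g)).Germ G₀)

/-- The germ of an arrow can be computed with any continuous local section of `s` through it. -/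
theorem arrowGerm_eq (hG : IsLocalDiffeomorph I₁ I₀ ∞ G.s) (g : G₁) (σ : G₀ → G₁)
    (hσ : ContinuousAt σ (G.s g)) (hg : σ (G.s g) = g)
    (hs : ∀ᶠ y in 𝓝 (G.s g), G.s (σ y) = y) :
    G.arrowGerm hG g = ((G.t ∘ σ : G₀ → G₀) : (𝓝 (G.s g)).Germ G₀) := by
  refine Filter.Germ.coe_eq.2 ?_
  have h1 : ∀ᶠ z in 𝓝 (σ (G.s g)), (hG g).localInverse (G.s z) = z := by
    rw [hg]
    exact (hG g).localInverse_eventuallyEq_left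
  filter_upwards [hσ.eventually h1, hs] with y hy hsy
  simp only [Function.comp_apply]
  rw [hsy] at hy
  rw [hy]

end SmoothGroupoid

namespace OrbifoldGroupoid

variable (G : OrbifoldGroupoid I₀ I₁ G₀ G₁)

/-- An arrow is an ineffective stabilizer if it has equal source and target and induces the germ of
the identity map. -/
def IsIneffective (g : G₁) : Prop :=
  G.s g = G.t g ∧
    G.toSmoothGroupoid.arrowGerm G.etale g = ((id : G₀ → G₀) : (𝓝 (G.s g)).Germ G₀)

/-- An ineffective stabilizer has a local section of both `s` and `t` through it. -/
theorem IsIneffective.exists_section {G : OrbifoldGroupoid I₀ I₁ G₀ G₁} {g : G₁}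
    (h : G.IsIneffective g) : ∃ σ : G₀ → G₁, ContinuousAt σ (G.s g) ∧ σ (G.s g) = g ∧
      ∀ᶠ y in 𝓝 (G.s g), G.s (σ y) = y ∧ G.t (σ y) = y := by
  refine ⟨(G.etale g).localInverse, (G.etale g).localInverse_contMDiffAt.continuousAt,
    (G.etale g).localInverse_left_inv (G.etale g).localInverse_mem_target, ?_⟩
  filter_upwards [(G.etale g).localInverse_eventuallyEq_right, Filter.Germ.coe_eq.1 h.2]
    with y h1 h2 using ⟨h1, h2⟩

theorem isIneffective_of_section {g : G₁} (σ : G₀ → G₁) (hσ : ContinuousAt σ (G.s g))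
    (hg : σ (G.s g) = g) (h : ∀ᶠ y in 𝓝 (G.s g), G.s (σ y) = y ∧ G.t (σ y) = y) :
    G.IsIneffective g := by
  refine ⟨?_, ?_⟩
  · have := h.self_of_nhds.2
    rw [hg] at this
    exact this.symm
  · rw [G.toSmoothGroupoid.arrowGerm_eq G.etale g σ hσ hg (h.mono fun _ h => h.1)]
    exact Filter.Germ.coe_eq.2 (h.mono fun _ h => h.2)

theorem isIneffective_unit (x : G₀) : G.IsIneffective (G.unit x) :=
  G.isIneffective_of_section G.unit G.smooth_unit.continuous.continuousAt
    (by rw [G.s_unit]) (Filter.Eventually.of_forall fun y => ⟨G.s_unit y, G.t_unit y⟩)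

theorem IsIneffective.inv {G : OrbifoldGroupoid I₀ I₁ G₀ G₁} {g : G₁} (h : G.IsIneffective g) :
    G.IsIneffective (G.inv g) := by
  obtain ⟨σ, hσ, hg, hst⟩ := h.exists_section
  have e : G.s (G.inv g) = G.s g := (G.s_inv g).trans h.1.symm
  refine G.isIneffective_of_section (fun y => G.inv (σ y)) ?_ ?_ ?_
  · rw [e]
    exact G.smooth_inv.continuous.continuousAt.comp hσ
  · rw [e, hg]
  · rw [e]
    filter_upwards [hst] with y hy using ⟨(G.s_inv _).trans hy.2, (G.t_inv _).trans hy.1⟩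

theorem IsIneffective.comp {G : OrbifoldGroupoid I₀ I₁ G₀ G₁} {g h : G₁}
    (hg : G.IsIneffective g) (hh : G.IsIneffective h) (e : G.s g = G.t h) :
    G.IsIneffective (G.comp g h e) := by
  obtain ⟨a, ha, hag, hast⟩ := hg.exists_section
  obtain ⟨b, hb, hbh, hbst⟩ := hh.exists_section
  have ex : G.s h = G.s g := hh.1.trans e.symm
  have ec : G.s (G.comp g h e) = G.s g := (G.s_comp g h e).trans ex
  rw [ex] at hb hbh hbst
  obtain ⟨U, hU, hxU, F, hF, hFeq⟩ := G.smooth_comp ⟨(g, h), e⟩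
  have hab : ContinuousAt (fun y => (a y, b y)) (G.s g) := ha.prodMk hb
  have hab' : (a (G.s g), b (G.s g)) = (g, h) := by rw [hag, hbh]
  have hmem : U ∈ 𝓝 (a (G.s g), b (G.s g)) := by
    rw [hab']
    exact hU.mem_nhds hxU
  refine G.isIneffective_of_section (fun y => F (a y, b y)) ?_ ?_ ?_
  · rw [ec]
    exact ContinuousAt.comp (f := fun y => (a y, b y)) (g := F)
      (hF.continuousOn.continuousAt hmem) hab
  · rw [ec, hab']
    exact hFeq ⟨(g, h), e⟩ hxU
  · rw [ec]
    filter_upwards [hast, hbst, hab.preimage_mem_nhds hmem] with y h1 h2 h3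
    have e' : G.s (a y) = G.t (b y) := h1.1.trans h2.2.symm
    have := hFeq ⟨(a y, b y), e'⟩ h3
    simp only at this
    rw [this]
    exact ⟨(G.s_comp _ _ _).trans h2.1, (G.t_comp _ _ _).trans h1.2⟩

/-- The group of ineffective stabilizers at `x`. -/
def ineffectiveStabilizer (x : G₀) : Subgroup (G.toSmoothGroupoid.Stabilizer x) where
  carrier := {g | G.IsIneffective g.1}
  mul_mem' {g h} hg hh := IsIneffective.comp hg hh (g.2.1.trans h.2.2.symm)
  one_mem' := G.isIneffective_unit x
  inv_mem' hg := IsIneffective.inv hg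

end OrbifoldGroupoid

section Actions

variable (G : SmoothGroupoid I₀ I₁ G₀ G₁)
  {E : Type*} [NormedAddCommGroup E] [NormedSpace ℝ E] [FiniteDimensional ℝ E]
  {H : Type*} [TopologicalSpace H] (J : ModelWithCorners ℝ E H) [J.Boundaryless]
  {Q : Type*} [TopologicalSpace Q] [ChartedSpace H Q] [IsManifold J ∞ Q] [T2Space Q]
  [SecondCountableTopology Q]

/-- A smooth left action of a groupoid on a manifold `Q` with base map `π`. -/
structure LeftAction (π : Q → G₀) where
  smooth_base : ContMDiff J I₀ ∞ π
  act : ∀ (g : G₁) (q : Q), G.s g = π q → Q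
  smooth_act : SmoothOnSubset (I₁.prod J) J
    (fun a : {a : G₁ × Q | G.s a.1 = π a.2} => act a.1.1 a.1.2 a.2)
  base_act : ∀ g q e, π (act g q e) = G.t g
  unit_act : ∀ q, act (G.unit (π q)) q (G.s_unit _) = q
  comp_act : ∀ g h q (e : G.s g = G.t h) (e' : G.s h = π q),
    act g (act h q e') (e.trans (base_act h q e').symm) =
      act (G.comp g h e) q ((G.s_comp g h e).trans e')

/-- A smooth right action of a groupoid on a manifold `Q` with base map `π`. -/
structure RightAction (π : Q → G₀) where
  smooth_base : ContMDiff J I₀ ∞ π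
  act : ∀ (q : Q) (g : G₁), π q = G.t g → Q
  smooth_act : SmoothOnSubset (J.prod I₁) J
    (fun a : {a : Q × G₁ | π a.1 = G.t a.2} => act a.1.1 a.1.2 a.2)
  base_act : ∀ q g e, π (act q g e) = G.s g
  act_unit : ∀ q, act q (G.unit (π q)) (G.t_unit _).symm = q
  act_comp : ∀ q g h (e : π q = G.t g) (e' : G.s g = G.t h),
    act (act q g e) h ((base_act q g e).trans e') =
      act q (G.comp g h e') (e.trans (G.t_comp g h e').symm)

variable {G J} {E' : Type*} [NormedAddCommGroup E'] [NormedSpace ℝ E'] [FiniteDimensional ℝ E']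
  {H' : Type*} [TopologicalSpace H'] (I' : ModelWithCorners ℝ E' H') [I'.Boundaryless]
  {B : Type*} [TopologicalSpace B] [ChartedSpace H' B] [IsManifold I' ∞ B] [T2Space B]
  [SecondCountableTopology B]

/-- `p : Q → B` is a principal bundle for the given left action of the groupoid on `Q`. -/
structure LeftAction.IsPrincipal {π : Q → G₀} (a : LeftAction G J π) (p : Q → B) : Prop where
  invariant : ∀ g q e, p (a.act g q e) = p q
  surjective : Function.Surjective p
  submersion : Manifold.IsSubmersion J I' ∞ p
  diffeo : IsDiffeoOfSubsets (I₁.prod J) (J.prod J)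
    (fun b : {b : G₁ × Q | G.s b.1 = π b.2} =>
      (⟨(a.act b.1.1 b.1.2 b.2, b.1.2), invariant _ _ b.2⟩ : {c : Q × Q | p c.1 = p c.2}))

/-- `p : Q → B` is a principal bundle for the given right action of the groupoid on `Q`. -/
structure RightAction.IsPrincipal {π : Q → G₀} (a : RightAction G J π) (p : Q → B) : Prop where
  invariant : ∀ q g e, p (a.act q g e) = p q
  surjective : Function.Surjective p
  submersion : Manifold.IsSubmersion J I' ∞ p
  diffeo : IsDiffeoOfSubsets (J.prod I₁) (J.prod J)
    (fun b : {b : Q × G₁ | π b.1 = G.t b.2} =>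
      (⟨(b.1.1, a.act b.1.1 b.1.2 b.2), (invariant _ _ b.2).symm⟩ :
        {c : Q × Q | p c.1 = p c.2}))

end Actions

end Groupoids

section Equivalence

variable {E₀ E₁ F₀ F₁ : Type*}
  [NormedAddCommGroup E₀] [NormedSpace ℝ E₀] [FiniteDimensional ℝ E₀]
  [NormedAddCommGroup E₁] [NormedSpace ℝ E₁] [FiniteDimensional ℝ E₁]
  [NormedAddCommGroup F₀] [NormedSpace ℝ F₀] [FiniteDimensional ℝ F₀]
  [NormedAddCommGroup F₁] [NormedSpace ℝ F₁] [FiniteDimensional ℝ F₁]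
  {M₀ M₁ N₀ N₁ : Type*} [TopologicalSpace M₀] [TopologicalSpace M₁]
  [TopologicalSpace N₀] [TopologicalSpace N₁]
  {I₀ : ModelWithCorners ℝ E₀ M₀} [I₀.Boundaryless]
  {I₁ : ModelWithCorners ℝ E₁ M₁} [I₁.Boundaryless]
  {J₀ : ModelWithCorners ℝ F₀ N₀} [J₀.Boundaryless]
  {J₁ : ModelWithCorners ℝ F₁ N₁} [J₁.Boundaryless]
  {G₀ G₁ H₀ H₁ : Type u}
  [TopologicalSpace G₀] [ChartedSpace M₀ G₀] [IsManifold I₀ ∞ G₀] [T2Space G₀]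
  [SecondCountableTopology G₀]
  [TopologicalSpace G₁] [ChartedSpace M₁ G₁] [IsManifold I₁ ∞ G₁] [T2Space G₁]
  [SecondCountableTopology G₁]
  [TopologicalSpace H₀] [ChartedSpace N₀ H₀] [IsManifold J₀ ∞ H₀] [T2Space H₀]
  [SecondCountableTopology H₀]
  [TopologicalSpace H₁] [ChartedSpace N₁ H₁] [IsManifold J₁ ∞ H₁] [T2Space H₁]
  [SecondCountableTopology H₁]
  (G : SmoothGroupoid I₀ I₁ G₀ G₁) (H : SmoothGroupoid J₀ J₁ H₀ H₁)

/-- A Hilsum–Skandalis morphism from `G` to `H`, carried by the manifold `Q`. -/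
structure HSMorphism (q : ℕ) (Q : Type u) [TopologicalSpace Q]
    [ChartedSpace (EuclideanSpace ℝ (Fin q)) Q] [IsManifold (𝓡 q) ∞ Q] [T2Space Q]
    [SecondCountableTopology Q] where
  sQ : Q → G₀
  tQ : Q → H₀
  left : LeftAction G (𝓡 q) sQ
  right : RightAction H (𝓡 q) tQ
  sQ_right : ∀ x h e, sQ (right.act x h e) = sQ x
  tQ_left : ∀ g x e, tQ (left.act g x e) = tQ x
  compatible : ∀ g x h (e : G.s g = sQ x) (e' : tQ x = H.t h),
    right.act (left.act g x e) h ((tQ_left g x e).trans e') =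
      left.act g (right.act x h e') (e.trans (sQ_right x h e').symm)
  right_principal : right.IsPrincipal I₀ sQ

/-- Two smooth groupoids are equivalent if there is a Hilsum–Skandalis morphism between them for
which both maps to the object manifolds are principal bundles. -/
def HSEquivalent : Prop :=
  ∃ (q : ℕ) (Q : Type u) (_ : TopologicalSpace Q)
    (_ : ChartedSpace (EuclideanSpace ℝ (Fin q)) Q) (_ : IsManifold (𝓡 q) ∞ Q) (_ : T2Space Q)
    (_ : SecondCountableTopology Q) (φ : HSMorphism G H q Q),
    φ.left.IsPrincipal J₀ φ.tQ

end Equivalence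

section Translation

variable {E E' : Type*} [NormedAddCommGroup E] [NormedSpace ℝ E] [FiniteDimensional ℝ E]
  [NormedAddCommGroup E'] [NormedSpace ℝ E'] [FiniteDimensional ℝ E']
  {H H' : Type*} [TopologicalSpace H] [TopologicalSpace H']
  (I : ModelWithCorners ℝ E H) [I.Boundaryless]
  (J : ModelWithCorners ℝ E' H') [J.Boundaryless]
  (P K : Type*)
  [TopologicalSpace P] [ChartedSpace H P] [IsManifold I ∞ P] [T2Space P]
  [SecondCountableTopology P]
  [Group K] [TopologicalSpace K] [ChartedSpace H' K] [LieGroup J ∞ K] [T2Space K]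
  [SecondCountableTopology K]

/-- A smooth right action of a Lie group `K` on a manifold `P`. -/
structure LieRightAction where
  act : P → K → P
  smooth_act : ContMDiff (I.prod J) I ∞ (fun a : P × K => act a.1 a.2)
  act_one : ∀ x, act x 1 = x
  act_mul : ∀ x k l, act x (k * l) = act (act x k) l

variable {I J P K}

namespace LieRightAction

variable (α : LieRightAction I J P K)

/-- The diffeomorphism `(x, k) ↦ (xk, k)` of `P × K`. -/
def shear : (P × K) ≃ₘ^∞⟮I.prod J, I.prod J⟯ (P × K) where
  toFun a := (α.act a.1 a.2, a.2)
  invFun a := (α.act a.1 a.2⁻¹, a.2)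
  left_inv a := by simp [← α.act_mul, α.act_one]
  right_inv a := by simp [← α.act_mul, α.act_one]
  contMDiff_toFun := α.smooth_act.prodMk contMDiff_snd
  contMDiff_invFun := by
    have h : ContMDiff (I.prod J) (I.prod J) ∞ (fun a : P × K => (a.1, a.2⁻¹)) :=
      contMDiff_fst.prodMk contMDiff_snd.inv
    exact (α.smooth_act.comp h).prodMk contMDiff_snd

theorem isSubmersion_act :
    Manifold.IsSubmersion (I.prod J) I ∞ (fun a : P × K => α.act a.1 a.2) := by
  have : IsManifold J ∞ K := (inferInstance : ContMDiffMul J ∞ K).toIsManifold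
  refine Manifold.IsSubmersionOfComplement.isSubmersion (F := E') fun a => ?_
  set c : OpenPartialHomeomorph (P × K) (ModelProd H H') := chartAt (ModelProd H H') (α.shear a)
    with hc
  have hcm : c ∈ IsManifold.maximalAtlas (I.prod J) ∞ (P × K) := IsManifold.chart_mem_maximalAtlas _
  set φ : OpenPartialHomeomorph (P × K) (ModelProd H H') :=
    α.shear.toHomeomorph.toOpenPartialHomeomorph.trans c with hφ
  refine Manifold.IsSubmersionAtOfComplement.mk_of_charts (ContinuousLinearEquiv.refl ℝ (E × E'))
    φ (chartAt H (α.act a.1 a.2)) ?_ (mem_chart_source H _) ?_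
    (IsManifold.chart_mem_maximalAtlas _) ?_ ?_
  · simp only [hφ, OpenPartialHomeomorph.trans_source, Set.mem_inter_iff]
    exact ⟨trivial, mem_chart_source (ModelProd H H') (α.shear a)⟩
  · refine OpenPartialHomeomorph.mem_maximalAtlas_of_contMDiffOn _ ?_ ?_
    · exact (contMDiffOn_of_mem_maximalAtlas hcm).comp α.shear.contMDiff.contMDiffOn
        (fun x hx => hx.2)
    · exact α.shear.symm.contMDiff.comp_contMDiffOn
        ((contMDiffOn_symm_of_mem_maximalAtlas hcm).mono fun x hx => hx.1)
  · intro b hb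
    exact hb.2.1
  · rintro ⟨v, w⟩ hvw
    have h1 : (c.extend (I.prod J)) (α.shear ((φ.extend (I.prod J)).symm (v, w))) = (v, w) :=
      (φ.extend (I.prod J)).right_inv hvw
    exact congrArg Prod.fst h1

/-- The translation groupoid `P ⋊ K`: an arrow `(x, k)` has source `xk` and target `x`. -/
def translationGroupoid : SmoothGroupoid I (I.prod J) P (P × K) where
  s a := α.act a.1 a.2
  t a := a.1
  unit x := (x, 1)
  inv a := (α.act a.1 a.2, a.2⁻¹)
  comp a b _ := (a.1, a.2 * b.2)
  smooth_s := α.smooth_act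
  smooth_t := contMDiff_fst
  smooth_unit := contMDiff_id.prodMk contMDiff_const
  smooth_inv := α.smooth_act.prodMk contMDiff_snd.inv
  smooth_comp := fun _ => ⟨Set.univ, isOpen_univ, trivial,
    fun p => (p.1.1, p.1.2 * p.2.2),
    ((contMDiff_fst.comp contMDiff_fst).prodMk
      ((contMDiff_snd.comp contMDiff_fst).mul (contMDiff_snd.comp contMDiff_snd))).contMDiffOn,
    fun _ _ => rfl⟩
  s_unit := α.act_one
  t_unit _ := rfl
  s_inv a := by simp [← α.act_mul, α.act_one]
  t_inv _ := rfl
  s_comp a b e := by rw [α.act_mul, e]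
  t_comp _ _ _ := rfl
  assoc a b c _ _ := by simp [mul_assoc]
  comp_unit a := by simp
  unit_comp a := by simp
  inv_comp a := by simp
  comp_inv a := by simp
  submersion_s := α.isSubmersion_act

end LieRightAction

end Translation

end OrbifoldPresentation

end

/-!
A cocycle on an orbifold groupoid `G` with values in a compact Lie group `K` glues a principal
`K`-bundle over the objects, on which `G` acts from the left. If the cocycle is faithful, i.e.
injective on stabilizers, then this action is free and proper, so its quotient is a manifold `P`.
The group `K` acts on `P` from the right, and the bundle itself is an equivalence between `G` and
`P ⋊ K`.

Under the hypothesis on centers, a faithful cocycle is the product of two cocycles with values in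
unitary groups. The first consists of the Jacobians of arrows in frames which are orthonormal for an
invariant metric; it is trivial only on ineffective arrows, as an isometry of finite order is
determined by its derivative at a fixed point. The second is the action of arrows on the ineffective
stabilizers by conjugation. These are finite and locally constant, hence all of the same order `N`
as `G` is connected, so that the action takes values in the symmetric group on `N` letters, and it
is faithful on an ineffective stabilizer with trivial center.
-/

noncomputable section

namespace OrbifoldPresentation

/-! ### Manifolds glued from local homeomorphisms -/

section SmoothCover

variable {E F : Type*} [NormedAddCommGroup E] [NormedSpace ℝ E]
  [NormedAddCommGroup F] [NormedSpace ℝ F]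
  {H : Type*} [TopologicalSpace H] (I : ModelWithCorners ℝ E H)
  {X N : Type*} [TopologicalSpace X] [TopologicalSpace N]

/-- A chart of a manifold without boundary, read in a normed space `F` isomorphic to the model
normed space. -/
def linearChart [I.Boundaryless] (L : E ≃L[ℝ] F) (φ : OpenPartialHomeomorph N H) :
    OpenPartialHomeomorph N F :=
  φ.transHomeomorph (I.toHomeomorph.trans L.toHomeomorph)

section linearChart

variable [I.Boundaryless] (L : E ≃L[ℝ] F) {φ : OpenPartialHomeomorph N H}

variable [ChartedSpace H N]

theorem contMDiffOn_linearChart (hφ : φ ∈ IsManifold.maximalAtlas I ∞ N) :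
    ContMDiffOn I 𝓘(ℝ, F) ∞ (linearChart I L φ) (linearChart I L φ).source :=
  L.contDiff.contMDiff.comp_contMDiffOn
    (I.contMDiff.comp_contMDiffOn (contMDiffOn_of_mem_maximalAtlas hφ))

theorem contMDiffOn_linearChart_symm (hφ : φ ∈ IsManifold.maximalAtlas I ∞ N) :
    ContMDiffOn 𝓘(ℝ, F) I ∞ (linearChart I L φ).symm (linearChart I L φ).target := by
  have hI : ContMDiff 𝓘(ℝ, E) I ∞ I.symm := by
    simpa only [I.range_eq_univ, contMDiffOn_univ] using I.contMDiffOn_symm (n := ∞)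
  exact (contMDiffOn_symm_of_mem_maximalAtlas hφ).comp
    (hI.comp L.symm.contDiff.contMDiff).contMDiffOn fun _ hx => hx

end linearChart

variable [ChartedSpace H N]

variable (X N) in
/-- A family of local homeomorphisms with smooth transition maps from a space `X` to a manifold
`N`, with a choice `indexAt` of a member around every point; it makes `X` a manifold. -/
structure SmoothCover (ι : Type*) where
  chart : ι → OpenPartialHomeomorph X N
  indexAt : X → ι
  mem_source : ∀ x, x ∈ (chart (indexAt x)).source
  compat : ∀ a b, ContMDiffOn I I ∞ (fun y => chart b ((chart a).symm y))
    ((chart a).target ∩ (chart a).symm ⁻¹' (chart b).source)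

variable {I}

namespace SmoothCover

variable {ι : Type*} (c : SmoothCover I X N ι) [I.Boundaryless] (L : E ≃L[ℝ] F)

/-- The charted space structure on a space covered by local homeomorphisms to `N`. -/
abbrev chartedSpace : ChartedSpace F X where
  atlas := {f | ∃ a, ∃ φ ∈ atlas H N, f = (c.chart a).trans (linearChart I L φ)}
  chartAt x :=
    (c.chart (c.indexAt x)).trans (linearChart I L (chartAt H (c.chart (c.indexAt x) x)))
  mem_chart_source _ := ⟨c.mem_source _, mem_chart_source H _⟩
  chart_mem_atlas _ := ⟨_, _, chart_mem_atlas H _, rfl⟩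

variable [IsManifold I ∞ N]

theorem isManifold :
    letI := c.chartedSpace L
    IsManifold 𝓘(ℝ, F) ∞ X := by
  let := c.chartedSpace L
  refine isManifold_of_contDiffOn _ _ _ ?_
  rintro _ _ ⟨a, φ, hφ, rfl⟩ ⟨b, ψ, hψ, rfl⟩
  rw [← contMDiffOn_iff_contDiffOn]
  have hφ' := contMDiffOn_linearChart_symm I L (IsManifold.subset_maximalAtlas (n := ∞) hφ)
  have hψ' := contMDiffOn_linearChart I L (IsManifold.subset_maximalAtlas (n := ∞) hψ)
  refine (hψ'.comp ((c.compat a b).comp (hφ'.mono ?_) ?_) ?_).congr ?_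
  all_goals intro x hx
  all_goals simp only [OpenPartialHomeomorph.trans_source, OpenPartialHomeomorph.symm_source,
      OpenPartialHomeomorph.trans_symm_eq_symm_trans_symm,
      OpenPartialHomeomorph.coe_trans, modelWithCornersSelf_coe_symm, modelWithCornersSelf_coe,
      Set.mem_inter_iff, Set.mem_preimage, Function.comp_apply, id, Set.range_id, Set.preimage_id,
      Set.inter_univ] at hx ⊢
  all_goals tauto

theorem trans_linearChart_mem_maximalAtlas (a : ι) (y : N) :
    letI := c.chartedSpace L
    (c.chart a).trans (linearChart I L (chartAt H y)) ∈ IsManifold.maximalAtlas 𝓘(ℝ, F) ∞ X := by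
  let := c.chartedSpace L
  have := c.isManifold L
  exact IsManifold.subset_maximalAtlas ⟨a, _, chart_mem_atlas H y, rfl⟩

theorem contMDiffOn_chart (a : ι) :
    letI := c.chartedSpace L
    ContMDiffOn 𝓘(ℝ, F) I ∞ (c.chart a) (c.chart a).source := by
  let := c.chartedSpace L
  intro x hx
  set φ := linearChart I L (chartAt H (c.chart a x))
  set ψ := (c.chart a).trans φ
  have hxφ : c.chart a x ∈ φ.source := mem_chart_source H (c.chart a x)
  have hxψ : ψ.source ∈ 𝓝 x := ψ.open_source.mem_nhds ⟨hx, hxφ⟩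
  have hψ : ContMDiffAt 𝓘(ℝ, F) 𝓘(ℝ, F) ∞ ψ x :=
    (contMDiffOn_of_mem_maximalAtlas
      (c.trans_linearChart_mem_maximalAtlas L a _)).contMDiffAt hxψ
  have hφ : ContMDiffAt 𝓘(ℝ, F) I ∞ φ.symm (ψ x) :=
    (contMDiffOn_linearChart_symm I L (IsManifold.chart_mem_maximalAtlas _)).contMDiffAt
      (φ.open_target.mem_nhds (φ.map_source hxφ))
  refine ((hφ.comp x hψ).congr_of_eventuallyEq ?_).contMDiffWithinAt
  filter_upwards [hxψ] with y hy using (φ.left_inv hy.2).symm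

theorem contMDiffOn_chart_symm (a : ι) :
    letI := c.chartedSpace L
    ContMDiffOn I 𝓘(ℝ, F) ∞ (c.chart a).symm (c.chart a).target := by
  let := c.chartedSpace L
  intro z hz
  set φ := linearChart I L (chartAt H z)
  set ψ := (c.chart a).trans φ
  have hzφ : z ∈ φ.source := mem_chart_source H z
  have hφ : ContMDiffAt I 𝓘(ℝ, F) ∞ φ z :=
    (contMDiffOn_linearChart I L (IsManifold.chart_mem_maximalAtlas _)).contMDiffAt
      (φ.open_source.mem_nhds hzφ)
  have hψ : ContMDiffAt 𝓘(ℝ, F) 𝓘(ℝ, F) ∞ ψ.symm (φ z) := by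
    refine (contMDiffOn_symm_of_mem_maximalAtlas
      (c.trans_linearChart_mem_maximalAtlas L a _)).contMDiffAt (ψ.open_target.mem_nhds
        ⟨φ.map_source hzφ, ?_⟩)
    change φ.symm (φ z) ∈ (c.chart a).target
    rwa [φ.left_inv hzφ]
  refine ((hψ.comp z hφ).congr_of_eventuallyEq ?_).contMDiffWithinAt
  filter_upwards [φ.open_source.mem_nhds hzφ] with y hy
  exact congrArg (c.chart a).symm (φ.left_inv hy).symm

end SmoothCover

end SmoothCover

/-! ### The Lie group of unitary elements -/

section Cayley

/-- The Cayley transform `(1 - a) / (1 + a)`, with the junk value `0` when `1 + a` is not a unit. It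
exchanges unitary and skew-adjoint elements, which gives charts of the unitary group. -/
def cayley {A : Type*} [Ring A] (a : A) : A := (1 - a) * Ring.inverse (1 + a)

section Ring

variable {A : Type*} [Ring A] {a : A}

theorem cayley_mul_one_add (h : IsUnit (1 + a)) : cayley a * (1 + a) = 1 - a := by
  rw [cayley, mul_assoc, Ring.inverse_mul_cancel _ h, mul_one]

theorem one_add_mul_cayley (h : IsUnit (1 + a)) : (1 + a) * cayley a = 1 - a := by
  have hcomm : (1 + a) * (1 - a) = (1 - a) * (1 + a) := by noncomm_ring
  rw [cayley, ← mul_assoc, hcomm, mul_assoc, Ring.mul_inverse_cancel _ h, mul_one]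

theorem one_add_cayley_mul_one_add (h : IsUnit (1 + a)) : (1 + cayley a) * (1 + a) = 2 := by
  rw [add_mul, cayley_mul_one_add h, ← one_add_one_eq_two]
  noncomm_ring

theorem isUnit_one_add_cayley (h2 : IsUnit (2 : A)) (h : IsUnit (1 + a)) :
    IsUnit (1 + cayley a) :=
  (IsUnit.mul_right_iff h).1 (by rwa [one_add_cayley_mul_one_add h])

theorem cayley_cayley (h2 : IsUnit (2 : A)) (h : IsUnit (1 + a)) : cayley (cayley a) = a := by
  refine (isUnit_one_add_cayley h2 h).mul_right_cancel ?_
  rw [cayley_mul_one_add (isUnit_one_add_cayley h2 h)]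
  linear_combination (norm := noncomm_ring) -one_add_mul_cayley h

variable [StarRing A]

theorem star_cayley_of_mem_unitary (ha : a ∈ unitary A) (h : IsUnit (1 + a)) :
    star (cayley a) = -cayley a := by
  have hstar : (1 + star a) * star (cayley a) = 1 - star a := by
    simpa using congrArg star (cayley_mul_one_add h)
  refine (show IsUnit (1 + star a) by simpa using h.star).mul_left_cancel (h.mul_right_cancel ?_)
  rw [hstar, mul_assoc, neg_mul, cayley_mul_one_add h]
  linear_combination (norm := noncomm_ring) (-2 : ℤ) • Unitary.star_mul_self_of_mem ha

theorem cayley_mem_unitary (ha : star a = -a) (h : IsUnit (1 + a)) : cayley a ∈ unitary A := by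
  have h' : IsUnit (1 - a) := by simpa [ha, sub_eq_add_neg] using h.star
  have hleft : (1 - a) * star (cayley a) = 1 + a := by
    simpa [ha, sub_eq_add_neg] using congrArg star (cayley_mul_one_add h)
  have hright : star (cayley a) * (1 - a) = 1 + a := by
    simpa [ha, sub_eq_add_neg] using congrArg star (one_add_mul_cayley h)
  constructor
  · refine h'.mul_left_cancel (h.mul_right_cancel ?_)
    rw [← mul_assoc, hleft, mul_assoc, cayley_mul_one_add h]
    noncomm_ring
  · refine h.mul_left_cancel (h'.mul_right_cancel ?_)
    rw [← mul_assoc, one_add_mul_cayley h, mul_assoc, hright]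
    noncomm_ring

/-- An element as an element of the unitary group, with the junk value `1` if it is not unitary. -/
def toUnitary (a : A) : unitary A :=
  open Classical in if h : a ∈ unitary A then ⟨a, h⟩ else 1

theorem coe_toUnitary (h : a ∈ unitary A) : (toUnitary a : A) = a := by
  rw [toUnitary, dif_pos h]

end Ring

theorem isUnit_two_of_algebra_real (A : Type*) [Ring A] [Algebra ℝ A] : IsUnit (2 : A) := by
  have h := (IsUnit.mk0 (2 : ℝ) two_ne_zero).map (algebraMap ℝ A)
  rwa [map_ofNat] at h

theorem contDiffAt_cayley {A : Type*} [NormedRing A] [NormedAlgebra ℝ A] [CompleteSpace A] {a : A}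
    (h : IsUnit (1 + a)) : ContDiffAt ℝ ∞ (cayley : A → A) a := by
  obtain ⟨v, hv⟩ := h
  have hinv : ContDiffAt ℝ ∞ (Ring.inverse : A → A) (1 + a) := hv ▸ contDiffAt_ringInverse ℝ v
  exact (contDiffAt_const.sub contDiffAt_id).mul
    (hinv.comp a (contDiffAt_const.add contDiffAt_id))

theorem isOpen_setOf_isUnit_one_add {A X : Type*} [NormedRing A] [CompleteSpace A]
    [TopologicalSpace X] {f : X → A} (hf : Continuous f) : IsOpen {x | IsUnit (1 + f x)} :=
  Units.isOpen.preimage (continuous_const.add hf)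

variable {A : Type*} [NormedRing A] [NormedAlgebra ℝ A] [StarRing A] [StarModule ℝ A]

variable (A) in
/-- The Lie algebra of the unitary group, as a normed space. -/
abbrev Skew : Type _ := skewAdjoint.submodule ℝ A

theorem contDiffAt_cayley_coe [CompleteSpace A] {a : Skew A} (ha : IsUnit (1 + (a : A))) :
    ContDiffAt ℝ ∞ (fun b : Skew A => cayley (b : A)) a :=
  (contDiffAt_cayley ha).comp a (skewAdjoint.submodule ℝ A).subtypeL.contDiff.contDiffAt

variable [ContinuousStar A]

variable (A) in
/-- The projection `a ↦ (a - a*) / 2` to the skew-adjoint part, as a map to `Skew A`. -/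
def skewProj : A →L[ℝ] Skew A := skewAdjointPartL ℝ A

theorem coe_skewProj {a : A} (ha : star a = -a) : (skewProj A a : A) = a := by
  change ((skewAdjointPart ℝ a : skewAdjoint A) : A) = a
  rw [skewAdjointPart_apply_coe, ha, sub_neg_eq_add, ← two_smul ℝ a, invOf_smul_smul]

theorem coe_skewProj_cayley {v : unitary A} (hv : IsUnit (1 + (v : A))) :
    (skewProj A (cayley (v : A)) : A) = cayley (v : A) :=
  coe_skewProj (star_cayley_of_mem_unitary v.2 hv)

variable [CompleteSpace A]

variable (A) in
/-- The Cayley chart of the unitary group at the identity. -/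
def cayleyChartOne : OpenPartialHomeomorph (unitary A) (Skew A) where
  toFun v := skewProj A (cayley (v : A))
  invFun a := toUnitary (cayley (a : A))
  source := {v | IsUnit (1 + (v : A))}
  target := {a | IsUnit (1 + (a : A))}
  map_source' v hv := by
    rw [Set.mem_ofPred_eq, coe_skewProj_cayley hv]
    exact isUnit_one_add_cayley (isUnit_two_of_algebra_real A) hv
  map_target' a ha := by
    rw [Set.mem_ofPred_eq, coe_toUnitary (cayley_mem_unitary a.2 ha)]
    exact isUnit_one_add_cayley (isUnit_two_of_algebra_real A) ha
  left_inv' v hv := by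
    have hv' : IsUnit (1 + (skewProj A (cayley (v : A)) : A)) := by
      rw [coe_skewProj_cayley hv]
      exact isUnit_one_add_cayley (isUnit_two_of_algebra_real A) hv
    ext
    rw [coe_toUnitary (cayley_mem_unitary (skewProj A (cayley (v : A))).2 hv'),
      coe_skewProj_cayley hv, cayley_cayley (isUnit_two_of_algebra_real A) hv]
  right_inv' a ha := by
    ext
    rw [coe_toUnitary (cayley_mem_unitary a.2 ha),
      cayley_cayley (isUnit_two_of_algebra_real A) ha, coe_skewProj a.2]
  open_source := isOpen_setOf_isUnit_one_add continuous_subtype_val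
  open_target := isOpen_setOf_isUnit_one_add continuous_subtype_val
  continuousOn_toFun v hv := ((skewProj A).continuous.continuousAt.comp
    ((contDiffAt_cayley hv).continuousAt.comp
      continuous_subtype_val.continuousAt)).continuousWithinAt
  continuousOn_invFun := by
    refine Topology.IsInducing.subtypeVal.continuousOn_iff.2 fun a ha => ?_
    exact (contDiffAt_cayley_coe ha).continuousAt.continuousWithinAt.congr
      (fun b hb => coe_toUnitary (cayley_mem_unitary b.2 hb))
      (coe_toUnitary (cayley_mem_unitary a.2 ha))

/-- The Cayley chart of the unitary group centred at `u`. -/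
def cayleyChart (u : unitary A) : OpenPartialHomeomorph (unitary A) (Skew A) :=
  (Homeomorph.mulLeft u⁻¹).transOpenPartialHomeomorph (cayleyChartOne A)

theorem mem_cayleyChart_source {u v : unitary A} :
    v ∈ (cayleyChart u).source ↔ IsUnit (1 + star (u : A) * v) := Iff.rfl

theorem mem_cayleyChart_target {u : unitary A} {a : Skew A} :
    a ∈ (cayleyChart u).target ↔ IsUnit (1 + (a : A)) := Iff.rfl

theorem coe_cayleyChart_symm (u : unitary A) {a : Skew A} (ha : a ∈ (cayleyChart u).target) :
    ((cayleyChart u).symm a : A) = u * cayley (a : A) := by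
  rw [← coe_toUnitary (cayley_mem_unitary a.2 (mem_cayleyChart_target.1 ha))]
  change (((u⁻¹)⁻¹ * toUnitary (cayley (a : A)) : unitary A) : A) = _
  rw [inv_inv, Submonoid.coe_mul]

theorem self_mem_cayleyChart_source (u : unitary A) : u ∈ (cayleyChart u).source := by
  rw [mem_cayleyChart_source, Unitary.coe_star_mul_self, one_add_one_eq_two]
  exact isUnit_two_of_algebra_real A

theorem contDiffAt_coe_cayleyChart_symm {u : unitary A} {a : Skew A}
    (ha : a ∈ (cayleyChart u).target) :
    ContDiffAt ℝ ∞ (fun b : Skew A => ((cayleyChart u).symm b : A)) a := by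
  have hmul : ContDiffAt ℝ ∞ (fun b : Skew A => (u : A) * cayley (b : A)) a :=
    contDiffAt_const.mul (contDiffAt_cayley_coe ha)
  refine hmul.congr_of_eventuallyEq ?_
  filter_upwards [(cayleyChart u).open_target.mem_nhds ha] with b hb
    using coe_cayleyChart_symm u hb

theorem contDiffAt_skewProj_cayley_star_mul {u v : unitary A} (hv : v ∈ (cayleyChart u).source) :
    ContDiffAt ℝ ∞ (fun a : A => skewProj A (cayley (star (u : A) * a))) (v : A) :=
  (skewProj A).contDiff.contDiffAt.comp _ (ContDiffAt.comp (f := fun a : A => star (u : A) * a) _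
    (contDiffAt_cayley hv) (contDiffAt_const.mul contDiffAt_id))

variable (A) in
/-- The Cayley atlas of the unitary group. -/
def cayleyCover : SmoothCover 𝓘(ℝ, Skew A) (unitary A) (Skew A) (unitary A) where
  chart := cayleyChart
  indexAt := id
  mem_source := self_mem_cayleyChart_source
  compat u v := fun a ⟨ha, hav⟩ => by
    exact ((contDiffAt_skewProj_cayley_star_mul hav).comp a
      (contDiffAt_coe_cayleyChart_symm ha)).contMDiffAt.contMDiffWithinAt

variable [FiniteDimensional ℝ (Skew A)]

instance : ChartedSpace (EuclideanSpace ℝ (Fin (Module.finrank ℝ (Skew A)))) (unitary A) :=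
  (cayleyCover A).chartedSpace toEuclidean

instance : IsManifold (𝓡 (Module.finrank ℝ (Skew A))) ∞ (unitary A) :=
  (cayleyCover A).isManifold toEuclidean

theorem contMDiff_coe_unitary :
    ContMDiff (𝓡 (Module.finrank ℝ (Skew A))) 𝓘(ℝ, A) ∞ ((↑) : unitary A → A) := by
  intro u
  have hu := self_mem_cayleyChart_source u
  have hsource := (cayleyChart u).open_source.mem_nhds hu
  have hchart : ContMDiffAt (𝓡 (Module.finrank ℝ (Skew A))) 𝓘(ℝ, Skew A) ∞ (cayleyChart u) u :=
    ((cayleyCover A).contMDiffOn_chart toEuclidean u).contMDiffAt hsource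
  refine ((contDiffAt_coe_cayleyChart_symm ((cayleyChart u).map_source hu)).contMDiffAt.comp u
    hchart).congr_of_eventuallyEq ?_
  filter_upwards [hsource] with v hv
  exact congrArg Subtype.val ((cayleyChart u).left_inv hv).symm

variable {E' : Type*} [NormedAddCommGroup E'] [NormedSpace ℝ E']
  {H' : Type*} [TopologicalSpace H'] {I' : ModelWithCorners ℝ E' H'}
  {M : Type*} [TopologicalSpace M] [ChartedSpace H' M]

theorem contMDiffWithinAt_of_coe_unitary {f : M → unitary A} {s : Set M} {x : M}
    (hf : ContMDiffWithinAt I' 𝓘(ℝ, A) ∞ (fun y => (f y : A)) s x) :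
    ContMDiffWithinAt I' (𝓡 (Module.finrank ℝ (Skew A))) ∞ f s x := by
  set u := f x
  have hx : f x ∈ (cayleyChart u).source := self_mem_cayleyChart_source u
  have hsymm : ContMDiffAt 𝓘(ℝ, Skew A) (𝓡 (Module.finrank ℝ (Skew A))) ∞ (cayleyChart u).symm
      (cayleyChart u (f x)) :=
    ((cayleyCover A).contMDiffOn_chart_symm toEuclidean u).contMDiffAt
      ((cayleyChart u).open_target.mem_nhds ((cayleyChart u).map_source hx))
  have hchart : ContMDiffWithinAt I' 𝓘(ℝ, Skew A) ∞ (fun y => cayleyChart u (f y)) s x :=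
    (contDiffAt_skewProj_cayley_star_mul hx).contMDiffAt.comp_contMDiffWithinAt
      (f := fun y => (f y : A)) x hf
  have hcont : ContinuousWithinAt f s x :=
    Topology.IsInducing.subtypeVal.continuousWithinAt_iff.2 hf.continuousWithinAt
  refine (hsymm.comp_contMDiffWithinAt x hchart).congr_of_eventuallyEq ?_
    ((cayleyChart u).left_inv hx).symm
  filter_upwards [hcont.preimage_mem_nhdsWithin
    ((cayleyChart u).open_source.mem_nhds hx)] with y hy using ((cayleyChart u).left_inv hy).symm

instance : LieGroup (𝓡 (Module.finrank ℝ (Skew A))) ∞ (unitary A) where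
  contMDiff_mul p := by
    refine contMDiffWithinAt_univ.1 (contMDiffWithinAt_of_coe_unitary ?_)
    have hmul : ContDiff ℝ ∞ (fun q : A × A => q.1 * q.2) := contDiff_mul
    exact (hmul.contMDiff.comp ((contMDiff_coe_unitary.comp contMDiff_fst).prodMk_space
      (contMDiff_coe_unitary.comp contMDiff_snd))).contMDiffAt
  contMDiff_inv p := by
    refine contMDiffWithinAt_univ.1 (contMDiffWithinAt_of_coe_unitary ?_)
    have hstar : ContDiff ℝ ∞ (star : A → A) := (starL' ℝ : A ≃L[ℝ] A).contDiff
    exact (hstar.contMDiff.comp contMDiff_coe_unitary).contMDiffAt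

end Cayley

instance {A : Type*} [NormedRing A] [StarRing A] [CStarRing A] [ProperSpace A] :
    CompactSpace (unitary A) := by
  refine isCompact_iff_compactSpace.1 (Metric.isCompact_of_isClosed_isBounded isClosed_unitary ?_)
  refine (Metric.isBounded_iff_subset_closedBall 0).2 ⟨1, fun a ha => ?_⟩
  rw [mem_closedBall_zero_iff]
  rcases subsingleton_or_nontrivial A with _ | _
  · simp [Subsingleton.elim a 0]
  · exact (CStarRing.norm_of_mem_unitary ha).le

/-! ### Arrows of orbifold groupoids -/

section Basic

variable {E₀ E₁ : Type*} [NormedAddCommGroup E₀] [NormedSpace ℝ E₀]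
  [NormedAddCommGroup E₁] [NormedSpace ℝ E₁]
  {H₀ H₁ : Type*} [TopologicalSpace H₀] [TopologicalSpace H₁]
  {I₀ : ModelWithCorners ℝ E₀ H₀} {I₁ : ModelWithCorners ℝ E₁ H₁}
  {G₀ G₁ : Type*} [TopologicalSpace G₀] [ChartedSpace H₀ G₀]
  [TopologicalSpace G₁] [ChartedSpace H₁ G₁]

namespace SmoothGroupoid

variable (G : SmoothGroupoid I₀ I₁ G₀ G₁) {g g' h k : G₁}

open Classical in
/-- The composite of two arrows, with the junk value `g` if they are not composable. -/
def mul (g h : G₁) : G₁ := if e : G.s g = G.t h then G.comp g h e else g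

theorem mul_eq_comp (e : G.s g = G.t h) : G.mul g h = G.comp g h e := dif_pos e

theorem s_mul (e : G.s g = G.t h) : G.s (G.mul g h) = G.s h := by
  rw [G.mul_eq_comp e, G.s_comp]

theorem t_mul (e : G.s g = G.t h) : G.t (G.mul g h) = G.t g := by
  rw [G.mul_eq_comp e, G.t_comp]

protected theorem mul_assoc (e : G.s g = G.t h) (e' : G.s h = G.t k) :
    G.mul (G.mul g h) k = G.mul g (G.mul h k) := by
  rw [G.mul_eq_comp e, G.mul_eq_comp e', G.mul_eq_comp ((G.s_comp g h e).trans e'),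
    G.mul_eq_comp (e.trans (G.t_comp h k e').symm), G.assoc]

theorem mul_unit (g : G₁) : G.mul g (G.unit (G.s g)) = g := by
  rw [G.mul_eq_comp (G.t_unit _).symm, G.comp_unit]

theorem unit_mul (g : G₁) : G.mul (G.unit (G.t g)) g = g := by
  rw [G.mul_eq_comp (G.s_unit _), G.unit_comp]

theorem inv_mul_self (g : G₁) : G.mul (G.inv g) g = G.unit (G.s g) := by
  rw [G.mul_eq_comp (G.s_inv _), G.inv_comp]

theorem mul_inv_self (g : G₁) : G.mul g (G.inv g) = G.unit (G.t g) := by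
  rw [G.mul_eq_comp (G.t_inv _).symm, G.comp_inv]

protected theorem inv_mul_cancel_right (e : G.s g = G.s h) :
    G.mul (G.mul g (G.inv h)) h = g := by
  rw [G.mul_assoc (e.trans (G.t_inv h).symm) (G.s_inv h), G.inv_mul_self, ← e, G.mul_unit]

protected theorem mul_inv_cancel_right (e : G.s g = G.t h) :
    G.mul (G.mul g h) (G.inv h) = g := by
  rw [G.mul_assoc e (G.t_inv h).symm, G.mul_inv_self, ← e, G.mul_unit]

protected theorem mul_right_cancel (e : G.s g = G.t h) (e' : G.s g' = G.t h)
    (hh : G.mul g h = G.mul g' h) : g = g' := by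
  rw [← G.mul_inv_cancel_right e, hh, G.mul_inv_cancel_right e']

theorem tendsto_mul {ι : Type*} {l : Filter ι} {a b : ι → G₁} (e : G.s g = G.t h)
    (ha : Filter.Tendsto a l (𝓝 g)) (hb : Filter.Tendsto b l (𝓝 h))
    (hab : ∀ᶠ i in l, G.s (a i) = G.t (b i)) :
    Filter.Tendsto (fun i => G.mul (a i) (b i)) l (𝓝 (G.mul g h)) := by
  obtain ⟨U, hU, hghU, F, hF, hFcomp⟩ := G.smooth_comp ⟨(g, h), e⟩
  have hpair : Filter.Tendsto (fun i => (a i, b i)) l (𝓝 (g, h)) := ha.prodMk_nhds hb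
  have hFgh : F (g, h) = G.mul g h := by rw [G.mul_eq_comp e, hFcomp ⟨(g, h), e⟩ hghU]
  rw [← hFgh]
  refine ((hF.continuousOn.continuousAt (hU.mem_nhds hghU)).tendsto.comp hpair).congr' ?_
  filter_upwards [hab, hpair.eventually (hU.mem_nhds hghU)] with i hi hiU
  rw [G.mul_eq_comp hi]
  exact hFcomp ⟨(a i, b i), hi⟩ hiU

end SmoothGroupoid

namespace OrbifoldGroupoid

variable (G : OrbifoldGroupoid I₀ I₁ G₀ G₁)

/-- The local section of the source map through an arrow. -/
def sec (g : G₁) : G₀ → G₁ := (G.etale g).localInverse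

theorem sec_s_self (g : G₁) : G.sec g (G.s g) = g :=
  (G.etale g).localInverse_left_inv (G.etale g).localInverse_mem_target

theorem eventually_s_sec (g : G₁) : ∀ᶠ y in 𝓝 (G.s g), G.s (G.sec g y) = y :=
  (G.etale g).localInverse_eventuallyEq_right

theorem eventually_sec_s (g : G₁) : ∀ᶠ h in 𝓝 g, G.sec g (G.s h) = h :=
  (G.etale g).localInverse_eventuallyEq_left

theorem eventually_contMDiffAt_sec (g : G₁) :
    ∀ᶠ y in 𝓝 (G.s g), ContMDiffAt I₀ I₁ ∞ (G.sec g) y := by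
  have hopen := (G.etale g).localInverse_open_source
  filter_upwards [hopen.mem_nhds (G.etale g).localInverse_mem_source] with y hy
  exact (G.etale g).localInverse_contMDiffOn.contMDiffAt (hopen.mem_nhds hy)

theorem contMDiffAt_sec (g : G₁) : ContMDiffAt I₀ I₁ ∞ (G.sec g) (G.s g) :=
  (G.eventually_contMDiffAt_sec g).self_of_nhds

theorem tendsto_sec (g : G₁) : Filter.Tendsto (G.sec g) (𝓝 (G.s g)) (𝓝 g) := by
  simpa only [G.sec_s_self] using (G.contMDiffAt_sec g).continuousAt.tendsto

theorem eventually_eq_of_tendsto {ι : Type*} {l : Filter ι} {a b : ι → G₁} {g : G₁}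
    (ha : Filter.Tendsto a l (𝓝 g)) (hb : Filter.Tendsto b l (𝓝 g))
    (hab : ∀ᶠ i in l, G.s (a i) = G.s (b i)) : ∀ᶠ i in l, a i = b i := by
  filter_upwards [ha.eventually (G.eventually_sec_s g), hb.eventually (G.eventually_sec_s g), hab]
    with i hai hbi hs
  rw [← hai, ← hbi, hs]

end OrbifoldGroupoid

end Basic

/-! ### The principal bundle of a cocycle -/

section Cocycle

variable {E₀ E₁ V : Type*} [NormedAddCommGroup E₀] [NormedSpace ℝ E₀]
  [NormedAddCommGroup E₁] [NormedSpace ℝ E₁] [NormedAddCommGroup V] [NormedSpace ℝ V]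
  {H₀ H₁ W : Type*} [TopologicalSpace H₀] [TopologicalSpace H₁] [TopologicalSpace W]
  {I₀ : ModelWithCorners ℝ E₀ H₀} {I₁ : ModelWithCorners ℝ E₁ H₁} {J : ModelWithCorners ℝ V W}
  {G₀ G₁ K : Type*} [TopologicalSpace G₀] [ChartedSpace H₀ G₀]
  [TopologicalSpace G₁] [ChartedSpace H₁ G₁]
  [TopologicalSpace K] [ChartedSpace W K] [Group K]

/-- A faithful smooth cocycle on an orbifold groupoid with values in a Lie group, relative to an
open cover of the objects, which for convenience is indexed by the objects themselves. It is a
smooth functor to the group, defined on the groupoid pulled back to the cover, that is injective on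
stabilizers; `val y x g` is its value at the arrow `g` from `U x` to `U y`. -/
structure FaithfulCocycle (G : OrbifoldGroupoid I₀ I₁ G₀ G₁) (J : ModelWithCorners ℝ V W)
    (K : Type*) [TopologicalSpace K] [ChartedSpace W K] [Group K] where
  U : G₀ → Set G₀
  isOpen_U : ∀ x, IsOpen (U x)
  mem_U : ∀ x, x ∈ U x
  val : G₀ → G₀ → G₁ → K
  smooth : ∀ x y, ContMDiffOn I₁ J ∞ (val y x) {g | G.s g ∈ U x ∧ G.t g ∈ U y}
  cocycle : ∀ x y z g h, G.s g = G.t h → G.s h ∈ U x → G.s g ∈ U y → G.t g ∈ U z →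
    val z y g * val y x h = val z x (G.mul g h)
  faithful : ∀ x g, G.s g = G.t g → G.s g ∈ U x → val x x g = 1 → g = G.unit (G.s g)

namespace FaithfulCocycle

variable {G : OrbifoldGroupoid I₀ I₁ G₀ G₁} (c : FaithfulCocycle G J K)

theorem val_unit {x y : G₀} (h : y ∈ c.U x) : c.val x x (G.unit y) = 1 := by
  have hmul := c.cocycle x x x (G.unit y) (G.unit y) (by rw [G.s_unit, G.t_unit])
    (by rwa [G.s_unit]) (by rwa [G.s_unit]) (by rwa [G.t_unit])
  have hunit := G.mul_unit (G.unit y)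
  rw [G.s_unit] at hunit
  rw [hunit] at hmul
  exact mul_eq_left.1 hmul

theorem val_unit_mul {x y z : G₀} {g : G₁} (hx : G.s g ∈ c.U x) (hy : G.t g ∈ c.U y)
    (hz : G.t g ∈ c.U z) : c.val z y (G.unit (G.t g)) * c.val y x g = c.val z x g := by
  rw [c.cocycle x y z _ g (G.s_unit _) hx (by rwa [G.s_unit]) (by rwa [G.t_unit]), G.unit_mul]

theorem val_mul_unit {x y z : G₀} {g : G₁} (hx : G.s g ∈ c.U x) (hy : G.s g ∈ c.U y)
    (hz : G.t g ∈ c.U z) : c.val z y g * c.val y x (G.unit (G.s g)) = c.val z x g := by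
  rw [c.cocycle x y z g _ (G.t_unit _).symm (by rwa [G.s_unit]) hy hz, G.mul_unit]

theorem val_unit_mul_val_unit {x y z w : G₀} (hx : w ∈ c.U x) (hy : w ∈ c.U y) (hz : w ∈ c.U z) :
    c.val z y (G.unit w) * c.val y x (G.unit w) = c.val z x (G.unit w) := by
  have h := c.val_unit_mul (g := G.unit w) (x := x) (y := y) (z := z)
    (by rwa [G.s_unit]) (by rwa [G.t_unit]) (by rwa [G.t_unit])
  rwa [G.t_unit] at h

theorem contMDiffOn_val_unit (x y : G₀) :
    ContMDiffOn I₀ J ∞ (fun w => c.val y x (G.unit w)) (c.U x ∩ c.U y) :=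
  (c.smooth x y).comp G.smooth_unit.contMDiffOn fun w hw =>
    ⟨(G.s_unit w).symm ▸ hw.1, (G.t_unit w).symm ▸ hw.2⟩

variable [LieGroup J ∞ K]

/-- The principal bundle of a cocycle, glued from the products `c.U i × K`. -/
def core : FiberBundleCore G₀ G₀ K where
  baseSet := c.U
  isOpen_baseSet := c.isOpen_U
  indexAt := id
  mem_baseSet_at := c.mem_U
  coordChange i j x v := c.val j i (G.unit x) * v
  coordChange_self i x hx v := by rw [c.val_unit hx, one_mul]
  continuousOn_coordChange i j := by
    have : ContinuousMul K := continuousMul_of_contMDiffMul J ∞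
    exact ((c.contMDiffOn_val_unit i j).continuousOn.comp continuousOn_fst fun p hp => hp.1).mul
      continuousOn_snd
  coordChange_comp i j l x hx v := by
    rw [← mul_assoc, c.val_unit_mul_val_unit hx.1.1 hx.1.2 hx.2]

/-- The total space of the principal bundle of a cocycle. -/
abbrev Total : Type _ := c.core.TotalSpace

/-- The fibre coordinate of a point of the principal bundle. -/
def fib (q : c.Total) : K := q.snd

/-- The fibre coordinate in the trivialization over `c.U i`. -/
def triv (i : G₀) (q : c.Total) : K := c.val i q.proj (G.unit q.proj) * c.fib q

/-- The inverse of the trivialization over `c.U i`. -/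
def ofTriv (i : G₀) (a : G₀ × K) : c.Total := ⟨a.1, c.val a.1 i (G.unit a.1) * a.2⟩

theorem localTriv_apply (i : G₀) (q : c.Total) :
    (c.core.localTriv i).toOpenPartialHomeomorph q = (q.proj, c.triv i q) := rfl

theorem localTriv_symm_apply (i : G₀) (a : G₀ × K) :
    (c.core.localTriv i).toOpenPartialHomeomorph.symm a = c.ofTriv i a := rfl

theorem mem_localTriv_target (i : G₀) (a : G₀ × K) :
    a ∈ (c.core.localTriv i).toOpenPartialHomeomorph.target ↔ a.1 ∈ c.U i :=
  c.core.mem_localTriv_target i a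

theorem triv_ofTriv {i j : G₀} {a : G₀ × K} (hi : a.1 ∈ c.U i) (hj : a.1 ∈ c.U j) :
    c.triv j (c.ofTriv i a) = c.val j i (G.unit a.1) * a.2 := by
  simp only [triv, ofTriv, fib]
  rw [← mul_assoc, c.val_unit_mul_val_unit hi (c.mem_U _) hj]

theorem ofTriv_triv {i : G₀} {q : c.Total} (hi : q.proj ∈ c.U i) :
    c.ofTriv i (q.proj, c.triv i q) = q :=
  (c.core.localTriv i).toOpenPartialHomeomorph.left_inv hi

theorem ext_triv {i : G₀} {q q' : c.Total} (h : q.proj = q'.proj) (hi : q.proj ∈ c.U i)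
    (ht : c.triv i q = c.triv i q') : q = q' := by
  rw [← c.ofTriv_triv hi, ← c.ofTriv_triv (h ▸ hi : q'.proj ∈ c.U i), ht, h]

/-- The local trivializations, as an atlas modelled on `G₀ × K`. -/
def totalCover : SmoothCover (I₀.prod J) c.Total (G₀ × K) G₀ where
  chart i := (c.core.localTriv i).toOpenPartialHomeomorph
  indexAt q := q.proj
  mem_source q := c.mem_U q.proj
  compat i j := by
    have hchange : ContMDiffOn (I₀.prod J) (I₀.prod J) ∞
        (fun a : G₀ × K => (a.1, c.val j i (G.unit a.1) * a.2)) (Prod.fst ⁻¹' (c.U i ∩ c.U j)) :=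
      contMDiffOn_fst.prodMk (((c.contMDiffOn_val_unit i j).comp contMDiffOn_fst fun a ha => ha).mul
        contMDiffOn_snd)
    refine (hchange.mono ?_).congr ?_
    · rintro a ⟨hi, hj⟩
      exact ⟨(c.mem_localTriv_target i a).1 hi, hj⟩
    · rintro a ⟨hi, hj⟩
      rw [localTriv_symm_apply, localTriv_apply,
        c.triv_ofTriv ((c.mem_localTriv_target i a).1 hi) hj]
      rfl

theorem isOpen_proj_mem (i : G₀) : IsOpen {q : c.Total | q.proj ∈ c.U i} :=
  (c.isOpen_U i).preimage c.core.continuous_proj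

instance [SecondCountableTopology G₀] [SecondCountableTopology K] :
    SecondCountableTopology c.Total := by
  obtain ⟨s, hs, hcov⟩ := TopologicalSpace.countable_cover_nhds
    (f := c.U) fun x => (c.isOpen_U x).mem_nhds (c.mem_U x)
  have : Countable s := hs
  have (i : s) : SecondCountableTopology {q : c.Total | q.proj ∈ c.U i} :=
    (c.core.localTriv i).toOpenPartialHomeomorph.secondCountableTopology_source
  refine TopologicalSpace.secondCountableTopology_of_countable_cover
    (U := fun i : s => {q : c.Total | q.proj ∈ c.U i})
    (fun i => c.isOpen_proj_mem i) ?_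
  refine Set.eq_univ_of_forall fun q => ?_
  have hq : q.proj ∈ ⋃ x ∈ s, c.U x := hcov ▸ Set.mem_univ _
  simpa using hq

/-- The left action of the groupoid on the principal bundle, meaningful for `G.s g = q.proj`. -/
def actL (g : G₁) (q : c.Total) : c.Total := ⟨G.t g, c.val (G.t g) q.proj g * c.fib q⟩

/-- The right action of the group on the principal bundle. -/
def actR (q : c.Total) (l : K) : c.Total := ⟨q.proj, c.fib q * l⟩

theorem triv_actR (i : G₀) (q : c.Total) (l : K) : c.triv i (c.actR q l) = c.triv i q * l :=
  (mul_assoc _ _ _).symm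

theorem triv_actL {i j : G₀} {g : G₁} {q : c.Total} (e : G.s g = q.proj) (hi : q.proj ∈ c.U i)
    (hj : G.t g ∈ c.U j) : c.triv j (c.actL g q) = c.val j i g * c.triv i q := by
  change c.val j (G.t g) (G.unit (G.t g)) * (c.val (G.t g) q.proj g * c.fib q) =
    c.val j i g * (c.val i q.proj (G.unit q.proj) * c.fib q)
  have hg : G.s g ∈ c.U q.proj := e ▸ c.mem_U q.proj
  rw [← mul_assoc, ← mul_assoc, c.val_unit_mul hg (c.mem_U _) hj, ← e,
    c.val_mul_unit (c.mem_U _) (by rwa [e]) hj]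

theorem actL_unit (q : c.Total) : c.actL (G.unit q.proj) q = q := by
  have ht : G.t (G.unit q.proj) ∈ c.U q.proj := by rw [G.t_unit]; exact c.mem_U _
  refine c.ext_triv (i := q.proj) (G.t_unit _) ht ?_
  rw [c.triv_actL (G.s_unit _) (c.mem_U _) ht, c.val_unit (c.mem_U _), one_mul]

theorem actL_actL {g h : G₁} {q : c.Total} (e : G.s g = G.t h) (e' : G.s h = q.proj) :
    c.actL g (c.actL h q) = c.actL (G.mul g h) q := by
  refine c.ext_triv (i := G.t g) (G.t_mul e).symm (c.mem_U _) ?_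
  rw [c.triv_actL (i := G.t h) e (c.mem_U _) (c.mem_U _),
    c.triv_actL (i := q.proj) e' (c.mem_U _) (c.mem_U _),
    c.triv_actL (i := q.proj) ((G.s_mul e).trans e') (c.mem_U _)
      (by rw [G.t_mul e]; exact c.mem_U _), ← mul_assoc,
    c.cocycle _ _ _ g h e (by rw [e']; exact c.mem_U _) (by rw [e]; exact c.mem_U _) (c.mem_U _)]

theorem actR_actL (g : G₁) (q : c.Total) (l : K) :
    c.actR (c.actL g q) l = c.actL g (c.actR q l) :=
  congrArg (Bundle.TotalSpace.mk (G.t g)) (mul_assoc (c.val (G.t g) q.proj g) (c.fib q) l)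

theorem actR_one (q : c.Total) : c.actR q 1 = q :=
  congrArg (Bundle.TotalSpace.mk q.proj) (mul_one (c.fib q))

theorem actR_mul (q : c.Total) (l l' : K) : c.actR q (l * l') = c.actR (c.actR q l) l' :=
  congrArg (Bundle.TotalSpace.mk q.proj) (mul_assoc (c.fib q) l l').symm

theorem actR_left_cancel {q : c.Total} {l l' : K} (h : c.actR q l = c.actR q l') : l = l' := by
  have h' := congrArg (c.triv q.proj) h
  rw [triv_actR, triv_actR] at h'
  exact mul_left_cancel h'

theorem actL_right_cancel {g h : G₁} {q : c.Total} (eg : G.s g = q.proj) (eh : G.s h = q.proj)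
    (e : c.actL g q = c.actL h q) : g = h := by
  have et : G.t g = G.t h := congrArg (fun q : c.Total => q.proj) e
  have est : G.s g = G.s h := eg.trans eh.symm
  have hval : c.val (G.t g) q.proj g = c.val (G.t g) q.proj h := by
    have htriv := congrArg (c.triv (G.t g)) e
    rw [c.triv_actL eg (c.mem_U _) (c.mem_U _),
      c.triv_actL eh (c.mem_U _) (by rw [← et]; exact c.mem_U _)] at htriv
    exact mul_right_cancel htriv
  set a := G.mul g (G.inv h) with ha
  have ea : G.s g = G.t (G.inv h) := by rw [G.t_inv, est]
  have hsa : G.s a = G.t g := by rw [ha, G.s_mul ea, G.s_inv, et]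
  have hta : G.t a = G.t g := G.t_mul ea
  have hah : G.mul a h = g := G.inv_mul_cancel_right est
  have hunit : a = G.unit (G.s a) := by
    refine c.faithful (G.t g) a (hsa.trans hta.symm) (by rw [hsa]; exact c.mem_U _) ?_
    have hmul := c.cocycle q.proj (G.t g) (G.t g) a h (by rw [hsa, et])
      (by rw [eh]; exact c.mem_U _) (by rw [hsa]; exact c.mem_U _) (by rw [hta]; exact c.mem_U _)
    rw [hah, hval] at hmul
    exact mul_eq_right.1 hmul
  rw [← hah, hunit, hsa, et, G.unit_mul]

/-- The formula for the left action in the trivializations over `c.U i` and `c.U j`; unlike `actL`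
it is smooth around a pair in `actDom i j` even among pairs with `G.s a.1 ≠ a.2.proj`. -/
def actExt (i j : G₀) (a : G₁ × c.Total) : c.Total :=
  c.ofTriv j (G.t a.1, c.val j i a.1 * c.triv i a.2)

/-- The domain of `actExt i j`. -/
def actDom (i j : G₀) : Set (G₁ × c.Total) :=
  {a | (G.s a.1 ∈ c.U i ∧ G.t a.1 ∈ c.U j) ∧ a.2.proj ∈ c.U i}

theorem isOpen_actDom (i j : G₀) : IsOpen (c.actDom i j) :=
  (((c.isOpen_U i).preimage (G.smooth_s.continuous.comp continuous_fst)).inter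
    ((c.isOpen_U j).preimage (G.smooth_t.continuous.comp continuous_fst))).inter
    ((c.isOpen_proj_mem i).preimage continuous_snd)

theorem mem_actDom {g : G₁} {q : c.Total} (e : G.s g = q.proj) :
    (g, q) ∈ c.actDom q.proj (G.t g) :=
  ⟨⟨by rw [e]; exact c.mem_U _, c.mem_U _⟩, c.mem_U _⟩

theorem actExt_eq {i j : G₀} {a : G₁ × c.Total} (ha : a ∈ c.actDom i j)
    (e : G.s a.1 = a.2.proj) : c.actExt i j a = c.actL a.1 a.2 := by
  rw [actExt, ← c.triv_actL e ha.2 ha.1.2]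
  exact c.ofTriv_triv (q := c.actL a.1 a.2) ha.1.2

/-- The map `q ↦ σ(q) q`, where `σ` is the local section of `s` through `g`. -/
def secAct (g : G₁) (q : c.Total) : c.Total := c.actL (G.sec g q.proj) q

theorem secAct_eq_actL {g : G₁} {q : c.Total} (e : G.s g = q.proj) :
    c.secAct g q = c.actL g q := by
  rw [secAct, ← e, G.sec_s_self]

variable [FiniteDimensional ℝ E₀] [FiniteDimensional ℝ V]

/-- The dimension of the principal bundle. -/
def totalDim (_ : FaithfulCocycle G J K) : ℕ := Module.finrank ℝ (E₀ × V)

/-- Linear coordinates on the model space of the principal bundle. -/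
def totalCoord : (E₀ × V) ≃L[ℝ] EuclideanSpace ℝ (Fin c.totalDim) := toEuclidean

variable [I₀.Boundaryless] [J.Boundaryless]

instance : ChartedSpace (EuclideanSpace ℝ (Fin c.totalDim)) c.Total :=
  c.totalCover.chartedSpace c.totalCoord

variable [IsManifold I₀ ∞ G₀]

instance : IsManifold (𝓡 c.totalDim) ∞ c.Total :=
  have : IsManifold J ∞ K := (inferInstance : ContMDiffMul J ∞ K).toIsManifold
  c.totalCover.isManifold c.totalCoord

theorem contMDiffOn_localTriv (i : G₀) :
    ContMDiffOn (𝓡 c.totalDim) (I₀.prod J) ∞ (fun q : c.Total => (q.proj, c.triv i q))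
      {q | q.proj ∈ c.U i} :=
  have : IsManifold J ∞ K := (inferInstance : ContMDiffMul J ∞ K).toIsManifold
  c.totalCover.contMDiffOn_chart c.totalCoord i

theorem contMDiffOn_ofTriv (i : G₀) :
    ContMDiffOn (I₀.prod J) (𝓡 c.totalDim) ∞ (c.ofTriv i) {a | a.1 ∈ c.U i} :=
  have : IsManifold J ∞ K := (inferInstance : ContMDiffMul J ∞ K).toIsManifold
  (c.totalCover.contMDiffOn_chart_symm c.totalCoord i).mono fun a ha =>
    (c.mem_localTriv_target i a).2 ha

theorem contMDiff_proj : ContMDiff (𝓡 c.totalDim) I₀ ∞ (fun q : c.Total => q.proj) := fun q =>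
  (contMDiff_fst.comp_contMDiffOn (c.contMDiffOn_localTriv q.proj)).contMDiffAt
    (((c.isOpen_U _).preimage c.core.continuous_proj).mem_nhds (c.mem_U _))

theorem contMDiffOn_triv (i : G₀) :
    ContMDiffOn (𝓡 c.totalDim) J ∞ (c.triv i) {q | q.proj ∈ c.U i} :=
  contMDiff_snd.comp_contMDiffOn (c.contMDiffOn_localTriv i)

theorem contMDiffAt_triv {i : G₀} {q : c.Total} (h : q.proj ∈ c.U i) :
    ContMDiffAt (𝓡 c.totalDim) J ∞ (c.triv i) q :=
  (c.contMDiffOn_triv i).contMDiffAt ((c.isOpen_proj_mem i).mem_nhds h)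

instance [T2Space G₀] [T2Space K] : T2Space c.Total := by
  refine t2Space_iff_disjoint_nhds.2 fun q q' hne => ?_
  by_cases h : q.proj = q'.proj
  · have hq : q.proj ∈ c.U q.proj := c.mem_U _
    have hq' : q'.proj ∈ c.U q.proj := h ▸ hq
    have hne' : c.triv q.proj q ≠ c.triv q.proj q' := fun e => hne (c.ext_triv h hq e)
    exact Filter.disjoint_of_map (f := c.triv q.proj) ((disjoint_nhds_nhds.2 hne').mono
      (c.contMDiffAt_triv hq).continuousAt (c.contMDiffAt_triv hq').continuousAt)
  · exact Filter.disjoint_of_map (f := fun q : c.Total => q.proj)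
      ((disjoint_nhds_nhds.2 h).mono
        c.core.continuous_proj.continuousAt c.core.continuous_proj.continuousAt)

theorem contMDiff_actR : ContMDiff ((𝓡 c.totalDim).prod J) (𝓡 c.totalDim) ∞
    (fun a : c.Total × K => c.actR a.1 a.2) := by
  rintro ⟨q, l⟩
  have hU : IsOpen {a : c.Total × K | a.1.proj ∈ c.U q.proj} :=
    (c.isOpen_proj_mem q.proj).preimage continuous_fst
  have hlocal : ContMDiffOn ((𝓡 c.totalDim).prod J) (𝓡 c.totalDim) ∞
      (fun a : c.Total × K => c.ofTriv q.proj (a.1.proj, c.triv q.proj a.1 * a.2))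
      {a : c.Total × K | a.1.proj ∈ c.U q.proj} :=
    (c.contMDiffOn_ofTriv q.proj).comp ((c.contMDiff_proj.comp contMDiff_fst).contMDiffOn.prodMk
      (((c.contMDiffOn_triv q.proj).comp contMDiffOn_fst fun a ha => ha).mul contMDiffOn_snd))
      fun a ha => ha
  refine (hlocal.congr fun a ha => ?_).contMDiffAt (hU.mem_nhds (c.mem_U _))
  rw [← triv_actR]
  exact (c.ofTriv_triv (q := c.actR a.1 a.2) ha).symm

theorem contMDiffOn_actExt (i j : G₀) :
    ContMDiffOn (I₁.prod (𝓡 c.totalDim)) (𝓡 c.totalDim) ∞ (c.actExt i j) (c.actDom i j) :=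
  (c.contMDiffOn_ofTriv j).comp ((G.smooth_t.comp contMDiff_fst).contMDiffOn.prodMk
    (((c.smooth i j).comp contMDiffOn_fst fun _ ha => ha.1).mul
      ((c.contMDiffOn_triv i).comp contMDiffOn_snd fun _ ha => ha.2))) fun _ ha => ha.1.2

theorem smoothOnSubset_actL : SmoothOnSubset (I₁.prod (𝓡 c.totalDim)) (𝓡 c.totalDim)
    (fun a : {a : G₁ × c.Total | G.s a.1 = a.2.proj} => c.actL a.1.1 a.1.2) := fun a =>
  ⟨c.actDom a.1.2.proj (G.t a.1.1), c.isOpen_actDom _ _, c.mem_actDom a.2,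
    c.actExt a.1.2.proj (G.t a.1.1), c.contMDiffOn_actExt _ _, fun b hb => c.actExt_eq hb b.2⟩

theorem continuousOn_actL :
    ContinuousOn (fun a : G₁ × c.Total => c.actL a.1 a.2) {a | G.s a.1 = a.2.proj} := by
  intro a ha
  have hdom := (c.isOpen_actDom a.2.proj (G.t a.1)).mem_nhds (c.mem_actDom ha)
  have hext := (c.contMDiffOn_actExt a.2.proj (G.t a.1)).continuousOn.continuousAt hdom
  refine hext.continuousWithinAt.congr_of_eventuallyEq ?_ (c.actExt_eq (c.mem_actDom ha) ha).symm
  filter_upwards [self_mem_nhdsWithin, mem_nhdsWithin_of_mem_nhds hdom] with b hb hbdom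
  exact (c.actExt_eq hbdom hb).symm

theorem contMDiffAt_secAct {g : G₁} {q : c.Total} (e : G.s g = q.proj) :
    ContMDiffAt (𝓡 c.totalDim) (𝓡 c.totalDim) ∞ (c.secAct g) q := by
  have hg : G.sec g q.proj = g := by rw [← e, G.sec_s_self]
  have hsec : ContMDiffAt (𝓡 c.totalDim) I₁ ∞ (fun q : c.Total => G.sec g q.proj) q :=
    ContMDiffAt.comp (f := fun q : c.Total => q.proj) q (e ▸ G.contMDiffAt_sec g)
      c.contMDiff_proj.contMDiffAt
  have hpair : ContMDiffAt (𝓡 c.totalDim) (I₁.prod (𝓡 c.totalDim)) ∞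
    (fun q : c.Total => (G.sec g q.proj, q)) q := hsec.prodMk contMDiffAt_id
  have hdom : c.actDom q.proj (G.t g) ∈ 𝓝 (G.sec g q.proj, q) := by
    rw [hg]
    exact (c.isOpen_actDom q.proj (G.t g)).mem_nhds (c.mem_actDom e)
  have hext := (c.contMDiffOn_actExt q.proj (G.t g)).contMDiffAt hdom
  refine (ContMDiffAt.comp (f := fun q : c.Total => (G.sec g q.proj, q)) q hext
    hpair).congr_of_eventuallyEq ?_
  filter_upwards [hpair.continuousAt.eventually hdom,
    c.core.continuous_proj.continuousAt.eventually (e ▸ G.eventually_s_sec g)] with q' hq' hs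
  exact (c.actExt_eq (a := (G.sec g q'.proj, q')) hq' hs).symm

theorem isClosed_setOf_exists_actL_eq [T2Space G₀] [T2Space K] {Z : Set G₁} (hZ : IsClosed Z) :
    IsClosed {a : c.Total × c.Total | ∃ g ∈ Z, G.s g = a.2.proj ∧ c.actL g a.2 = a.1} := by
  let D : Set (G₁ × c.Total × c.Total) := {b | b.1 ∈ Z ∧ G.s b.1 = b.2.2.proj}
  have hD : IsClosed D := (hZ.preimage continuous_fst).inter <|
    isClosed_eq (G.smooth_s.continuous.comp continuous_fst)
      (c.core.continuous_proj.comp (continuous_snd.comp continuous_snd))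
  have hact : ContinuousOn (fun b : G₁ × c.Total × c.Total => (c.actL b.1 b.2.2, b.2.1)) D :=
    (c.continuousOn_actL.comp (f := fun b : G₁ × c.Total × c.Total => (b.1, b.2.2))
      (by fun_prop) fun b hb => hb.2).prodMk (by fun_prop)
  have hgraph := hact.preimage_isClosed_of_isClosed hD isClosed_diagonal
  have hproper := G.proper.prodMap (isProperMap_id (X := c.Total × c.Total))
  have hproj : Continuous fun a : c.Total × c.Total => (((a.2.proj, a.1.proj) : G₀ × G₀), a) :=
    ((c.core.continuous_proj.comp continuous_snd).prodMk
      (c.core.continuous_proj.comp continuous_fst)).prodMk continuous_id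
  convert (hproper.isClosedMap _ hgraph).preimage hproj using 1
  ext a
  constructor
  · rintro ⟨g, hgZ, hs, hga⟩
    refine ⟨(g, a), ⟨⟨hgZ, hs⟩, hga⟩, ?_⟩
    refine Prod.ext (Prod.ext hs ?_) rfl
    exact congrArg (fun q : c.Total => q.proj) hga
  · rintro ⟨⟨g, a'⟩, ⟨⟨hgZ, hs⟩, hga⟩, heq⟩
    obtain rfl : a' = a := congrArg Prod.snd heq
    exact ⟨g, hgZ, hs, hga⟩

end FaithfulCocycle

end Cocycle

/-! ### The quotient of the principal bundle -/

section Submersions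

variable {E H : Type*} [NormedAddCommGroup E] [NormedSpace ℝ E] [TopologicalSpace H]
  {I : ModelWithCorners ℝ E H} {M N : Type*} [TopologicalSpace M] [ChartedSpace H M]
  [TopologicalSpace N] [ChartedSpace H N] [IsManifold I ∞ M] [IsManifold I ∞ N]

theorem isSubmersion_of_isLocalDiffeomorph {f : M → N} (hf : IsLocalDiffeomorph I I ∞ f) :
    Manifold.IsSubmersion I I ∞ f := by
  refine Manifold.IsSubmersionOfComplement.isSubmersion (F := PUnit) fun x => ?_
  obtain ⟨Φ, hx, hΦ⟩ := hf x
  set ψ := chartAt H (f x)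
  have hψ : ψ ∈ IsManifold.maximalAtlas I ∞ N := IsManifold.chart_mem_maximalAtlas _
  have hfx : f x ∈ ψ.source := mem_chart_source H _
  set φ : OpenPartialHomeomorph M H := Φ.toOpenPartialHomeomorph.trans ψ
  refine Manifold.IsSubmersionAtOfComplement.mk_of_charts
    (ContinuousLinearEquiv.prodUnique ℝ E PUnit).symm φ ψ ?_ hfx ?_ hψ ?_ ?_
  · exact ⟨hx, show Φ x ∈ ψ.source from hΦ hx ▸ hfx⟩
  · refine OpenPartialHomeomorph.mem_maximalAtlas_of_contMDiffOn _ ?_ ?_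
    · exact (contMDiffOn_of_mem_maximalAtlas hψ).comp (Φ.contMDiffOn.mono fun y hy => hy.1)
        fun y hy => hy.2
    · exact Φ.symm.contMDiffOn.comp ((contMDiffOn_symm_of_mem_maximalAtlas hψ).mono
        fun y hy => hy.1) fun y hy => hy.2
  · intro y hy
    rw [Set.mem_preimage, hΦ hy.1]
    exact hy.2
  · intro v hv
    have hsource : (φ.extend I).symm v ∈ φ.source := by
      simpa only [φ.extend_source] using (φ.extend I).map_target hv
    have hφv : (φ.extend I) ((φ.extend I).symm v) = v := (φ.extend I).right_inv hv
    have hψv : (ψ.extend I) (f ((φ.extend I).symm v)) = v := by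
      rw [hΦ hsource.1]
      exact hφv
    simpa using hψv

end Submersions

section Quotient

variable {E₀ E₁ V : Type*} [NormedAddCommGroup E₀] [NormedSpace ℝ E₀]
  [NormedAddCommGroup E₁] [NormedSpace ℝ E₁] [NormedAddCommGroup V] [NormedSpace ℝ V]
  {H₀ H₁ W : Type*} [TopologicalSpace H₀] [TopologicalSpace H₁] [TopologicalSpace W]
  {I₀ : ModelWithCorners ℝ E₀ H₀} {I₁ : ModelWithCorners ℝ E₁ H₁} {J : ModelWithCorners ℝ V W}
  {G₀ G₁ K : Type*} [TopologicalSpace G₀] [ChartedSpace H₀ G₀]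
  [TopologicalSpace G₁] [ChartedSpace H₁ G₁]
  [TopologicalSpace K] [ChartedSpace W K] [Group K] [LieGroup J ∞ K]

namespace FaithfulCocycle

variable {G : OrbifoldGroupoid I₀ I₁ G₀ G₁} (c : FaithfulCocycle G J K)

/-- Two points of the principal bundle are equivalent if an arrow moves one to the other. -/
def actSetoid : Setoid c.Total where
  r q q' := ∃ g, G.s g = q.proj ∧ c.actL g q = q'
  iseqv :=
    { refl := fun q => ⟨G.unit q.proj, G.s_unit _, c.actL_unit q⟩
      symm := by
        rintro q _ ⟨g, hg, rfl⟩
        refine ⟨G.inv g, G.s_inv g, ?_⟩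
        rw [c.actL_actL (G.s_inv g) hg, G.inv_mul_self, hg, c.actL_unit]
      trans := by
        rintro q _ _ ⟨g, hg, rfl⟩ ⟨h, hh, rfl⟩
        exact ⟨G.mul h g, (G.s_mul hh).trans hg, (c.actL_actL hh hg).symm⟩ }

/-- The quotient of the principal bundle by the groupoid. -/
def Quot : Type _ := Quotient c.actSetoid

instance : TopologicalSpace c.Quot := inferInstanceAs (TopologicalSpace (Quotient c.actSetoid))

/-- The projection of the principal bundle to its quotient by the groupoid. -/
def quot (q : c.Total) : c.Quot := Quotient.mk c.actSetoid q

theorem quot_eq_iff {q q' : c.Total} :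
    c.quot q = c.quot q' ↔ ∃ g, G.s g = q.proj ∧ c.actL g q = q' := Quotient.eq

theorem quot_actL {g : G₁} {q : c.Total} (e : G.s g = q.proj) : c.quot (c.actL g q) = c.quot q :=
  (c.quot_eq_iff.2 ⟨g, e, rfl⟩).symm

theorem quot_surjective : Function.Surjective c.quot := Quotient.mk_surjective

theorem continuous_quot : Continuous c.quot := continuous_quotient_mk'

theorem eventually_quot_secAct {g : G₁} {q : c.Total} (e : G.s g = q.proj) :
    ∀ᶠ q' in 𝓝 q, c.quot (c.secAct g q') = c.quot q' := by
  filter_upwards [c.core.continuous_proj.continuousAt.eventually (e ▸ G.eventually_s_sec g)]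
    with q' h
  exact c.quot_actL (q := q') h

theorem actR_triv_inv_mul_triv {i : G₀} {a b : c.Total} (hab : a.proj = b.proj)
    (hi : a.proj ∈ c.U i) : c.actR a ((c.triv i a)⁻¹ * c.triv i b) = b := by
  refine c.ext_triv (i := i) hab hi ?_
  rw [c.triv_actR, mul_inv_cancel_left]

variable [FiniteDimensional ℝ E₀] [FiniteDimensional ℝ V] [I₀.Boundaryless] [J.Boundaryless]
  [IsManifold I₀ ∞ G₀]

theorem isOpenMap_quot : IsOpenMap c.quot := by
  intro O hO
  refine (isQuotientMap_quotient_mk' (s := c.actSetoid)).isOpen_preimage.1 ?_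
  refine isOpen_iff_mem_nhds.2 ?_
  rintro q ⟨q₀, hq₀, hq⟩
  obtain ⟨g, hg, rfl⟩ := c.quot_eq_iff.1 hq.symm
  have hmem : ∀ᶠ q' in 𝓝 q, c.secAct g q' ∈ O :=
    (c.contMDiffAt_secAct hg).continuousAt.eventually
      (by rw [c.secAct_eq_actL hg]; exact hO.mem_nhds hq₀)
  filter_upwards [hmem, c.eventually_quot_secAct hg] with q' hq'O hq' using ⟨_, hq'O, hq'⟩

theorem isOpenQuotientMap_quot : IsOpenQuotientMap c.quot :=
  ⟨c.quot_surjective, c.continuous_quot, c.isOpenMap_quot⟩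

instance [SecondCountableTopology G₀] [SecondCountableTopology K] :
    SecondCountableTopology c.Quot :=
  c.isOpenQuotientMap_quot.isQuotientMap.secondCountableTopology c.isOpenMap_quot

theorem isSubmersion_proj :
    Manifold.IsSubmersion (𝓡 c.totalDim) I₀ ∞ (fun q : c.Total => q.proj) := by
  refine Manifold.IsSubmersionOfComplement.isSubmersion (F := V) fun q => ?_
  set ψ := chartAt H₀ q.proj
  set φ := chartAt (EuclideanSpace ℝ (Fin c.totalDim)) q
  have hsource : ∀ q' ∈ φ.source, q'.proj ∈ ψ.source := fun q' hq' => hq'.2.1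
  refine Manifold.IsSubmersionAtOfComplement.mk_of_charts c.totalCoord.symm φ ψ
    (mem_chart_source _ q) (mem_chart_source _ q.proj) (IsManifold.chart_mem_maximalAtlas _)
    (IsManifold.chart_mem_maximalAtlas _) hsource ?_
  intro v hv
  set q' := (φ.extend (𝓡 c.totalDim)).symm v
  have hq' : (φ.extend (𝓡 c.totalDim)) q' = v := (φ.extend (𝓡 c.totalDim)).right_inv hv
  have hcoord : c.totalCoord.symm v =
      (I₀ (ψ q'.proj), J (chartAt W (c.triv q.proj q) (c.triv q.proj q'))) := by
    rw [← hq', ContinuousLinearEquiv.symm_apply_eq]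
    rfl
  simp only [Function.comp_apply, hcoord]
  rfl

variable [T2Space G₀] [T2Space K]

instance : T2Space c.Quot := by
  rw [t2Space_iff_of_isOpenQuotientMap c.isOpenQuotientMap_quot]
  convert c.isClosed_setOf_exists_actL_eq isClosed_univ using 1
  ext ⟨q, q'⟩
  rw [Set.mem_ofPred, Set.mem_ofPred, eq_comm, c.quot_eq_iff]
  simp only [Set.mem_univ, true_and]

theorem eventually_mem_of_actL_eq {g : G₁} {q : c.Total} (e : G.s g = q.proj) {O : Set G₁}
    (hO : O ∈ 𝓝 g) : ∀ᶠ a in 𝓝 (c.actL g q, q), ∀ h, G.s h = a.2.proj → c.actL h a.2 = a.1 →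
      h ∈ O := by
  have hclosed := c.isClosed_setOf_exists_actL_eq (isOpen_interior (s := O)).isClosed_compl
  have hmem : (c.actL g q, q) ∉ {a : c.Total × c.Total |
      ∃ h ∈ (interior O)ᶜ, G.s h = a.2.proj ∧ c.actL h a.2 = a.1} := by
    rintro ⟨h, hh, hs, ha⟩
    rw [c.actL_right_cancel hs e ha] at hh
    exact hh (mem_interior_iff_mem_nhds.2 hO)
  filter_upwards [hclosed.isOpen_compl.mem_nhds hmem] with a ha h hs hh
  by_contra hn
  exact ha ⟨h, fun h' => hn (interior_subset h'), hs, hh⟩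

theorem eventually_eq_sec_of_actL_eq {g : G₁} {q : c.Total} (e : G.s g = q.proj) :
    ∀ᶠ a in 𝓝 (c.actL g q, q), ∀ h, G.s h = a.2.proj → c.actL h a.2 = a.1 →
      h = G.sec g a.2.proj := by
  filter_upwards [c.eventually_mem_of_actL_eq e (G.eventually_sec_s g)] with a ha h hs hh
  have hsec : G.sec g (G.s h) = h := ha h hs hh
  rw [← hs, hsec]

theorem exists_isOpen_injOn_quot (q : c.Total) :
    ∃ O : Set c.Total, IsOpen O ∧ q ∈ O ∧ Set.InjOn c.quot O := by
  have hrel := c.eventually_eq_sec_of_actL_eq (g := G.unit q.proj) (q := q) (G.s_unit _)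
  rw [c.actL_unit, nhds_prod_eq, Filter.eventually_prod_self_iff'] at hrel
  obtain ⟨O, hO, hOsec⟩ := hrel
  have hunit : ∀ᶠ y in 𝓝 q.proj, G.sec (G.unit q.proj) y = G.unit y := by
    have htendsto := G.tendsto_sec (G.unit q.proj)
    have hsection := G.eventually_s_sec (G.unit q.proj)
    rw [G.s_unit] at htendsto hsection
    refine G.eventually_eq_of_tendsto htendsto G.smooth_unit.continuous.continuousAt ?_
    filter_upwards [hsection] with y hy
    rw [hy, G.s_unit]
  have hOunit := c.core.continuous_proj.continuousAt.eventually hunit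
  obtain ⟨O', hO', hopen, hq⟩ := mem_nhds_iff.1 (Filter.inter_mem hO hOunit)
  refine ⟨O', hopen, hq, fun a ha b hb hab => ?_⟩
  obtain ⟨h, hs, hh⟩ := c.quot_eq_iff.1 hab
  have hsec := hOsec b (hO' hb).1 a (hO' ha).1 h hs hh
  have hsec' : G.sec (G.unit q.proj) a.proj = G.unit a.proj := (hO' ha).2
  rw [← hh, hsec, hsec', c.actL_unit]

theorem isLocalHomeomorph_quot : IsLocalHomeomorph c.quot := by
  refine isLocalHomeomorph_iff_isOpenEmbedding_restrict.2 fun q => ?_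
  obtain ⟨O, hO, hq, hinj⟩ := c.exists_isOpen_injOn_quot q
  exact ⟨O, hO.mem_nhds hq, .of_continuous_injective_isOpenMap
    (c.continuous_quot.comp continuous_subtype_val) hinj.injective
    (c.isOpenMap_quot.comp hO.isOpenMap_subtype_val)⟩

/-- The restriction of the quotient map to a neighbourhood of `q` on which it is injective. -/
def quotChart (q : c.Total) : OpenPartialHomeomorph c.Total c.Quot :=
  (c.isLocalHomeomorph_quot q).choose

theorem mem_quotChart_source (q : c.Total) : q ∈ (c.quotChart q).source :=
  (c.isLocalHomeomorph_quot q).choose_spec.1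

theorem coe_quotChart (q : c.Total) : ⇑(c.quotChart q) = c.quot :=
  (c.isLocalHomeomorph_quot q).choose_spec.2.symm

theorem quot_mem_quotChart_target (q : c.Total) : c.quot q ∈ (c.quotChart q).target := by
  simpa only [coe_quotChart] using (c.quotChart q).map_source (c.mem_quotChart_source q)

theorem quot_quotChart_symm {q : c.Total} {p : c.Quot} (hp : p ∈ (c.quotChart q).target) :
    c.quot ((c.quotChart q).symm p) = p := by
  simpa only [coe_quotChart] using (c.quotChart q).right_inv hp

/-- The local inverses of the quotient map, as an atlas modelled on the principal bundle. -/
def quotCover : SmoothCover (𝓡 c.totalDim) c.Quot c.Total c.Total where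
  chart q := (c.quotChart q).symm
  indexAt := Quotient.out
  mem_source p := by
    have hp : c.quot (Quotient.out p) = p := Quotient.out_eq p
    have hmem := c.quot_mem_quotChart_target (Quotient.out p)
    rwa [hp] at hmem
  compat a b := by
    rintro q ⟨hqa, hqb⟩
    simp only [OpenPartialHomeomorph.symm_source, OpenPartialHomeomorph.symm_symm,
      OpenPartialHomeomorph.symm_target, Set.mem_preimage, coe_quotChart] at hqa hqb ⊢
    obtain ⟨g, hg, hgq⟩ := c.quot_eq_iff.1 (c.quot_quotChart_symm hqb).symm
    have hsmooth := c.contMDiffAt_secAct hg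
    have hmem : ∀ᶠ q' in 𝓝 q, c.secAct g q' ∈ (c.quotChart b).source := by
      refine hsmooth.continuousAt.eventually ((c.quotChart b).open_source.mem_nhds ?_)
      rw [c.secAct_eq_actL hg, hgq]
      exact (c.quotChart b).map_target hqb
    refine (hsmooth.congr_of_eventuallyEq ?_).contMDiffWithinAt
    filter_upwards [hmem, c.eventually_quot_secAct hg] with q' hq' hquot
    rw [← hquot, ← c.coe_quotChart b, (c.quotChart b).left_inv hq']

instance : ChartedSpace (EuclideanSpace ℝ (Fin c.totalDim)) c.Quot :=
  c.quotCover.chartedSpace (ContinuousLinearEquiv.refl ℝ _)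

instance : IsManifold (𝓡 c.totalDim) ∞ c.Quot :=
  c.quotCover.isManifold (ContinuousLinearEquiv.refl ℝ _)

theorem contMDiffOn_quotChart_symm (q : c.Total) :
    ContMDiffOn (𝓡 c.totalDim) (𝓡 c.totalDim) ∞ (c.quotChart q).symm (c.quotChart q).target :=
  c.quotCover.contMDiffOn_chart (ContinuousLinearEquiv.refl ℝ _) q

theorem contMDiffOn_quotChart (q : c.Total) :
    ContMDiffOn (𝓡 c.totalDim) (𝓡 c.totalDim) ∞ (c.quotChart q) (c.quotChart q).source :=
  c.quotCover.contMDiffOn_chart_symm (ContinuousLinearEquiv.refl ℝ _) q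

theorem isLocalDiffeomorph_quot :
    IsLocalDiffeomorph (𝓡 c.totalDim) (𝓡 c.totalDim) ∞ c.quot := fun q =>
  ⟨{ toPartialEquiv := (c.quotChart q).toPartialEquiv
     open_source := (c.quotChart q).open_source
     open_target := (c.quotChart q).open_target
     contMDiffOn_toFun := c.contMDiffOn_quotChart q
     contMDiffOn_invFun := c.contMDiffOn_quotChart_symm q }, c.mem_quotChart_source q,
    fun q' _ => (congrFun (c.coe_quotChart q) q').symm⟩

theorem contMDiff_quot : ContMDiff (𝓡 c.totalDim) (𝓡 c.totalDim) ∞ c.quot :=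
  c.isLocalDiffeomorph_quot.contMDiff

/-- The right action of the group on the quotient of the principal bundle. -/
def quotAction : LieRightAction (𝓡 c.totalDim) J c.Quot K where
  act p l := Quotient.map (sa := c.actSetoid) (sb := c.actSetoid) (fun q => c.actR q l)
    (by
      rintro q _ ⟨g, hg, rfl⟩
      exact ⟨g, hg, (c.actR_actL g q l).symm⟩) p
  smooth_act := by
    rintro ⟨p, l⟩
    obtain ⟨q, rfl⟩ := c.quot_surjective p
    have hp := (c.quotChart q).open_target.mem_nhds (c.quot_mem_quotChart_target q)
    have hlift : ContMDiffAt ((𝓡 c.totalDim).prod J) (𝓡 c.totalDim) ∞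
        (fun a : c.Quot × K => (c.quotChart q).symm a.1) (c.quot q, l) :=
      ContMDiffAt.comp (c.quot q, l)
        ((c.contMDiffOn_quotChart_symm q).contMDiffAt hp) contMDiffAt_fst
    have hact : ContMDiffAt ((𝓡 c.totalDim).prod J) (𝓡 c.totalDim) ∞
        (fun a : c.Quot × K => c.quot (c.actR ((c.quotChart q).symm a.1) a.2)) (c.quot q, l) :=
      (c.contMDiff_quot.comp c.contMDiff_actR).contMDiffAt.comp (c.quot q, l)
        (hlift.prodMk contMDiffAt_snd)
    refine hact.congr_of_eventuallyEq ?_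
    filter_upwards [continuousAt_fst.preimage_mem_nhds (x := (c.quot q, l)) hp] with a ha
    conv_lhs => rw [← c.quot_quotChart_symm ha]
    rfl
  act_one p := by
    obtain ⟨q, rfl⟩ := c.quot_surjective p
    exact congrArg c.quot (c.actR_one q)
  act_mul p l l' := by
    obtain ⟨q, rfl⟩ := c.quot_surjective p
    exact congrArg c.quot (c.actR_mul q l l')

theorem quotAction_quot (q : c.Total) (l : K) :
    c.quotAction.act (c.quot q) l = c.quot (c.actR q l) := rfl

/-- The left action of the groupoid on the principal bundle. -/
def leftAction : LeftAction G.toSmoothGroupoid (𝓡 c.totalDim) (fun q : c.Total => q.proj) where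
  smooth_base := c.contMDiff_proj
  act g q _ := c.actL g q
  smooth_act := c.smoothOnSubset_actL
  base_act _ _ _ := rfl
  unit_act := c.actL_unit
  comp_act g h q e e' := by rw [c.actL_actL e e', G.mul_eq_comp e]

theorem isDiffeoOfSubsets_leftAction : IsDiffeoOfSubsets (I₁.prod (𝓡 c.totalDim))
    ((𝓡 c.totalDim).prod (𝓡 c.totalDim))
    (fun b : {b : G₁ × c.Total | G.s b.1 = b.2.proj} =>
      (⟨(c.actL b.1.1 b.1.2, b.1.2), c.quot_actL b.2⟩ :
        {a : c.Total × c.Total | c.quot a.1 = c.quot a.2})) := by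
  have hex : ∀ a : {a : c.Total × c.Total | c.quot a.1 = c.quot a.2},
      ∃ g, G.s g = a.1.2.proj ∧ c.actL g a.1.2 = a.1.1 := fun a => c.quot_eq_iff.1 a.2.symm
  choose div hdiv_s hdiv_actL using hex
  refine ⟨fun b => ?_, fun a => ⟨(div a, a.1.2), hdiv_s a⟩, ?_, ?_, fun a => ?_⟩
  · obtain ⟨U, hU, hbU, F, hF, hFact⟩ := c.smoothOnSubset_actL b
    exact ⟨U, hU, hbU, fun a => (F a, a.2), hF.prodMk contMDiffOn_snd,
      fun y hy => Prod.ext (hFact y hy) rfl⟩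
  · rintro ⟨⟨g, q⟩, e⟩
    exact Subtype.ext (Prod.ext (c.actL_right_cancel (hdiv_s _) e (hdiv_actL _)) rfl)
  · rintro ⟨⟨q', q⟩, e⟩
    exact Subtype.ext (Prod.ext (hdiv_actL ⟨⟨q', q⟩, e⟩) rfl)
  · have hproj := c.contMDiff_proj.comp (contMDiff_snd (M := c.Total) (I := 𝓡 c.totalDim))
    have hdiv_eq := c.eventually_eq_sec_of_actL_eq (hdiv_s a)
    rw [hdiv_actL a] at hdiv_eq
    have hsec := hproj.continuous.continuousAt.eventually
      (hdiv_s a ▸ G.eventually_contMDiffAt_sec (div a))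
    obtain ⟨U, hU, hopen, ha⟩ := mem_nhds_iff.1 (Filter.inter_mem hdiv_eq hsec)
    have hsmooth : ContMDiffOn ((𝓡 c.totalDim).prod (𝓡 c.totalDim)) I₁ ∞
        (fun b : c.Total × c.Total => G.sec (div a) b.2.proj) U := fun b hb =>
      (ContMDiffAt.comp (f := fun b : c.Total × c.Total => b.2.proj) b (hU hb).2
        hproj.contMDiffAt).contMDiffWithinAt
    exact ⟨U, hopen, ha, fun b => (G.sec (div a) b.2.proj, b.2),
      hsmooth.prodMk contMDiffOn_snd,
      fun b hb => Prod.ext ((hU hb).1 (div b) (hdiv_s b) (hdiv_actL b)).symm rfl⟩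

theorem leftAction_isPrincipal : c.leftAction.IsPrincipal (𝓡 c.totalDim) c.quot where
  invariant _ _ e := c.quot_actL e
  surjective := c.quot_surjective
  submersion := isSubmersion_of_isLocalDiffeomorph c.isLocalDiffeomorph_quot
  diffeo := c.isDiffeoOfSubsets_leftAction

theorem isDiffeoOfSubsets_rightAction : IsDiffeoOfSubsets
    ((𝓡 c.totalDim).prod ((𝓡 c.totalDim).prod J)) ((𝓡 c.totalDim).prod (𝓡 c.totalDim))
    (fun b : {b : c.Total × c.Quot × K | c.quot b.1 = b.2.1} =>
      (⟨(b.1.1, c.actR b.1.1 b.1.2.2), rfl⟩ :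
        {a : c.Total × c.Total | a.1.proj = a.2.proj})) := by
  refine ⟨fun _ => ⟨Set.univ, isOpen_univ, trivial, fun a => (a.1, c.actR a.1 a.2.2),
    (contMDiff_fst.prodMk (c.contMDiff_actR.comp
      (contMDiff_fst.prodMk (contMDiff_snd.comp contMDiff_snd)))).contMDiffOn, fun _ _ => rfl⟩,
    fun a => ⟨(a.1.1, c.quot a.1.1,
      (c.triv a.1.1.proj a.1.1)⁻¹ * c.triv a.1.1.proj a.1.2), rfl⟩, ?_, ?_, fun a => ?_⟩
  · rintro ⟨⟨q, ⟨p, l⟩⟩, e⟩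
    refine Subtype.ext (Prod.ext rfl (Prod.ext e ?_))
    change (c.triv q.proj q)⁻¹ * c.triv q.proj (c.actR q l) = l
    rw [c.triv_actR, inv_mul_cancel_left]
  · rintro ⟨⟨q, q'⟩, e⟩
    exact Subtype.ext (Prod.ext rfl (c.actR_triv_inv_mul_triv e (c.mem_U _)))
  · set i := a.1.1.proj
    have hopen : IsOpen {b : c.Total × c.Total | b.1.proj ∈ c.U i ∧ b.2.proj ∈ c.U i} :=
      ((c.isOpen_proj_mem i).preimage continuous_fst).inter
        ((c.isOpen_proj_mem i).preimage continuous_snd)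
    have hi : a.1.2.proj ∈ c.U i := (show i = a.1.2.proj from a.2) ▸ c.mem_U i
    refine ⟨_, hopen, ⟨c.mem_U _, hi⟩, fun b => (b.1, c.quot b.1,
      (c.triv i b.1)⁻¹ * c.triv i b.2), ?_, fun b hb => ?_⟩
    · exact contMDiffOn_fst.prodMk ((c.contMDiff_quot.comp contMDiff_fst).contMDiffOn.prodMk
        (((c.contMDiffOn_triv i).comp contMDiffOn_fst fun b hb => hb.1).inv.mul
          ((c.contMDiffOn_triv i).comp contMDiffOn_snd fun b hb => hb.2)))
    · refine Prod.ext rfl (Prod.ext rfl (c.actR_left_cancel (q := b.1.1) ?_))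
      rw [c.actR_triv_inv_mul_triv b.2 hb.1, c.actR_triv_inv_mul_triv b.2 (c.mem_U _)]

variable [SecondCountableTopology G₀] [SecondCountableTopology K]

/-- The right action of the translation groupoid on the principal bundle. -/
def rightAction : RightAction c.quotAction.translationGroupoid (𝓡 c.totalDim) c.quot where
  smooth_base := c.contMDiff_quot
  act q a _ := c.actR q a.2
  smooth_act := fun _ => ⟨Set.univ, isOpen_univ, trivial, fun a => c.actR a.1 a.2.2,
    (c.contMDiff_actR.comp (contMDiff_fst.prodMk (contMDiff_snd.comp contMDiff_snd))).contMDiffOn,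
    fun _ _ => rfl⟩
  base_act q a e := by
    change c.quot (c.actR q a.2) = c.quotAction.act a.1 a.2
    rw [← c.quotAction_quot]
    exact congrArg (fun p => c.quotAction.act p a.2) e
  act_unit := c.actR_one
  act_comp q a b _ _ := (c.actR_mul q a.2 b.2).symm

theorem rightAction_isPrincipal :
    c.rightAction.IsPrincipal I₀ (fun q : c.Total => q.proj) where
  invariant _ _ _ := rfl
  surjective x := ⟨⟨x, (1 : K)⟩, rfl⟩
  submersion := c.isSubmersion_proj
  diffeo := c.isDiffeoOfSubsets_rightAction

end FaithfulCocycle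

end Quotient

section Equivalence

variable {E₀ E₁ V : Type*} [NormedAddCommGroup E₀] [NormedSpace ℝ E₀] [FiniteDimensional ℝ E₀]
  [NormedAddCommGroup E₁] [NormedSpace ℝ E₁]
  [NormedAddCommGroup V] [NormedSpace ℝ V] [FiniteDimensional ℝ V]
  {H₀ H₁ W : Type*} [TopologicalSpace H₀] [TopologicalSpace H₁] [TopologicalSpace W]
  {I₀ : ModelWithCorners ℝ E₀ H₀} [I₀.Boundaryless] {I₁ : ModelWithCorners ℝ E₁ H₁}
  {J : ModelWithCorners ℝ V W} [J.Boundaryless]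
  {G₀ G₁ : Type u} [TopologicalSpace G₀] [ChartedSpace H₀ G₀] [IsManifold I₀ ∞ G₀]
  [T2Space G₀] [SecondCountableTopology G₀] [TopologicalSpace G₁] [ChartedSpace H₁ G₁]
  {K : Type} [TopologicalSpace K] [ChartedSpace W K] [Group K] [LieGroup J ∞ K]
  [T2Space K] [SecondCountableTopology K]
  {G : OrbifoldGroupoid I₀ I₁ G₀ G₁} (c : FaithfulCocycle G J K)

theorem FaithfulCocycle.hsEquivalent :
    HSEquivalent G.toSmoothGroupoid c.quotAction.translationGroupoid :=
  ⟨c.totalDim, c.Total, inferInstance, inferInstance, inferInstance, inferInstance, inferInstance,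
    { sQ := fun q => q.proj
      tQ := c.quot
      left := c.leftAction
      right := c.rightAction
      sQ_right := fun _ _ _ => rfl
      tQ_left := fun _ _ e => c.quot_actL e
      compatible := fun g q a _ _ => c.actR_actL g q a.2
      right_principal := c.rightAction_isPrincipal }, c.leftAction_isPrincipal⟩

end Equivalence

/-! ### Germs and Jacobians of arrows -/

section FiniteOrder

variable {𝕜 E : Type*} [NontriviallyNormedField 𝕜] [NormedAddCommGroup E] [NormedSpace 𝕜 E]
  {f : E → E} {p : E}

theorem exists_mem_nhds_injOn_of_hasStrictFDerivAt_id
    (hf : HasStrictFDerivAt f (ContinuousLinearMap.id 𝕜 E) p) :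
    ∃ W ∈ 𝓝 p, Set.InjOn f W := by
  obtain ⟨W, hW, happrox⟩ := hf.approximates_deriv_on_nhds (c := 1 / 2) (Or.inr (by norm_num))
  refine ⟨W, hW, fun a ha b hb hab => ?_⟩
  have hle : ‖a - b‖ ≤ 1 / 2 * ‖a - b‖ := by
    simpa [hab, norm_sub_rev] using happrox a ha b hb
  exact sub_eq_zero.1 (norm_eq_zero.1 (by linarith [norm_nonneg (a - b)]))

theorem hasStrictFDerivAt_average_iterate [CharZero 𝕜] (hp : f p = p)
    (hf : HasStrictFDerivAt f (ContinuousLinearMap.id 𝕜 E) p) {r : ℕ} (hr : r ≠ 0) :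
    HasStrictFDerivAt (fun z => (r : 𝕜)⁻¹ • ∑ k ∈ Finset.range r, f^[k] z)
      (ContinuousLinearMap.id 𝕜 E) p := by
  have hiter : ∀ k : ℕ, HasStrictFDerivAt f^[k] (ContinuousLinearMap.id 𝕜 E) p := fun k => by
    simpa only [← ContinuousLinearMap.one_def, one_pow] using hf.iterate hp k
  refine ((HasStrictFDerivAt.fun_sum fun k _ => hiter k).const_smul (r : 𝕜)⁻¹).congr_fderiv ?_
  rw [Finset.sum_const, Finset.card_range, ← Nat.cast_smul_eq_nsmul 𝕜, smul_smul,
    inv_mul_cancel₀ (Nat.cast_ne_zero.2 hr), one_smul]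

/- The average `ψ` of the first `r` iterates has derivative `id` at `p`, so it is injective near
`p`, and `ψ ∘ f = ψ` wherever `f^[r] = id`. -/
theorem eventually_eq_self_of_iterate [CharZero 𝕜] (hp : f p = p)
    (hf : HasStrictFDerivAt f (ContinuousLinearMap.id 𝕜 E) p) {r : ℕ} (hr : r ≠ 0)
    (hiter : ∀ᶠ z in 𝓝 p, f^[r] z = z) : ∀ᶠ z in 𝓝 p, f z = z := by
  obtain ⟨W, hW, hinj⟩ :=
    exists_mem_nhds_injOn_of_hasStrictFDerivAt_id (hasStrictFDerivAt_average_iterate hp hf hr)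
  have hf_tendsto : Filter.Tendsto f (𝓝 p) (𝓝 p) := by
    simpa only [hp] using hf.continuousAt.tendsto
  filter_upwards [hW, hf_tendsto.eventually hW, hiter] with z hz hfz hrz
  refine hinj hfz hz (congrArg ((r : 𝕜)⁻¹ • ·) ?_)
  have hsum := Finset.sum_range_succ (fun k => f^[k] z) r
  rw [Finset.sum_range_succ', hrz] at hsum
  exact add_right_cancel hsum

end FiniteOrder

section Germs

variable {E₀ E₁ : Type*} [NormedAddCommGroup E₀] [NormedSpace ℝ E₀]
  [NormedAddCommGroup E₁] [NormedSpace ℝ E₁]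
  {H₀ H₁ : Type*} [TopologicalSpace H₀] [TopologicalSpace H₁]
  {I₀ : ModelWithCorners ℝ E₀ H₀} {I₁ : ModelWithCorners ℝ E₁ H₁}
  {G₀ G₁ : Type*} [TopologicalSpace G₀] [ChartedSpace H₀ G₀]
  [TopologicalSpace G₁] [ChartedSpace H₁ G₁]

namespace OrbifoldGroupoid

variable (G : OrbifoldGroupoid I₀ I₁ G₀ G₁)

section Fibres

theorem isCompact_setOf_s_mem_t_mem {A B : Set G₀} (hA : IsCompact A) (hB : IsCompact B) :
    IsCompact {g | G.s g ∈ A ∧ G.t g ∈ B} :=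
  G.proper.isCompact_preimage (hA.prod hB)

theorem finite_inter_fibre [T1Space G₀] {C : Set G₁} (hC : IsCompact C) (x : G₀) :
    (C ∩ G.s ⁻¹' {x}).Finite := by
  have hfibre : IsCompact (C ∩ G.s ⁻¹' {x}) :=
    hC.inter_right (isClosed_singleton.preimage G.smooth_s.continuous)
  obtain ⟨F, -, hF⟩ := hfibre.elim_nhds_subcover (fun f => {g | G.sec f (G.s g) = g})
    fun f _ => G.eventually_sec_s f
  refine (F.finite_toSet.image fun f => G.sec f x).subset fun g hg => ?_
  obtain ⟨f, hf, hfg⟩ := Set.mem_iUnion₂.1 (hF hg)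
  exact ⟨f, hf, (congrArg (G.sec f) hg.2.out).symm.trans hfg⟩

theorem finite_setOf_s_eq_t_eq [T1Space G₀] (x : G₀) : {g | G.s g = x ∧ G.t g = x}.Finite :=
  (G.finite_inter_fibre (G.isCompact_setOf_s_mem_t_mem isCompact_singleton
    isCompact_singleton) x).subset fun _ hg => ⟨hg, hg.1⟩

instance [T1Space G₀] (x : G₀) : Finite (G.toSmoothGroupoid.Stabilizer x) :=
  (G.finite_setOf_s_eq_t_eq x).to_subtype

theorem eventually_exists_sec_eq [T2Space G₀] {C : Set G₁} (hC : IsCompact C) (x : G₀) :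
    ∀ᶠ y in 𝓝 x, ∀ g ∈ C, G.s g = y → ∃ f ∈ C ∩ G.s ⁻¹' {x}, G.sec f y = g := by
  set V : Set G₁ := {g | ∃ f ∈ C ∩ G.s ⁻¹' {x}, G.sec f (G.s g) = g}
  have hV : C ∩ G.s ⁻¹' {x} ⊆ interior V := fun f hf => by
    rw [mem_interior_iff_mem_nhds]
    filter_upwards [G.eventually_sec_s f] with g hg using ⟨f, hf, hg⟩
  have hclosed : IsClosed (G.s '' (C \ interior V)) :=
    ((hC.diff isOpen_interior).image G.smooth_s.continuous).isClosed
  have hx : x ∉ G.s '' (C \ interior V) := by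
    rintro ⟨g, ⟨hg, hgV⟩, hgx⟩
    exact hgV (hV ⟨hg, hgx⟩)
  filter_upwards [hclosed.isOpen_compl.mem_nhds hx] with y hy g hg hgy
  obtain ⟨f, hf, hfg⟩ : g ∈ V := by
    by_contra hgV
    exact hy ⟨g, ⟨hg, fun h => hgV (interior_subset h)⟩, hgy⟩
  exact ⟨f, hf, by rw [← hgy, hfg]⟩

theorem eventually_injOn_sec [T2Space G₁] {F : Set G₁} (hF : F.Finite) {x : G₀}
    (hx : ∀ f ∈ F, G.s f = x) : ∀ᶠ y in 𝓝 x, Set.InjOn (fun f => G.sec f y) F := by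
  obtain ⟨O, hO, hdisj⟩ := hF.t2_separation
  have hmem : ∀ᶠ y in 𝓝 x, ∀ f ∈ F, G.sec f y ∈ O f :=
    (Filter.eventually_all_finite hF).2 fun f hf =>
      hx f hf ▸ (G.tendsto_sec f).eventually ((hO f).2.mem_nhds (hO f).1)
  filter_upwards [hmem] with y hy f hf f' hf' heq
  by_contra hne
  exact Set.disjoint_left.1 (hdisj hf hf' hne) (hy f hf)
    ((congrArg (· ∈ O f') heq).mpr (hy f' hf'))

theorem eventually_sec_eventuallyEq (g : G₁) :
    ∀ᶠ h in 𝓝 g, G.sec h =ᶠ[𝓝 (G.s h)] G.sec g := by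
  filter_upwards [(G.eventually_sec_s g).eventually_nhds] with h hh
  filter_upwards [(G.tendsto_sec h).eventually hh, G.eventually_s_sec h] with y hsec hs
  rw [hs] at hsec
  exact hsec.symm

end Fibres

section Holonomy

/-- The local diffeomorphism of the space of objects induced by an arrow. -/
def hol (g : G₁) (y : G₀) : G₀ := G.t (G.sec g y)

theorem hol_s (g : G₁) : G.hol g (G.s g) = G.t g := by rw [hol, G.sec_s_self]

theorem contMDiffAt_hol (g : G₁) : ContMDiffAt I₀ I₀ ∞ (G.hol g) (G.s g) :=
  G.smooth_t.contMDiffAt.comp _ (G.contMDiffAt_sec g)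

theorem tendsto_hol (g : G₁) : Filter.Tendsto (G.hol g) (𝓝 (G.s g)) (𝓝 (G.t g)) := by
  simpa only [G.hol_s] using (G.contMDiffAt_hol g).continuousAt.tendsto

theorem eventually_hol_eq {σ : G₀ → G₁} {g : G₁} (hσ : Filter.Tendsto σ (𝓝 (G.s g)) (𝓝 g))
    (hs : ∀ᶠ y in 𝓝 (G.s g), G.s (σ y) = y) : ∀ᶠ y in 𝓝 (G.s g), G.hol g y = G.t (σ y) := by
  have hsec : ∀ᶠ y in 𝓝 (G.s g), G.sec g y = σ y := by
    refine G.eventually_eq_of_tendsto (G.tendsto_sec g) hσ ?_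
    filter_upwards [G.eventually_s_sec g, hs] with y hy hy'
    rw [hy, hy']
  exact hsec.mono fun y hy => congrArg G.t hy

theorem eventually_hol_unit (x : G₀) : ∀ᶠ y in 𝓝 x, G.hol (G.unit x) y = y := by
  have hunit := G.eventually_hol_eq (g := G.unit x) (σ := G.unit)
  rw [G.s_unit] at hunit
  filter_upwards [hunit G.smooth_unit.continuous.continuousAt
    (Filter.Eventually.of_forall G.s_unit)] with y hy
  rw [hy, G.t_unit]

theorem eventually_hol_mul {g h : G₁} (e : G.s g = G.t h) :
    ∀ᶠ y in 𝓝 (G.s h), G.hol (G.mul g h) y = G.hol g (G.hol h y) := by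
  have hhol : Filter.Tendsto (G.hol h) (𝓝 (G.s h)) (𝓝 (G.s g)) := e ▸ G.tendsto_hol h
  have hcomp : ∀ᶠ y in 𝓝 (G.s h), G.s (G.sec g (G.hol h y)) = G.t (G.sec h y) :=
    hhol.eventually (G.eventually_s_sec g)
  have hmul := G.eventually_hol_eq (g := G.mul g h)
    (σ := fun y => G.mul (G.sec g (G.hol h y)) (G.sec h y))
  rw [G.s_mul e] at hmul
  filter_upwards [hmul (G.tendsto_mul e ((G.tendsto_sec g).comp hhol) (G.tendsto_sec h) hcomp)
    (by filter_upwards [hcomp, G.eventually_s_sec h] with y hy hs; rw [G.s_mul hy, hs]), hcomp]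
    with y hy hy'
  rw [hy, G.t_mul hy']
  rfl

theorem isIneffective_iff {g : G₁} :
    G.IsIneffective g ↔ G.s g = G.t g ∧ ∀ᶠ y in 𝓝 (G.s g), G.hol g y = y :=
  and_congr_right fun _ => Filter.Germ.coe_eq

theorem eventually_iterate_hol_eq_hol_pow {x : G₀} (g : G.toSmoothGroupoid.Stabilizer x) (k : ℕ) :
    ∀ᶠ y in 𝓝 x, (G.hol g.1)^[k] y = G.hol (g ^ k).1 y := by
  induction k with
  | zero => exact (G.eventually_hol_unit x).mono fun y hy => hy.symm
  | succ k ih =>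
    have e : G.s g.1 = G.t (g ^ k).1 := g.2.1.trans (g ^ k).2.2.symm
    have hmul := G.eventually_hol_mul e
    rw [(g ^ k).2.1] at hmul
    have hsucc : (g ^ (k + 1)).1 = G.mul g.1 (g ^ k).1 := by
      rw [pow_succ', G.mul_eq_comp e]
      rfl
    filter_upwards [ih, hmul] with y hy hy'
    rw [Function.iterate_succ_apply', hy, hsucc, hy']

theorem exists_iterate_hol_eq_self [T1Space G₀] {g : G₁} (hg : G.s g = G.t g) :
    ∃ r ≠ 0, ∀ᶠ y in 𝓝 (G.s g), (G.hol g)^[r] y = y := by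
  set a : G.toSmoothGroupoid.Stabilizer (G.s g) := ⟨g, rfl, hg.symm⟩
  refine ⟨orderOf a, (orderOf_pos a).ne', ?_⟩
  filter_upwards [G.eventually_iterate_hol_eq_hol_pow a (orderOf a), G.eventually_hol_unit (G.s g)]
    with y hiter hunit
  rw [pow_orderOf_eq_one] at hiter
  exact hiter.trans hunit

end Holonomy

end OrbifoldGroupoid

section Coordinates

variable [FiniteDimensional ℝ E₀] [I₀.Boundaryless]

variable (I₀) in
/-- The preferred chart at `x`, read in a Euclidean space, where linear maps have adjoints. -/
def coord (x : G₀) : OpenPartialHomeomorph G₀ (EuclideanSpace ℝ (Fin (Module.finrank ℝ E₀))) :=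
  linearChart I₀ toEuclidean (chartAt H₀ x)

theorem mem_coord_source (x : G₀) : x ∈ (coord I₀ x).source := mem_chart_source H₀ x

theorem tendsto_coord_symm {x y : G₀} (hy : y ∈ (coord I₀ x).source) :
    Filter.Tendsto (coord I₀ x).symm (𝓝 (coord I₀ x y)) (𝓝 y) := by
  simpa only [(coord I₀ x).left_inv hy] using
    ((coord I₀ x).continuousAt_symm ((coord I₀ x).map_source hy)).tendsto

variable [IsManifold I₀ ∞ G₀]

theorem contMDiffAt_coord {x y : G₀} (hy : y ∈ (coord I₀ x).source) :
    ContMDiffAt I₀ (𝓡 (Module.finrank ℝ E₀)) ∞ (coord I₀ x) y :=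
  (contMDiffOn_linearChart I₀ toEuclidean (IsManifold.chart_mem_maximalAtlas x)).contMDiffAt
    ((coord I₀ x).open_source.mem_nhds hy)

theorem contMDiffAt_coord_symm {x y : G₀} (hy : y ∈ (coord I₀ x).source) :
    ContMDiffAt (𝓡 (Module.finrank ℝ E₀)) I₀ ∞ (coord I₀ x).symm (coord I₀ x y) :=
  (contMDiffOn_linearChart_symm I₀ toEuclidean (IsManifold.chart_mem_maximalAtlas x)).contMDiffAt
    ((coord I₀ x).open_target.mem_nhds ((coord I₀ x).map_source hy))

end Coordinates

namespace OrbifoldGroupoid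

section Jacobian

variable [FiniteDimensional ℝ E₀] [I₀.Boundaryless] (G : OrbifoldGroupoid I₀ I₁ G₀ G₁)

local notation "𝔼" => EuclideanSpace ℝ (Fin (Module.finrank ℝ E₀))

/-- The local diffeomorphism induced by an arrow, read in the coordinates at `x` and `y`. -/
def coordHol (y x : G₀) (g : G₁) (v : 𝔼) : 𝔼 := coord I₀ y (G.hol g ((coord I₀ x).symm v))

/-- The derivative of the local diffeomorphism induced by an arrow, in the coordinates at `x` and
`y`. -/
def jac (y x : G₀) (g : G₁) : 𝔼 →L[ℝ] 𝔼 := fderiv ℝ (G.coordHol y x g) (coord I₀ x (G.s g))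

/-- The arrows at which the derivative `jac y x` is meaningful. -/
def jacDomain (y x : G₀) : Set G₁ := {g | G.s g ∈ (coord I₀ x).source ∧ G.t g ∈ (coord I₀ y).source}

theorem isOpen_jacDomain (y x : G₀) : IsOpen (G.jacDomain y x) :=
  ((coord I₀ x).open_source.preimage G.smooth_s.continuous).inter
    ((coord I₀ y).open_source.preimage G.smooth_t.continuous)

variable {x y z : G₀} {g h : G₁}

theorem coordHol_coord_s (hx : G.s g ∈ (coord I₀ x).source) :
    G.coordHol y x g (coord I₀ x (G.s g)) = coord I₀ y (G.t g) := by
  rw [coordHol, (coord I₀ x).left_inv hx, G.hol_s]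

theorem jac_eq_one_of_isIneffective (hx : G.s g ∈ (coord I₀ x).source) (hg : G.IsIneffective g) :
    G.jac x x g = 1 := by
  have hid : G.coordHol x x g =ᶠ[𝓝 (coord I₀ x (G.s g))] id := by
    filter_upwards [(tendsto_coord_symm hx).eventually (G.isIneffective_iff.1 hg).2,
      (coord I₀ x).open_target.mem_nhds ((coord I₀ x).map_source hx)] with v hol_eq hv
    rw [coordHol, hol_eq, (coord I₀ x).right_inv hv, id]
  rw [jac, hid.fderiv_eq, fderiv_id, ContinuousLinearMap.one_def]

theorem jac_unit (hy : y ∈ (coord I₀ x).source) : G.jac x x (G.unit y) = 1 :=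
  G.jac_eq_one_of_isIneffective ((G.s_unit y).symm ▸ hy) (G.isIneffective_iff.2
    ⟨(G.s_unit y).trans (G.t_unit y).symm, (G.s_unit y).symm ▸ G.eventually_hol_unit y⟩)

theorem eventually_iterate_coordHol (hg : G.s g = G.t g) (hx : G.s g ∈ (coord I₀ x).source)
    (k : ℕ) : ∀ᶠ y in 𝓝 (G.s g),
      (G.coordHol x x g)^[k] (coord I₀ x y) = coord I₀ x ((G.hol g)^[k] y) := by
  have hhol : Filter.Tendsto (G.hol g) (𝓝 (G.s g)) (𝓝 (G.s g)) := hg ▸ G.tendsto_hol g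
  induction k with
  | zero => exact Filter.Eventually.of_forall fun _ => rfl
  | succ k ih =>
    filter_upwards [ih, (hhol.iterate k).eventually ((coord I₀ x).open_source.mem_nhds hx)]
      with y hy hmem
    rw [Function.iterate_succ_apply', Function.iterate_succ_apply', hy, coordHol,
      (coord I₀ x).left_inv hmem]

variable [IsManifold I₀ ∞ G₀]

theorem contDiffAt_coordHol (hg : g ∈ G.jacDomain y x) :
    ContDiffAt ℝ ∞ (G.coordHol y x g) (coord I₀ x (G.s g)) := by
  rw [← contMDiffAt_iff_contDiffAt]
  have hsymm := (coord I₀ x).left_inv hg.1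
  have hhol : ContMDiffAt (𝓡 (Module.finrank ℝ E₀)) I₀ ∞
      (G.hol g ∘ (coord I₀ x).symm) (coord I₀ x (G.s g)) :=
    (G.contMDiffAt_hol g).comp_of_eq (contMDiffAt_coord_symm hg.1) hsymm
  exact (contMDiffAt_coord hg.2).comp_of_eq hhol (by rw [hsymm, G.hol_s])

theorem hasStrictFDerivAt_coordHol (hg : g ∈ G.jacDomain y x) :
    HasStrictFDerivAt (G.coordHol y x g) (G.jac y x g) (coord I₀ x (G.s g)) :=
  (G.contDiffAt_coordHol hg).hasStrictFDerivAt (by simp)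

variable (x y) in
theorem contMDiffOn_jac :
    ContMDiffOn I₁ 𝓘(ℝ, 𝔼 →L[ℝ] 𝔼) ∞ (G.jac y x) (G.jacDomain y x) := by
  intro g hg
  have hfderiv : ContDiffAt ℝ ∞ (fderiv ℝ (G.coordHol y x g)) (coord I₀ x (G.s g)) :=
    (G.contDiffAt_coordHol hg).fderiv_right (by simp)
  have hcoord : ContMDiffAt I₁ 𝓘(ℝ, 𝔼) ∞ (fun h => coord I₀ x (G.s h)) g :=
    (contMDiffAt_coord hg.1).comp g G.smooth_s.contMDiffAt
  refine ((hfderiv.contMDiffAt.comp g hcoord).congr_of_eventuallyEq ?_).contMDiffWithinAt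
  filter_upwards [G.eventually_sec_eventuallyEq g, (G.isOpen_jacDomain y x).mem_nhds hg]
    with h hsec hh
  refine Filter.EventuallyEq.fderiv_eq ?_
  filter_upwards [(tendsto_coord_symm hh.1).eventually hsec] with v hv
  simp only [coordHol, hol, hv]

theorem jac_mul_jac (e : G.s g = G.t h) (hx : G.s h ∈ (coord I₀ x).source)
    (hy : G.s g ∈ (coord I₀ y).source) (hz : G.t g ∈ (coord I₀ z).source) :
    G.jac z y g * G.jac y x h = G.jac z x (G.mul g h) := by
  have hh : h ∈ G.jacDomain y x := ⟨hx, e ▸ hy⟩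
  have hg : HasStrictFDerivAt (G.coordHol z y g) (G.jac z y g)
      (G.coordHol y x h (coord I₀ x (G.s h))) := by
    rw [G.coordHol_coord_s hx, ← e]
    exact G.hasStrictFDerivAt_coordHol ⟨hy, hz⟩
  have hcomp := hg.comp _ (G.hasStrictFDerivAt_coordHol hh)
  rw [ContinuousLinearMap.mul_def, ← hcomp.hasFDerivAt.fderiv, jac, G.s_mul e]
  refine Filter.EventuallyEq.fderiv_eq (Filter.EventuallyEq.symm ?_)
  filter_upwards [(tendsto_coord_symm hx).eventually (G.eventually_hol_mul e),
    (tendsto_coord_symm hx).eventually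
      ((G.tendsto_hol h).eventually ((coord I₀ y).open_source.mem_nhds hh.2))] with v hmul hmem
  rw [coordHol, coordHol, coordHol, (coord I₀ y).left_inv hmem, ← hmul]

theorem isUnit_jac (hg : g ∈ G.jacDomain y x) : IsUnit (G.jac y x g) := by
  have hinv_mul := G.jac_mul_jac (G.s_inv g) hg.1 ((G.s_inv g).symm ▸ hg.2)
    ((G.t_inv g).symm ▸ hg.1)
  have hmul_inv := G.jac_mul_jac (G.t_inv g).symm ((G.s_inv g).symm ▸ hg.2) hg.1 hg.2
  rw [G.inv_mul_self, G.jac_unit hg.1] at hinv_mul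
  rw [G.mul_inv_self, G.jac_unit hg.2] at hmul_inv
  exact ⟨⟨_, _, hmul_inv, hinv_mul⟩, rfl⟩

theorem isIneffective_of_jac_eq_one [T1Space G₀] (hx : G.s g ∈ (coord I₀ x).source)
    (hg : G.s g = G.t g) (hjac : G.jac x x g = 1) : G.IsIneffective g := by
  obtain ⟨r, hr, hiter⟩ := G.exists_iterate_hol_eq_self hg
  have hfix : G.coordHol x x g (coord I₀ x (G.s g)) = coord I₀ x (G.s g) := by
    rw [G.coordHol_coord_s hx, hg]
  have hderiv := G.hasStrictFDerivAt_coordHol (x := x) (y := x) ⟨hx, hg ▸ hx⟩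
  rw [hjac] at hderiv
  have hcoordHol : ∀ᶠ v in 𝓝 (coord I₀ x (G.s g)), G.coordHol x x g v = v := by
    refine eventually_eq_self_of_iterate hfix hderiv hr ?_
    filter_upwards [(tendsto_coord_symm hx).eventually (G.eventually_iterate_coordHol hg hx r),
      (tendsto_coord_symm hx).eventually hiter,
      (coord I₀ x).open_target.mem_nhds ((coord I₀ x).map_source hx)] with v hv hv' hmem
    rwa [hv', (coord I₀ x).right_inv hmem] at hv
  refine G.isIneffective_iff.2 ⟨hg, ?_⟩
  have hsource := (coord I₀ x).open_source.mem_nhds hx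
  have hhol : Filter.Tendsto (G.hol g) (𝓝 (G.s g)) (𝓝 (G.s g)) := hg ▸ G.tendsto_hol g
  filter_upwards [((coord I₀ x).continuousAt hx).eventually hcoordHol, hsource,
    hhol.eventually hsource] with y hy hmem hmem'
  rw [coordHol, (coord I₀ x).left_inv hmem] at hy
  exact (coord I₀ x).injOn hmem' hmem hy

end Jacobian

end OrbifoldGroupoid

end Germs

/-! ### The permutation cocycle -/

section Permutations

variable {E₀ E₁ : Type*} [NormedAddCommGroup E₀] [NormedSpace ℝ E₀]
  [NormedAddCommGroup E₁] [NormedSpace ℝ E₁]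
  {H₀ H₁ : Type*} [TopologicalSpace H₀] [TopologicalSpace H₁]
  {I₀ : ModelWithCorners ℝ E₀ H₀} {I₁ : ModelWithCorners ℝ E₁ H₁}
  {G₀ G₁ : Type*} [TopologicalSpace G₀] [ChartedSpace H₀ G₀]
  [TopologicalSpace G₁] [ChartedSpace H₁ G₁]

namespace SmoothGroupoid

variable (G : SmoothGroupoid I₀ I₁ G₀ G₁)

/-- The conjugate `g a g⁻¹` of a loop `a` at the source of an arrow `g`. -/
def conj (g a : G₁) : G₁ := G.mul (G.mul g a) (G.inv g)

variable {g h a b : G₁}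

private theorem s_mul_eq_t_inv (hs : G.s a = G.s g) (ht : G.t a = G.s g) :
    G.s (G.mul g a) = G.t (G.inv g) := by
  rw [G.s_mul ht.symm, G.t_inv, hs]

theorem s_conj (hs : G.s a = G.s g) (ht : G.t a = G.s g) : G.s (G.conj g a) = G.t g := by
  rw [conj, G.s_mul (G.s_mul_eq_t_inv hs ht), G.s_inv]

theorem t_conj (hs : G.s a = G.s g) (ht : G.t a = G.s g) : G.t (G.conj g a) = G.t g := by
  rw [conj, G.t_mul (G.s_mul_eq_t_inv hs ht), G.t_mul ht.symm]

theorem conj_mul_self (hs : G.s a = G.s g) (ht : G.t a = G.s g) :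
    G.mul (G.conj g a) g = G.mul g a :=
  G.inv_mul_cancel_right ((G.s_mul ht.symm).trans hs)

theorem eq_conj_of_mul_eq (hs : G.s a = G.s g) (ht : G.t a = G.s g) (hb : G.s b = G.t g)
    (e : G.mul b g = G.mul g a) : b = G.conj g a :=
  G.mul_right_cancel hb (G.s_conj hs ht) (e.trans (G.conj_mul_self hs ht).symm)

theorem conj_mul (e : G.s g = G.t h) (hs : G.s a = G.s h) (ht : G.t a = G.s h) :
    G.conj (G.mul g h) a = G.conj g (G.conj h a) := by
  have hs_conj : G.s (G.conj h a) = G.s g := (G.s_conj hs ht).trans e.symm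
  have ht_conj : G.t (G.conj h a) = G.s g := (G.t_conj hs ht).trans e.symm
  refine (G.eq_conj_of_mul_eq (hs.trans (G.s_mul e).symm) (ht.trans (G.s_mul e).symm)
    ((G.s_conj hs_conj ht_conj).trans (G.t_mul e).symm) ?_).symm
  calc G.mul (G.conj g (G.conj h a)) (G.mul g h)
      = G.mul (G.mul (G.conj g (G.conj h a)) g) h :=
        (G.mul_assoc (G.s_conj hs_conj ht_conj) e).symm
    _ = G.mul g (G.mul (G.conj h a) h) := by
        rw [G.conj_mul_self hs_conj ht_conj, G.mul_assoc ht_conj.symm (G.s_conj hs ht)]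
    _ = G.mul (G.mul g h) a := by rw [G.conj_mul_self hs ht, G.mul_assoc e ht.symm]

theorem conj_unit {x : G₀} (hs : G.s a = x) (ht : G.t a = x) : G.conj (G.unit x) a = a := by
  subst hs
  refine (G.eq_conj_of_mul_eq (G.s_unit _).symm (ht.trans (G.s_unit _).symm) (G.t_unit _).symm
    ?_).symm
  rw [G.mul_unit, ← ht, G.unit_mul]

theorem conj_inv_conj (hs : G.s a = G.s g) (ht : G.t a = G.s g) :
    G.conj (G.inv g) (G.conj g a) = a := by
  rw [← G.conj_mul (G.s_inv g) hs ht, G.inv_mul_self, G.conj_unit hs ht]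

theorem conj_conj_inv (hs : G.s a = G.t g) (ht : G.t a = G.t g) :
    G.conj g (G.conj (G.inv g) a) = a := by
  rw [← G.conj_mul (G.t_inv g).symm (hs.trans (G.s_inv g).symm) (ht.trans (G.s_inv g).symm),
    G.mul_inv_self, G.conj_unit hs ht]

theorem tendsto_conj {ι : Type*} {l : Filter ι} {b c : ι → G₁}
    (hs : G.s a = G.s g) (ht : G.t a = G.s g) (hb : Filter.Tendsto b l (𝓝 g))
    (hc : Filter.Tendsto c l (𝓝 a)) (hbs : ∀ᶠ i in l, G.s (c i) = G.s (b i))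
    (hbt : ∀ᶠ i in l, G.t (c i) = G.s (b i)) :
    Filter.Tendsto (fun i => G.conj (b i) (c i)) l (𝓝 (G.conj g a)) := by
  refine G.tendsto_mul (G.s_mul_eq_t_inv hs ht)
    (G.tendsto_mul ht.symm hb hc (hbt.mono fun _ h => h.symm))
    ((G.smooth_inv.continuous.tendsto g).comp hb) ?_
  filter_upwards [hbs, hbt] with i his hit using G.s_mul_eq_t_inv his hit

end SmoothGroupoid

namespace OrbifoldGroupoid

variable (G : OrbifoldGroupoid I₀ I₁ G₀ G₁)

/-- The ineffective arrows at `x`. -/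
def ineff (x : G₀) : Set G₁ := {g | G.s g = x ∧ G.IsIneffective g}

variable {G} in
theorem t_of_mem_ineff {x : G₀} {g : G₁} (h : g ∈ G.ineff x) : G.t g = x :=
  h.2.1.symm.trans h.1

theorem finite_ineff [T1Space G₀] (x : G₀) : (G.ineff x).Finite :=
  (G.finite_setOf_s_eq_t_eq x).subset fun _ hg => ⟨hg.1, t_of_mem_ineff hg⟩

theorem isOpen_setOf_isIneffective : IsOpen {g | G.IsIneffective g} := by
  refine isOpen_iff_mem_nhds.2 fun g hg => ?_
  filter_upwards [G.eventually_sec_eventuallyEq g,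
    G.smooth_s.continuous.continuousAt.eventually (G.isIneffective_iff.1 hg).2.eventually_nhds]
    with h hsec hgerm
  have hhol : ∀ᶠ y in 𝓝 (G.s h), G.hol h y = y := by
    filter_upwards [hsec, hgerm] with y hy hgy
    rwa [hol, hy]
  exact G.isIneffective_iff.2 ⟨hhol.self_of_nhds.symm.trans (G.hol_s h), hhol⟩

theorem conj_mem_ineff {g a : G₁} (ha : a ∈ G.ineff (G.s g)) : G.conj g a ∈ G.ineff (G.t g) := by
  have hs := ha.1
  have ht := t_of_mem_ineff ha
  have hs_conj := G.s_conj hs ht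
  refine ⟨hs_conj, G.isIneffective_iff.2 ⟨hs_conj.trans (G.t_conj hs ht).symm, ?_⟩⟩
  have hinv : Filter.Tendsto (G.hol (G.inv g)) (𝓝 (G.t g)) (𝓝 (G.s g)) := by
    simpa only [G.s_inv, G.t_inv] using G.tendsto_hol (G.inv g)
  have hconj := G.eventually_hol_mul (g := G.mul g a) (h := G.inv g)
    (by rw [G.s_mul ht.symm, G.t_inv, hs])
  have hmul := G.eventually_hol_mul ht.symm
  have hunit := G.eventually_hol_mul (G.t_inv g).symm
  have hid := (G.isIneffective_iff.1 ha.2).2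
  rw [G.s_inv] at hconj hunit
  rw [hs] at hmul hid
  rw [G.mul_inv_self] at hunit
  rw [hs_conj]
  filter_upwards [hconj, hinv.eventually hmul, hinv.eventually hid, hunit,
    G.eventually_hol_unit (G.t g)] with y hy_conj hy_mul hy_id hy_unit hy
  calc G.hol (G.conj g a) y = G.hol g (G.hol a (G.hol (G.inv g) y)) := hy_conj.trans hy_mul
    _ = y := by rw [hy_id, ← hy_unit, hy]

theorem bijOn_conj (g : G₁) : Set.BijOn (G.conj g) (G.ineff (G.s g)) (G.ineff (G.t g)) := by
  have hinv : Set.MapsTo (G.conj (G.inv g)) (G.ineff (G.t g)) (G.ineff (G.s g)) := fun b hb => by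
    rw [← G.s_inv] at hb
    simpa only [G.t_inv] using G.conj_mem_ineff hb
  exact Set.InvOn.bijOn ⟨fun a ha => G.conj_inv_conj ha.1 (t_of_mem_ineff ha),
    fun b hb => G.conj_conj_inv hb.1 (t_of_mem_ineff hb)⟩ (fun a ha => G.conj_mem_ineff ha) hinv

section LocallyConstant

variable [FiniteDimensional ℝ E₀] [I₀.Boundaryless] [IsManifold I₀ ∞ G₀]

theorem isClosed_setOf_isIneffective [T2Space G₀] : IsClosed {g | G.IsIneffective g} := by
  refine isClosed_iff_frequently.2 fun g hg => ?_
  have hst : G.s g = G.t g :=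
    (isClosed_eq G.smooth_s.continuous G.smooth_t.continuous).mem_of_frequently_of_tendsto
      (hg.mono fun h hh => hh.1) Filter.tendsto_id
  have hdomain : G.jacDomain (G.s g) (G.s g) ∈ 𝓝 g :=
    (G.isOpen_jacDomain _ _).mem_nhds ⟨mem_coord_source _, hst ▸ mem_coord_source _⟩
  have hjac : ∃ᶠ h in 𝓝 g, G.jac (G.s g) (G.s g) h ∈ ({1} : Set _) :=
    (hg.and_eventually hdomain).mono fun h hh => G.jac_eq_one_of_isIneffective hh.2.1 hh.1
  exact G.isIneffective_of_jac_eq_one (mem_coord_source _) hst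
    (isClosed_singleton.mem_of_frequently_of_tendsto hjac
      ((G.contMDiffOn_jac _ _).continuousOn.continuousAt hdomain))

variable [T2Space G₀] [T2Space G₁]

theorem eventually_bijOn_sec_ineff (x : G₀) :
    ∀ᶠ y in 𝓝 x, Set.BijOn (fun f => G.sec f y) (G.ineff x) (G.ineff y) := by
  have : LocallyCompactSpace G₀ := Manifold.locallyCompact_of_finiteDimensional I₀
  obtain ⟨C, hC, hxC⟩ := exists_compact_mem_nhds x
  have hcompact : IsCompact ({g | G.s g ∈ C ∧ G.t g ∈ C} ∩ {g | G.IsIneffective g}) :=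
    (G.isCompact_setOf_s_mem_t_mem hC hC).inter_right G.isClosed_setOf_isIneffective
  have hmaps : ∀ᶠ y in 𝓝 x, ∀ f ∈ G.ineff x, G.sec f y ∈ G.ineff y := by
    refine (Filter.eventually_all_finite (G.finite_ineff x)).2 fun f hf => ?_
    filter_upwards [hf.1 ▸ (G.tendsto_sec f).eventually
      (G.isOpen_setOf_isIneffective.mem_nhds hf.2), hf.1 ▸ G.eventually_s_sec f] with y hineff hs
      using ⟨hs, hineff⟩
  filter_upwards [hmaps, G.eventually_exists_sec_eq hcompact x, hxC,
    G.eventually_injOn_sec (G.finite_ineff x) fun f hf => hf.1] with y hmaps hsurj hyC hinj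
  refine ⟨hmaps, hinj, fun g hg => ?_⟩
  obtain ⟨f, hf, hfg⟩ := hsurj g
    ⟨⟨hg.1.symm ▸ hyC, (t_of_mem_ineff hg).symm ▸ hyC⟩, hg.2⟩ hg.1
  exact ⟨f, ⟨hf.2, hf.1.2⟩, hfg⟩

theorem exists_ncard_ineff_eq (hconn : G.toSmoothGroupoid.IsConnected) :
    ∃ N, ∀ x, (G.ineff x).ncard = N := by
  have : ConnectedSpace G.TopQuotient := hconn
  have hinv : ∀ x y : G₀, G.orbitSetoid.r x y → (G.ineff x).ncard = (G.ineff y).ncard := by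
    rintro _ _ ⟨g, rfl, rfl⟩
    rw [← (G.bijOn_conj g).image_eq, (G.bijOn_conj g).injOn.ncard_image]
  have hcont : Continuous fun x => (G.ineff x).ncard := by
    refine continuous_iff_continuousAt.2 fun x =>
      (continuousAt_const (y := (G.ineff x).ncard)).congr ?_
    filter_upwards [G.eventually_bijOn_sec_ineff x] with y hy
    rw [← hy.image_eq, hy.injOn.ncard_image]
  obtain ⟨p⟩ := (inferInstance : Nonempty G.TopQuotient)
  exact ⟨Quotient.lift _ hinv p, fun x => PreconnectedSpace.constant
    (inferInstance : PreconnectedSpace G.TopQuotient) (hcont.quotient_lift hinv)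
    (x := Quotient.mk _ x) (y := p)⟩

end LocallyConstant

/-- Enumerations of the ineffective arrows by continuous local sections, over the members of an open
cover of the objects, which is indexed by the objects as in `FaithfulCocycle`. -/
structure IneffEnumeration (G : OrbifoldGroupoid I₀ I₁ G₀ G₁) (N : ℕ) where
  V : G₀ → Set G₀
  isOpen_V : ∀ x, IsOpen (V x)
  mem_V : ∀ x, x ∈ V x
  enum : G₀ → Fin N → G₀ → G₁
  continuousAt_enum : ∀ {x y}, y ∈ V x → ∀ i, ContinuousAt (enum x i) y
  injective_enum : ∀ {x y}, y ∈ V x → Function.Injective fun i => enum x i y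
  range_enum : ∀ {x y}, y ∈ V x → Set.range (fun i => enum x i y) = G.ineff y

theorem nonempty_ineffEnumeration [FiniteDimensional ℝ E₀] [I₀.Boundaryless] [IsManifold I₀ ∞ G₀]
    [T2Space G₀] [T2Space G₁] {N : ℕ} (hN : ∀ x, (G.ineff x).ncard = N) :
    Nonempty (IneffEnumeration G N) := by
  have hlocal : ∀ x, ∃ (V : Set G₀) (τ : Fin N → G₀ → G₁), IsOpen V ∧ x ∈ V ∧
      ∀ y ∈ V, (∀ i, ContinuousAt (τ i) y) ∧ Function.Injective (fun i => τ i y) ∧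
        Set.range (fun i => τ i y) = G.ineff y := by
    intro x
    have : Finite (G.ineff x) := G.finite_ineff x
    let e : Fin N ≃ G.ineff x := (Finite.equivFinOfCardEq (hN x)).symm
    have hcont : ∀ᶠ y in 𝓝 x, ∀ i, ContinuousAt (G.sec (e i)) y :=
      Filter.eventually_all.2 fun i => by
        have hsmooth := G.eventually_contMDiffAt_sec (e i)
        rw [(e i).2.1] at hsmooth
        exact hsmooth.mono fun y hy => hy.continuousAt
    obtain ⟨V, hV, hopen, hx⟩ :=
      mem_nhds_iff.1 (Filter.inter_mem hcont (G.eventually_bijOn_sec_ineff x))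
    refine ⟨V, fun i => G.sec (e i), hopen, hx, fun y hy => ⟨(hV hy).1, fun i j hij =>
      e.injective (Subtype.ext ((hV hy).2.injOn (e i).2 (e j).2 hij)), ?_⟩⟩
    rw [← (hV hy).2.image_eq, Set.image_eq_range]
    exact e.surjective.range_comp fun f : G.ineff x => G.sec f y
  choose V τ hopen hmem hτ using hlocal
  exact ⟨⟨V, hopen, hmem, τ, fun hy => (hτ _ _ hy).1, fun hy => (hτ _ _ hy).2.1,
    fun hy => (hτ _ _ hy).2.2⟩⟩

namespace IneffEnumeration

variable {G} {N : ℕ} (e : IneffEnumeration G N) {x y z : G₀} {g h : G₁}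

theorem enum_mem (hy : y ∈ e.V x) (i : Fin N) : e.enum x i y ∈ G.ineff y :=
  e.range_enum hy ▸ Set.mem_range_self i

/-- The bijection with the ineffective arrows at a point given by an enumeration. -/
def equiv (hy : y ∈ e.V x) : Fin N ≃ G.ineff y :=
  (Equiv.ofInjective _ (e.injective_enum hy)).trans (Equiv.setCongr (e.range_enum hy))

theorem coe_equiv (hy : y ∈ e.V x) (i : Fin N) : (e.equiv hy i : G₁) = e.enum x i y := rfl

open Classical in
/-- The permutation by which an arrow acts on the enumerated ineffective arrows, with the junk value
`1` for arrows whose end points are outside of the domains of the enumerations. -/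
def perm (y x : G₀) (g : G₁) : Equiv.Perm (Fin N) :=
  if hg : G.s g ∈ e.V x ∧ G.t g ∈ e.V y then
    (e.equiv hg.1).trans (((G.bijOn_conj g).equiv _).trans (e.equiv hg.2).symm)
  else 1

theorem enum_perm (hx : G.s g ∈ e.V x) (hy : G.t g ∈ e.V y) (i : Fin N) :
    e.enum y (e.perm y x g i) (G.t g) = G.conj g (e.enum x i (G.s g)) := by
  rw [← e.coe_equiv hy, perm, dif_pos ⟨hx, hy⟩, Equiv.trans_apply, Equiv.trans_apply,
    Equiv.apply_symm_apply]
  rfl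

theorem perm_mul_perm (hgh : G.s g = G.t h) (hx : G.s h ∈ e.V x) (hy : G.s g ∈ e.V y)
    (hz : G.t g ∈ e.V z) : e.perm z y g * e.perm y x h = e.perm z x (G.mul g h) := by
  refine Equiv.ext fun i => e.injective_enum hz ?_
  have hmul := e.enum_perm (g := G.mul g h) (x := x) (y := z) (by rwa [G.s_mul hgh])
    (by rwa [G.t_mul hgh]) i
  rw [G.s_mul hgh, G.t_mul hgh] at hmul
  change e.enum z (e.perm z y g (e.perm y x h i)) (G.t g) =
    e.enum z (e.perm z x (G.mul g h) i) (G.t g)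
  rw [hmul, e.enum_perm hy hz, hgh, e.enum_perm hx (hgh ▸ hy),
    G.conj_mul hgh (e.enum_mem hx i).1 (t_of_mem_ineff (e.enum_mem hx i))]

theorem eventually_perm_eq (hx : G.s g ∈ e.V x) (hy : G.t g ∈ e.V y) :
    ∀ᶠ h in 𝓝 g, e.perm y x h = e.perm y x g := by
  have hs := (G.smooth_s.continuous.tendsto g).eventually ((e.isOpen_V x).mem_nhds hx)
  have ht := (G.smooth_t.continuous.tendsto g).eventually ((e.isOpen_V y).mem_nhds hy)
  have henum : ∀ᶠ h in 𝓝 g, ∀ i,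
      e.enum y (e.perm y x g i) (G.t h) = G.conj h (e.enum x i (G.s h)) := by
    refine Filter.eventually_all.2 fun i => ?_
    have hleft : Filter.Tendsto (fun h => e.enum y (e.perm y x g i) (G.t h)) (𝓝 g)
        (𝓝 (G.conj g (e.enum x i (G.s g)))) := by
      rw [← e.enum_perm hx hy]
      exact (e.continuousAt_enum hy _).tendsto.comp (G.smooth_t.continuous.tendsto g)
    have hright : Filter.Tendsto (fun h => G.conj h (e.enum x i (G.s h))) (𝓝 g)
        (𝓝 (G.conj g (e.enum x i (G.s g)))) :=
      G.tendsto_conj (e.enum_mem hx i).1 (t_of_mem_ineff (e.enum_mem hx i)) Filter.tendsto_id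
        ((e.continuousAt_enum hx i).tendsto.comp (G.smooth_s.continuous.tendsto g))
        (hs.mono fun h hh => (e.enum_mem hh i).1)
        (hs.mono fun h hh => t_of_mem_ineff (e.enum_mem hh i))
    refine G.eventually_eq_of_tendsto hleft hright ?_
    filter_upwards [hs, ht] with h hhs hht
    rw [(e.enum_mem hht _).1, G.s_conj (e.enum_mem hhs i).1 (t_of_mem_ineff (e.enum_mem hhs i))]
  filter_upwards [henum, hs, ht] with h hh hhs hht
  refine Equiv.ext fun i => e.injective_enum hht ?_
  exact (e.enum_perm hhs hht i).trans (hh i).symm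

theorem conj_eq_of_perm_eq_one (hg : G.s g = G.t g) (hx : G.s g ∈ e.V x)
    (hperm : e.perm x x g = 1) {a : G₁} (ha : a ∈ G.ineff (G.s g)) : G.conj g a = a := by
  rw [← e.range_enum hx] at ha
  obtain ⟨i, rfl⟩ := ha
  have hi := e.enum_perm hx (hg ▸ hx) i
  rw [hperm, ← hg] at hi
  exact hi.symm

end IneffEnumeration

section TrivialCenter

variable [FiniteDimensional ℝ E₀] [FiniteDimensional ℝ E₁] [I₀.Boundaryless] [I₁.Boundaryless]
  [IsManifold I₀ ∞ G₀] [IsManifold I₁ ∞ G₁] [T2Space G₀] [T2Space G₁]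
  [SecondCountableTopology G₀] [SecondCountableTopology G₁]

variable {G} in
theorem eq_unit_of_conj_eq {g : G₁}
    (hcenter : Subgroup.center (G.ineffectiveStabilizer (G.s g)) = ⊥) (hg : G.IsIneffective g)
    (hconj : ∀ a ∈ G.ineff (G.s g), G.conj g a = a) : g = G.unit (G.s g) := by
  let γ : G.ineffectiveStabilizer (G.s g) := ⟨⟨g, rfl, hg.1.symm⟩, hg⟩
  have hγ : γ ∈ Subgroup.center (G.ineffectiveStabilizer (G.s g)) := by
    refine Subgroup.mem_center_iff.2 fun b => ?_
    have hb : b.1.1 ∈ G.ineff (G.s g) := ⟨b.1.2.1, b.2⟩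
    have hcomm := G.conj_mul_self hb.1 (t_of_mem_ineff hb)
    rw [hconj _ hb, G.mul_eq_comp (hb.1.trans hg.1),
      G.mul_eq_comp (t_of_mem_ineff hb).symm] at hcomm
    exact Subtype.ext (Subtype.ext hcomm)
  rw [hcenter, Subgroup.mem_bot] at hγ
  exact congrArg (fun γ : G.ineffectiveStabilizer (G.s g) => γ.1.1) hγ

end TrivialCenter

end OrbifoldGroupoid

end Permutations

/-! ### Invariant metrics -/

theorem contDiff_star_mul_self {A : Type*} [NormedRing A] [NormedAlgebra ℝ A] [StarRing A]
    [StarModule ℝ A] [ContinuousStar A] : ContDiff ℝ ∞ (fun a : A => star a * a) :=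
  (starL' ℝ : A ≃L[ℝ] A).contDiff.mul contDiff_id

section InvariantMetric

variable {E₀ E₁ : Type*} [NormedAddCommGroup E₀] [NormedSpace ℝ E₀]
  [NormedAddCommGroup E₁] [NormedSpace ℝ E₁]
  {H₀ H₁ : Type*} [TopologicalSpace H₀] [TopologicalSpace H₁]
  {I₀ : ModelWithCorners ℝ E₀ H₀} {I₁ : ModelWithCorners ℝ E₁ H₁}
  {G₀ : Type u} {G₁ : Type*} [TopologicalSpace G₀] [ChartedSpace H₀ G₀]
  [TopologicalSpace G₁] [ChartedSpace H₁ G₁]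

namespace OrbifoldGroupoid

section Orbits

variable (G : OrbifoldGroupoid I₀ I₁ G₀ G₁)

/-- The projection to the space of orbits. -/
def orbit (x : G₀) : G.TopQuotient := Quotient.mk G.orbitSetoid x

theorem orbit_eq_iff {x y : G₀} : G.orbit x = G.orbit y ↔ ∃ g, G.s g = x ∧ G.t g = y :=
  Quotient.eq

theorem isOpenQuotientMap_orbit : IsOpenQuotientMap G.orbit := by
  refine ⟨Quotient.mk_surjective, continuous_quotient_mk', fun W hW => ?_⟩
  refine (isQuotientMap_quotient_mk' (s := G.orbitSetoid)).isOpen_preimage.1 ?_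
  convert G.etale.isLocalHomeomorph.isOpenMap _ (hW.preimage G.smooth_t.continuous) using 1
  ext x
  constructor
  · rintro ⟨y, hy, hyx⟩
    obtain ⟨g, rfl, rfl⟩ := G.orbit_eq_iff.1 hyx.symm
    exact ⟨g, hy, rfl⟩
  · rintro ⟨g, hg, rfl⟩
    exact ⟨G.t g, hg, (G.orbit_eq_iff.2 ⟨g, rfl, rfl⟩).symm⟩

theorem t2Space_topQuotient : T2Space G.TopQuotient := by
  rw [t2Space_iff_of_isOpenQuotientMap G.isOpenQuotientMap_orbit]
  convert G.proper.isClosedMap.isClosed_range using 1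
  ext ⟨x, y⟩
  rw [Set.mem_ofPred, G.orbit_eq_iff]
  simp only [Set.mem_range, Prod.ext_iff]

end Orbits

/-- Bump functions on the objects, whose supports are locally finite modulo the groupoid and meet
every orbit. They turn a family of functions on the arrows into invariant functions on the objects,
see `average`. -/
structure OrbitBumpCover [FiniteDimensional ℝ E₀] (G : OrbifoldGroupoid I₀ I₁ G₀ G₁) where
  ι : Type u
  center : ι → G₀
  bump : ∀ a, SmoothBumpFunction I₀ (center a)
  locallyFinite : LocallyFinite fun a => G.orbit '' tsupport (bump a)
  exists_ne_zero : ∀ x, ∃ a g, G.s g = x ∧ bump a (G.t g) ≠ 0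

theorem nonempty_orbitBumpCover [FiniteDimensional ℝ E₀] [T2Space G₀]
    [SecondCountableTopology G₀] (G : OrbifoldGroupoid I₀ I₁ G₀ G₁) :
    Nonempty (OrbitBumpCover G) := by
  have : LocallyCompactSpace G₀ := Manifold.locallyCompact_of_finiteDimensional I₀
  have hq := G.isOpenQuotientMap_orbit
  have := hq.locallyCompactSpace
  have := hq.isQuotientMap.secondCountableTopology hq.isOpenMap
  have := G.t2Space_topQuotient
  have hbasis : ∀ p : G.TopQuotient, (𝓝 p).HasBasis
      (fun f : SmoothBumpFunction I₀ (Quotient.out p) => tsupport f ⊆ Set.univ)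
      (fun f => G.orbit '' Function.support f) := fun p => by
    have hmap := (SmoothBumpFunction.nhds_basis_support (I := I₀) (c := Quotient.out p)
      Filter.univ_mem).map G.orbit
    rwa [hq.map_nhds_eq, show G.orbit (Quotient.out p) = p from Quotient.out_eq p] at hmap
  obtain ⟨ι, c, b, -, hcover, hfin⟩ :=
    refinement_of_locallyCompact_sigmaCompact_of_nhds_basis hbasis
  refine ⟨⟨ι, fun a => Quotient.out (c a), b, hfin.closure.subset fun a =>
    image_closure_subset_closure_image hq.continuous, fun x => ?_⟩⟩
  obtain ⟨a, z, hz, hzx⟩ := Set.mem_iUnion.1 (hcover.symm ▸ Set.mem_univ (G.orbit x))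
  obtain ⟨g, hs, ht⟩ := G.orbit_eq_iff.1 hzx.symm
  exact ⟨a, g, hs, ht ▸ hz⟩

namespace OrbitBumpCover

variable [FiniteDimensional ℝ E₀] {G : OrbifoldGroupoid I₀ I₁ G₀ G₁} (b : OrbitBumpCover G)

/-- The pairs of a bump function and an arrow with source `y`, such that the target of the arrow
lies in the support of the bump function. -/
def fibre (y : G₀) : Set (b.ι × G₁) := {p | G.s p.2 = y ∧ G.t p.2 ∈ tsupport (b.bump p.1)}

variable {b} in
theorem orbit_mem_image_tsupport {a : b.ι} {g : G₁} (hg : G.t g ∈ tsupport (b.bump a)) :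
    G.orbit (G.s g) ∈ G.orbit '' tsupport (b.bump a) :=
  ⟨G.t g, hg, (G.orbit_eq_iff.2 ⟨g, rfl, rfl⟩).symm⟩

theorem isCompact_setOf_mem_tsupport [T2Space G₀] {C : Set G₀} (hC : IsCompact C) (a : b.ι) :
    IsCompact {g | G.s g ∈ C ∧ G.t g ∈ tsupport (b.bump a)} :=
  G.isCompact_setOf_s_mem_t_mem hC (b.bump a).hasCompactSupport

theorem finite_fibre [T2Space G₀] (y : G₀) : (b.fibre y).Finite := by
  refine ((b.locallyFinite.point_finite (G.orbit y)).biUnion fun a _ =>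
    (G.finite_inter_fibre (b.isCompact_setOf_mem_tsupport (isCompact_singleton (x := y)) a) y).image
      (Prod.mk a)).subset ?_
  rintro ⟨a, g⟩ ⟨rfl, hg⟩
  exact Set.mem_biUnion (orbit_mem_image_tsupport hg) ⟨g, ⟨⟨rfl, hg⟩, rfl⟩, rfl⟩

theorem eventually_fibre_subset [T2Space G₀] (x : G₀) :
    ∀ᶠ y in 𝓝 x, b.fibre y ⊆ (fun p => (p.1, G.sec p.2 y)) '' b.fibre x := by
  have : LocallyCompactSpace G₀ := Manifold.locallyCompact_of_finiteDimensional I₀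
  obtain ⟨C, hC, hxC⟩ := exists_compact_mem_nhds x
  obtain ⟨O, hO, hfin⟩ := b.locallyFinite (G.orbit x)
  have hlift := (Filter.eventually_all_finite hfin).2 fun a _ =>
    G.eventually_exists_sec_eq (b.isCompact_setOf_mem_tsupport hC a) x
  filter_upwards [hxC, G.isOpenQuotientMap_orbit.continuous.continuousAt.eventually hO, hlift]
    with y hyC hyO hlift
  rintro ⟨a, g⟩ ⟨rfl, hg⟩
  obtain ⟨f, hf, hfg⟩ :=
    hlift a ⟨_, orbit_mem_image_tsupport hg, hyO⟩ g ⟨hyC, hg⟩ rfl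
  exact ⟨(a, f), ⟨hf.2, hf.1.2⟩, Prod.ext rfl hfg⟩

theorem eventually_injOn_fibre [T2Space G₀] [T2Space G₁] (x : G₀) :
    ∀ᶠ y in 𝓝 x, Set.InjOn (fun p => (p.1, G.sec p.2 y)) (b.fibre x) := by
  filter_upwards [G.eventually_injOn_sec ((b.finite_fibre x).image Prod.snd)
    (by rintro _ ⟨p, hp, rfl⟩; exact hp.1)] with y hy p hp q hq hpq
  exact Prod.ext (Prod.mk.inj hpq).1
    (hy (Set.mem_image_of_mem _ hp) (Set.mem_image_of_mem _ hq) (Prod.mk.inj hpq).2)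

section Average

variable {V V' : Type*} [AddCommGroup V] [Module ℝ V] [AddCommGroup V'] [Module ℝ V']

/-- The sum of a family of functions over the arrows with source `y`, weighted by the values of the
bump functions at the targets. -/
def average (F : b.ι → G₁ → V) (y : G₀) : V :=
  ∑ᶠ p ∈ {p : b.ι × G₁ | G.s p.2 = y}, b.bump p.1 (G.t p.2) • F p.1 p.2

variable {b} {F F' : b.ι → G₁ → V} {y : G₀}

theorem average_congr
    (h : ∀ a g, G.s g = y → G.t g ∈ tsupport (b.bump a) → F a g = F' a g) :
    b.average F y = b.average F' y := by
  refine finsum_mem_congr rfl fun p hp => ?_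
  by_cases hne : b.bump p.1 (G.t p.2) = 0
  · rw [hne, zero_smul, zero_smul]
  · rw [h p.1 p.2 hp (subset_tsupport _ hne)]

theorem average_mul (F : b.ι → G₁ → V) (h : G₁) :
    b.average (fun a g => F a (G.mul g h)) (G.t h) = b.average F (G.s h) := by
  refine finsum_mem_eq_of_bijOn (fun p => (p.1, G.mul p.2 h)) ⟨?_, ?_, ?_⟩ ?_
  · exact fun p hp => G.s_mul hp
  · exact fun p hp q hq hpq => Prod.ext (Prod.mk.inj hpq).1
      (G.mul_right_cancel hp hq (Prod.mk.inj hpq).2)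
  · exact fun p (hp : G.s p.2 = G.s h) => ⟨(p.1, G.mul p.2 (G.inv h)),
      (G.s_mul (hp.trans (G.t_inv h).symm)).trans (G.s_inv h),
      Prod.ext rfl (G.inv_mul_cancel_right hp)⟩
  · exact fun p (hp : G.s p.2 = G.t h) => by rw [G.t_mul hp]

variable [T2Space G₀]

theorem average_eq_sum (F : b.ι → G₁ → V) (y : G₀) :
    b.average F y = ∑ p ∈ (b.finite_fibre y).toFinset, b.bump p.1 (G.t p.2) • F p.1 p.2 := by
  refine finsum_mem_eq_sum_of_inter_support_eq _ (Set.ext fun p => ?_)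
  rw [Set.Finite.coe_toFinset]
  exact and_congr_left fun hp => ⟨fun hs => ⟨hs, subset_tsupport _ (left_ne_zero_of_smul hp)⟩,
    fun hs => hs.1⟩

theorem map_average (Φ : V →ₗ[ℝ] V') (F : b.ι → G₁ → V) (y : G₀) :
    Φ (b.average F y) = b.average (fun a g => Φ (F a g)) y := by
  simp only [average_eq_sum, map_sum, map_smul]

theorem mul_average_mul {A : Type*} [Ring A] [Algebra ℝ A] (c d : A) (F : b.ι → G₁ → A) (y : G₀) :
    c * b.average F y * d = b.average (fun a g => c * F a g * d) y :=
  map_average ((LinearMap.mulRight ℝ d).comp (LinearMap.mulLeft ℝ c)) F y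

theorem star_average {A : Type*} [AddCommGroup A] [Module ℝ A] [StarAddMonoid A] [StarModule ℝ A]
    (F : b.ι → G₁ → A) (y : G₀) : star (b.average F y) = b.average (fun a g => star (F a g)) y :=
  map_average (starLinearEquiv ℝ : A ≃ₗ⋆[ℝ] A).toLinearMap F y

theorem average_pos {F : b.ι → G₁ → ℝ}
    (hF : ∀ a g, G.s g = y → G.t g ∈ tsupport (b.bump a) → 0 < F a g) : 0 < b.average F y := by
  obtain ⟨a, g, hg, hne⟩ := b.exists_ne_zero y
  have hmem : (a, g) ∈ (b.finite_fibre y).toFinset :=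
    (Set.Finite.mem_toFinset _).2 ⟨hg, subset_tsupport _ hne⟩
  rw [average_eq_sum]
  refine Finset.sum_pos' (fun p hp => ?_) ⟨_, hmem,
    mul_pos ((b.bump a).nonneg.lt_of_ne' hne) (hF a g hg (subset_tsupport _ hne))⟩
  obtain ⟨hs, ht⟩ := (Set.Finite.mem_toFinset _).1 hp
  exact mul_nonneg (b.bump _).nonneg (hF _ _ hs ht).le

variable [T2Space G₁]

theorem eventually_average_eq (F : b.ι → G₁ → V) (x : G₀) :
    ∀ᶠ y in 𝓝 x, b.average F y =
      ∑ p ∈ (b.finite_fibre x).toFinset, b.bump p.1 (G.t (G.sec p.2 y)) • F p.1 (G.sec p.2 y) := by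
  have hs : ∀ᶠ y in 𝓝 x, ∀ p ∈ b.fibre x, G.s (G.sec p.2 y) = y :=
    (Filter.eventually_all_finite (b.finite_fibre x)).2 fun p hp =>
      hp.1 ▸ G.eventually_s_sec p.2
  filter_upwards [b.eventually_fibre_subset x, b.eventually_injOn_fibre x, hs] with y hsub hinj hs
  rw [← finsum_mem_eq_finite_toFinset_sum,
    ← finsum_mem_image (f := fun p : b.ι × G₁ => b.bump p.1 (G.t p.2) • F p.1 p.2) hinj]
  refine finsum_mem_inter_support_eq _ _ _ (Set.ext fun p => and_congr_left fun hp => ?_)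
  refine ⟨fun hp_s => hsub ⟨hp_s, subset_tsupport _ (left_ne_zero_of_smul hp)⟩, ?_⟩
  rintro ⟨q, hq, rfl⟩
  exact hs q hq

end Average

section Square

variable [T2Space G₀] {A : Type*} [NormedRing A] [NormedAlgebra ℝ A] [StarRing A]

/-- The average of the squares `star T * T` of a family of functions on the arrows. -/
def averageSq (T : b.ι → G₁ → A) (y : G₀) : A :=
  b.average (fun a g => star (T a g) * T a g) y

variable {b}

theorem star_averageSq [StarModule ℝ A] (T : b.ι → G₁ → A) (y : G₀) :
    star (b.averageSq T y) = b.averageSq T y := by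
  simp only [averageSq, star_average, star_mul, star_star]

theorem averageSq_s {T T' : b.ι → G₁ → A} {h : G₁} {c : A}
    (hT : ∀ a g, G.s g = G.t h → G.t g ∈ tsupport (b.bump a) →
      T a (G.mul g h) = T' a g * c) :
    b.averageSq T (G.s h) = star c * b.averageSq T' (G.t h) * c := by
  calc b.averageSq T (G.s h)
      = b.average (fun a g => star (T a (G.mul g h)) * T a (G.mul g h)) (G.t h) :=
        (average_mul _ h).symm
    _ = b.average (fun a g => star c * (star (T' a g) * T' a g) * c) (G.t h) :=
        average_congr fun a g hs ht => by
          rw [hT a g hs ht, star_mul]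
          simp only [mul_assoc]
    _ = star c * b.averageSq T' (G.t h) * c := (mul_average_mul _ _ _ _).symm

variable [IsManifold I₀ ∞ G₀] [T2Space G₁]

theorem contMDiffAt_average {V : Type*} [NormedAddCommGroup V] [NormedSpace ℝ V]
    {F : b.ι → G₁ → V} {x : G₀}
    (hF : ∀ a g, G.s g = x → G.t g ∈ tsupport (b.bump a) → ContMDiffAt I₁ 𝓘(ℝ, V) ∞ (F a) g) :
    ContMDiffAt I₀ 𝓘(ℝ, V) ∞ (b.average F) x := by
  refine ContMDiffAt.congr_of_eventuallyEq (contMDiffAt_finsetSum fun p hp => ?_)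
    (b.eventually_average_eq F x)
  obtain ⟨a, g⟩ := p
  obtain ⟨rfl, ht⟩ := (Set.Finite.mem_toFinset _).1 hp
  have hbump : ContMDiffAt I₁ 𝓘(ℝ, ℝ) ∞ (fun g => b.bump a (G.t g)) g :=
    ((b.bump a).contMDiff.comp G.smooth_t).contMDiffAt
  exact ContMDiffAt.comp_of_eq (hbump.smul (hF a g rfl ht)) (G.contMDiffAt_sec g)
    (G.sec_s_self g)

theorem contMDiffAt_averageSq [StarModule ℝ A] [ContinuousStar A] {T : b.ι → G₁ → A} {x : G₀}
    (hT : ∀ a g, G.s g = x → G.t g ∈ tsupport (b.bump a) → ContMDiffAt I₁ 𝓘(ℝ, A) ∞ (T a) g) :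
    ContMDiffAt I₀ 𝓘(ℝ, A) ∞ (b.averageSq T) x :=
  contMDiffAt_average fun a g hs ht =>
    contDiff_star_mul_self.contMDiff.contMDiffAt.comp g (hT a g hs ht)

end Square

variable [I₀.Boundaryless] [T2Space G₀]

local notation "𝔼" => EuclideanSpace ℝ (Fin (Module.finrank ℝ E₀))

/-- The operator which represents, in the coordinates at `x`, the inner product on the tangent
space at `y` obtained by averaging the pullbacks of the inner products of the charts at the centers
of the bump functions. -/
def metric (x y : G₀) : 𝔼 →L[ℝ] 𝔼 :=
  b.averageSq (fun a => G.jac (b.center a) x) y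

variable {b} {x y : G₀} {a : b.ι} {g : G₁}

theorem mem_jacDomain (hx : G.s g ∈ (coord I₀ x).source) (hg : G.t g ∈ tsupport (b.bump a)) :
    g ∈ G.jacDomain (b.center a) x :=
  ⟨hx, (b.bump a).tsupport_subset_chartAt_source hg⟩

theorem star_metric (x y : G₀) : star (b.metric x y) = b.metric x y :=
  star_averageSq _ _

variable [IsManifold I₀ ∞ G₀]

theorem inner_metric_pos (hy : y ∈ (coord I₀ x).source) {v : 𝔼} (hv : v ≠ 0) :
    0 < inner ℝ (b.metric x y v) v := by
  let Φ : (𝔼 →L[ℝ] 𝔼) →ₗ[ℝ] ℝ :=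
    (innerₗ 𝔼 v).comp (ContinuousLinearMap.apply ℝ 𝔼 v).toLinearMap
  have hΦ : ∀ T, Φ T = inner ℝ (T v) v := fun T => real_inner_comm (T v) v
  rw [← hΦ, metric, averageSq, map_average]
  refine average_pos fun a g hg ht => ?_
  have hne : G.jac (b.center a) x g v ≠ 0 := fun h0 => hv <|
    (ContinuousLinearMap.isUnit_iff_bijective.1
      (G.isUnit_jac (mem_jacDomain (hg ▸ hy) ht))).1 (h0.trans (map_zero _).symm)
  rw [hΦ, mul_apply_eq_comp, ContinuousLinearMap.star_eq_adjoint,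
    ContinuousLinearMap.adjoint_inner_left, real_inner_self_eq_norm_sq]
  positivity

theorem isPositive_metric (hy : y ∈ (coord I₀ x).source) : (b.metric x y).IsPositive := by
  refine (ContinuousLinearMap.isPositive_iff' _).2 ⟨star_metric x y, fun v => ?_⟩
  rcases eq_or_ne v 0 with rfl | hv
  · rw [map_zero, inner_zero_left]
  · exact (inner_metric_pos hy hv).le

theorem isUnit_metric (hy : y ∈ (coord I₀ x).source) : IsUnit (b.metric x y) := by
  have hinj : Function.Injective (b.metric x y) := (injective_iff_map_eq_zero _).2 fun v hv => by
    by_contra hne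
    have hpos := inner_metric_pos (b := b) hy hne
    rw [hv, inner_zero_left] at hpos
    exact lt_irrefl _ hpos
  exact ContinuousLinearMap.isUnit_iff_bijective.2
    ⟨hinj, LinearMap.injective_iff_surjective (f := (b.metric x y).toLinearMap).1 hinj⟩

theorem metric_s (hg : g ∈ G.jacDomain y x) :
    b.metric x (G.s g) = star (G.jac y x g) * b.metric y (G.t g) * G.jac y x g :=
  averageSq_s fun _ _ hs ht =>
    (G.jac_mul_jac hs hg.1 (hs ▸ hg.2) (mem_jacDomain (hs ▸ hg.2) ht).2).symm

theorem contMDiffOn_metric [T2Space G₁] (x : G₀) :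
    ContMDiffOn I₀ 𝓘(ℝ, 𝔼 →L[ℝ] 𝔼) ∞ (b.metric x) (coord I₀ x).source := fun _ hy =>
  (contMDiffAt_averageSq fun _ _ hg ht => (G.contMDiffOn_jac x _).contMDiffAt
    ((G.isOpen_jacDomain _ _).mem_nhds (mem_jacDomain (hg ▸ hy) ht))).contMDiffWithinAt

end OrbitBumpCover

end OrbifoldGroupoid

end InvariantMetric

/-! ### Orthonormal frames -/

section SquareRoot

variable {A : Type*} [NormedRing A] [NormedAlgebra ℝ A] [CompleteSpace A]

theorem exists_contDiffAt_sqrt_one : ∃ r : A → A, ContDiffAt ℝ ω r 1 ∧ r 1 = 1 ∧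
    (∀ᶠ a in 𝓝 1, r a * r a = a) ∧ ∀ᶠ a in 𝓝 1, r (a * a) = a := by
  have hsq : ContDiffAt ℝ ω (fun a : A => a * a) 1 := contDiffAt_id.mul contDiffAt_id
  let double : A ≃L[ℝ] A := ContinuousLinearEquiv.smulLeft (Units.mk0 (2 : ℝ) two_ne_zero)
  have hderiv : HasFDerivAt (fun a : A => a * a) (double : A →L[ℝ] A) 1 := by
    refine ((hasFDerivAt_id (𝕜 := ℝ) (1 : A)).mul' (hasFDerivAt_id 1)).congr_fderiv ?_
    ext a
    change (1 : A) * a + a * 1 = (2 : ℝ) • a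
    rw [one_mul, mul_one, two_smul]
  have hω : (ω : WithTop ℕ∞) ≠ 0 := by simp
  have hstrict := hsq.hasStrictFDerivAt' hderiv hω
  have hsmooth := hsq.to_localInverse hderiv hω
  have hone := hsq.localInverse_apply_image hderiv hω
  have hright := hstrict.eventually_right_inverse
  simp only [mul_one] at hsmooth hone hright
  exact ⟨_, hsmooth, hone, hright, hstrict.eventually_left_inverse⟩

variable [StarRing A] [ContinuousStar A]

theorem exists_isSelfAdjoint_sqrt_one : ∃ r : A → A, ∀ᶠ a in 𝓝 1, ContDiffAt ℝ ∞ r a ∧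
    r a * r a = a ∧ (IsSelfAdjoint a → IsSelfAdjoint (r a)) ∧ IsUnit (r a) := by
  obtain ⟨r, hr, hr_one, hright, hleft⟩ := exists_contDiffAt_sqrt_one (A := A)
  have htendsto : Filter.Tendsto r (𝓝 1) (𝓝 1) := by
    simpa only [hr_one] using hr.continuousAt.tendsto
  have htendsto_star : Filter.Tendsto (fun a => star (r a)) (𝓝 1) (𝓝 1) := by
    simpa only [star_one] using htendsto.star
  have hunit : ∀ᶠ a in 𝓝 (1 : A), IsUnit a := Units.isOpen.mem_nhds isUnit_one
  refine ⟨r, ?_⟩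
  filter_upwards [hr.eventually (by simp), hright, htendsto_star.eventually hleft,
    htendsto.eventually hunit] with a hra hsq hstar hu
  refine ⟨hra.of_le le_top, hsq, fun ha => ?_, hu⟩
  -- `star (r a)` is another square root of `a` near `1`.
  rw [← star_mul, hsq, ha.star_eq] at hstar
  exact hstar.symm

theorem exists_contDiffAt_star_mul_self_eq {S : A} (hS : IsUnit S) :
    ∃ R : A → A, ∀ᶠ T in 𝓝 (star S * S), ContDiffAt ℝ ∞ R T ∧
      (IsSelfAdjoint T → star (R T) * R T = T) ∧ IsUnit (R T) := by
  obtain ⟨S, rfl⟩ := hS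
  obtain ⟨r, hr⟩ := exists_isSelfAdjoint_sqrt_one (A := A)
  let φ : A → A := fun T => star (↑S⁻¹ : A) * T * (↑S⁻¹ : A)
  have hφ : ContDiff ℝ ∞ φ := (contDiff_const.mul contDiff_id).mul contDiff_const
  have hstar_inv : star (↑S⁻¹ : A) * star (S : A) = 1 := by rw [← star_mul, S.mul_inv, star_one]
  have hinv_star : star (S : A) * star (↑S⁻¹ : A) = 1 := by rw [← star_mul, S.inv_mul, star_one]
  have hφ_one : φ (star (S : A) * S) = 1 := by
    simp only [φ, ← mul_assoc, hstar_inv, one_mul, S.mul_inv]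
  have htendsto : Filter.Tendsto φ (𝓝 (star (S : A) * S)) (𝓝 1) := by
    simpa only [hφ_one] using hφ.continuous.tendsto (star (S : A) * S)
  refine ⟨fun T => r (φ T) * S, ?_⟩
  filter_upwards [htendsto.eventually hr] with T ⟨hsmooth, hsq, hsa, hunit⟩
  refine ⟨(hsmooth.comp T hφ.contDiffAt).mul contDiffAt_const, fun hT => ?_,
    hunit.mul S.isUnit⟩
  calc star (r (φ T) * S) * (r (φ T) * S)
      = star (S : A) * (r (φ T) * r (φ T)) * S := by
        rw [star_mul, (hsa (hT.conjugate' _)).star_eq]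
        simp only [mul_assoc]
    _ = star (S : A) * star (↑S⁻¹ : A) * T * (↑S⁻¹ * S) := by
        rw [hsq]
        simp only [φ, mul_assoc]
    _ = T := by rw [hinv_star, one_mul, S.inv_mul, mul_one]

end SquareRoot

section PositiveOperators

variable {𝕜 E : Type*} [RCLike 𝕜] [NormedAddCommGroup E] [InnerProductSpace 𝕜 E]
  [FiniteDimensional 𝕜 E]

open scoped MatrixOrder in
theorem exists_linearMap_star_mul_self_eq {T : E →ₗ[𝕜] E} (hT : T.IsPositive) :
    ∃ S : E →ₗ[𝕜] E, star S * S = T := by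
  let Φ := LinearMap.toMatrixOrthonormal (stdOrthonormalBasis 𝕜 E)
  have hΦT : 0 ≤ Φ T := Matrix.nonneg_iff_posSemidef.2 ((LinearMap.posSemidef_toMatrix_iff _).2 hT)
  obtain ⟨B, hB⟩ := CStarAlgebra.nonneg_iff_eq_star_mul_self.1 hΦT
  exact ⟨Φ.symm B, by rw [← map_star, ← map_mul, ← hB, StarAlgEquiv.symm_apply_apply]⟩

theorem exists_isUnit_star_mul_self_eq [CompleteSpace E] {T : E →L[𝕜] E} (hT : T.IsPositive)
    (hunit : IsUnit T) : ∃ S : E →L[𝕜] E, IsUnit S ∧ star S * S = T := by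
  obtain ⟨S, hS⟩ := exists_linearMap_star_mul_self_eq hT
  let Ψ := Module.End.toContinuousLinearMap (𝕜 := 𝕜) E
  have hS_unit : IsUnit S := by
    refine isUnit_of_mul_isUnit_right (x := star S) ?_
    rw [hS]
    exact hunit.map Ψ.symm
  refine ⟨Ψ S, hS_unit.map Ψ, ?_⟩
  have hstar : star (Ψ S) = Ψ (star S) := rfl
  rw [hstar, ← map_mul, hS]
  rfl

end PositiveOperators

section Frames

variable {E₀ E₁ : Type*} [NormedAddCommGroup E₀] [NormedSpace ℝ E₀]
  [NormedAddCommGroup E₁] [NormedSpace ℝ E₁]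
  {H₀ H₁ : Type*} [TopologicalSpace H₀] [TopologicalSpace H₁]
  {I₀ : ModelWithCorners ℝ E₀ H₀} {I₁ : ModelWithCorners ℝ E₁ H₁}
  {G₀ : Type u} {G₁ : Type*} [TopologicalSpace G₀] [ChartedSpace H₀ G₀]
  [TopologicalSpace G₁] [ChartedSpace H₁ G₁] [FiniteDimensional ℝ E₀] [I₀.Boundaryless]

local notation "𝔼" => EuclideanSpace ℝ (Fin (Module.finrank ℝ E₀))

namespace OrbifoldGroupoid

/-- Smooth local frames on the objects which are orthonormal for a common invariant metric, written
in the coordinates `coord I₀ x`: the operators `star (frame x y) * frame x y` represent that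
metric. -/
structure OrthonormalFrames (G : OrbifoldGroupoid I₀ I₁ G₀ G₁) where
  U : G₀ → Set G₀
  isOpen_U : ∀ x, IsOpen (U x)
  mem_U : ∀ x, x ∈ U x
  U_subset : ∀ x, U x ⊆ (coord I₀ x).source
  frame : G₀ → G₀ → 𝔼 →L[ℝ] 𝔼
  contMDiffOn_frame : ∀ x, ContMDiffOn I₀ 𝓘(ℝ, 𝔼 →L[ℝ] 𝔼) ∞ (frame x) (U x)
  isUnit_frame : ∀ {x y}, y ∈ U x → IsUnit (frame x y)
  invariant : ∀ {x y g}, G.s g ∈ U x → G.t g ∈ U y →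
    star (frame x (G.s g)) * frame x (G.s g) =
      star (G.jac y x g) * (star (frame y (G.t g)) * frame y (G.t g)) * G.jac y x g

variable [IsManifold I₀ ∞ G₀] [T2Space G₀] [T2Space G₁]
  {G : OrbifoldGroupoid I₀ I₁ G₀ G₁}

open OrbitBumpCover in
theorem OrbitBumpCover.exists_star_mul_self_eq_metric (b : OrbitBumpCover G) (x : G₀) :
    ∃ (U : Set G₀) (B : G₀ → 𝔼 →L[ℝ] 𝔼), IsOpen U ∧ x ∈ U ∧ U ⊆ (coord I₀ x).source ∧
      ContMDiffOn I₀ 𝓘(ℝ, 𝔼 →L[ℝ] 𝔼) ∞ B U ∧ (∀ y ∈ U, IsUnit (B y)) ∧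
      ∀ y ∈ U, star (B y) * B y = b.metric x y := by
  have hx : x ∈ (coord I₀ x).source := mem_coord_source x
  obtain ⟨S, hS, hSx⟩ := exists_isUnit_star_mul_self_eq (isPositive_metric (b := b) hx)
    (isUnit_metric hx)
  obtain ⟨R, hR⟩ := exists_contDiffAt_star_mul_self_eq (A := 𝔼 →L[ℝ] 𝔼) hS
  have hmetric : ∀ y ∈ (coord I₀ x).source,
      ContMDiffAt I₀ 𝓘(ℝ, 𝔼 →L[ℝ] 𝔼) ∞ (b.metric x) y := fun y hy =>
    (contMDiffOn_metric x).contMDiffAt ((coord I₀ x).open_source.mem_nhds hy)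
  obtain ⟨U, hU, hUo, hxU⟩ := eventually_nhds_iff.1
    (((hmetric x hx).continuousAt.eventually (hSx ▸ hR)).and
      ((coord I₀ x).open_source.mem_nhds hx))
  exact ⟨U, R ∘ b.metric x, hUo, hxU, fun y hy => (hU y hy).2,
    fun y hy => ((hU y hy).1.1.contMDiffAt.comp y (hmetric y (hU y hy).2)).contMDiffWithinAt,
    fun y hy => (hU y hy).1.2.2, fun y hy => (hU y hy).1.2.1 (star_metric x y)⟩

theorem nonempty_orthonormalFrames [SecondCountableTopology G₀]
    (G : OrbifoldGroupoid I₀ I₁ G₀ G₁) : Nonempty (OrthonormalFrames G) := by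
  obtain ⟨b⟩ := nonempty_orbitBumpCover G
  choose U B hUo hxU hU hB hunit hmetric using b.exists_star_mul_self_eq_metric
  refine ⟨⟨U, hUo, hxU, hU, B, hB, hunit _ _, fun {x y g} hx hy => ?_⟩⟩
  rw [hmetric x _ hx, hmetric y _ hy, OrbitBumpCover.metric_s ⟨hU x hx, hU y hy⟩]

end OrbifoldGroupoid

end Frames

/-! ### Existence of a faithful cocycle -/

section PermutationOperators

variable {ι : Type*} [Fintype ι]

variable (ι) in
/-- The permutation representation of the symmetric group by unitary operators. -/
def permUnitary : Equiv.Perm ι →* unitary (EuclideanSpace ℝ ι →L[ℝ] EuclideanSpace ℝ ι) :=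
  (Unitary.linearIsometryEquiv (𝕜 := ℝ) (H := EuclideanSpace ℝ ι)).symm.toMonoidHom.comp
    { toFun := LinearIsometryEquiv.piLpCongrLeft 2 ℝ ℝ
      map_one' := rfl
      map_mul' _ _ := LinearIsometryEquiv.ext fun _ => rfl }

theorem permUnitary_single [DecidableEq ι] (σ : Equiv.Perm ι) (i : ι) (a : ℝ) :
    (permUnitary ι σ).1 (EuclideanSpace.single i a) = EuclideanSpace.single (σ i) a :=
  EuclideanSpace.piLpCongrLeft_single σ i a

theorem permUnitary_injective : Function.Injective (permUnitary ι) := fun σ τ h => by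
  classical
  refine Equiv.ext fun i => ?_
  have hsingle : EuclideanSpace.single (σ i) (1 : ℝ) = EuclideanSpace.single (τ i) 1 := by
    rw [← permUnitary_single, h, permUnitary_single]
  simpa using congrArg (fun v : EuclideanSpace ℝ ι => v (σ i)) hsingle

end PermutationOperators

section FrameChange

variable {A : Type*} [NormedRing A]

/-- The operator which represents `J` in the frames `b` on the source and `b'` on the target. -/
def frameChange (b' J b : A) : A := b' * J * Ring.inverse b

theorem frameChange_mul_frameChange {b₁ b₂ b₃ J J' : A} (h : IsUnit b₂) :
    frameChange b₃ J' b₂ * frameChange b₂ J b₁ = frameChange b₃ (J' * J) b₁ := by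
  simp only [frameChange, mul_assoc, Ring.inverse_mul_cancel_left _ _ h]

theorem eq_one_of_frameChange_eq_one {b J : A} (hb : IsUnit b) (h : frameChange b J b = 1) :
    J = 1 := by
  have hJ : b * J * Ring.inverse b * b = b := by rw [← frameChange, h, one_mul]
  rw [mul_assoc, Ring.inverse_mul_cancel _ hb, mul_one] at hJ
  exact hb.mul_left_cancel (hJ.trans (mul_one b).symm)

theorem frameChange_mem_unitary [StarRing A] {b' J b : A} (hb' : IsUnit b') (hJ : IsUnit J)
    (hb : IsUnit b) (h : star b * b = star J * (star b' * b') * J) :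
    frameChange b' J b ∈ unitary A := by
  refine ((hb'.mul hJ).mul hb.ringInverse).mem_unitary_of_star_mul_self ?_
  calc star (b' * J * Ring.inverse b) * (b' * J * Ring.inverse b)
      = star (Ring.inverse b) * (star J * (star b' * b') * J) * Ring.inverse b := by
        simp only [star_mul, mul_assoc]
    _ = star (b * Ring.inverse b) * (b * Ring.inverse b) := by
        rw [← h]
        simp only [star_mul, mul_assoc]
    _ = 1 := by rw [Ring.mul_inverse_cancel _ hb, star_one, one_mul]

theorem contMDiffWithinAt_frameChange [NormedAlgebra ℝ A] [CompleteSpace A]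
    {E' H' M : Type*} [NormedAddCommGroup E'] [NormedSpace ℝ E'] [TopologicalSpace H']
    {I' : ModelWithCorners ℝ E' H'} [TopologicalSpace M] [ChartedSpace H' M] {b' J b : M → A}
    {S : Set M} {x : M} (hb' : ContMDiffWithinAt I' 𝓘(ℝ, A) ∞ b' S x)
    (hJ : ContMDiffWithinAt I' 𝓘(ℝ, A) ∞ J S x) (hb : ContMDiffWithinAt I' 𝓘(ℝ, A) ∞ b S x)
    (hu : IsUnit (b x)) :
    ContMDiffWithinAt I' 𝓘(ℝ, A) ∞ (fun y => frameChange (b' y) (J y) (b y)) S x := by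
  obtain ⟨w, hw⟩ := hu
  have hinv : ContDiffAt ℝ ∞ (Ring.inverse : A → A) (b x) := hw ▸ contDiffAt_ringInverse ℝ w
  have hmul : ContDiff ℝ ∞ (fun p : (A × A) × A => p.1.1 * p.1.2 * p.2) :=
    ((contDiff_fst.comp contDiff_fst).mul (contDiff_snd.comp contDiff_fst)).mul contDiff_snd
  exact hmul.contMDiff.contMDiffAt.comp_contMDiffWithinAt x
    ((hb'.prodMk_space hJ).prodMk_space (hinv.contMDiffAt.comp_contMDiffWithinAt x hb))

end FrameChange

section Cocycles

variable {E₀ E₁ : Type*} [NormedAddCommGroup E₀] [NormedSpace ℝ E₀]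
  [NormedAddCommGroup E₁] [NormedSpace ℝ E₁]
  {H₀ H₁ : Type*} [TopologicalSpace H₀] [TopologicalSpace H₁]
  {I₀ : ModelWithCorners ℝ E₀ H₀} {I₁ : ModelWithCorners ℝ E₁ H₁}
  {G₀ : Type u} {G₁ : Type*} [TopologicalSpace G₀] [ChartedSpace H₀ G₀]
  [TopologicalSpace G₁] [ChartedSpace H₁ G₁]

section Unitary

variable {A A₁ A₂ : Type*} [NormedRing A] [NormedAlgebra ℝ A] [StarRing A]
  [NormedRing A₁] [NormedAlgebra ℝ A₁] [StarRing A₁]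
  [NormedRing A₂] [NormedAlgebra ℝ A₂] [StarRing A₂]
  {G : OrbifoldGroupoid I₀ I₁ G₀ G₁}

/-- A smooth cocycle with values in the unitary group of `A`, not necessarily faithful, over an open
cover as in `FaithfulCocycle`. The values are recorded as elements of `A`, where smoothness does not
refer to charts of the unitary group. -/
structure UnitaryCocycle (G : OrbifoldGroupoid I₀ I₁ G₀ G₁) (A : Type*) [NormedRing A]
    [NormedAlgebra ℝ A] [StarRing A] where
  U : G₀ → Set G₀
  isOpen_U : ∀ x, IsOpen (U x)
  mem_U : ∀ x, x ∈ U x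
  val : G₀ → G₀ → G₁ → A
  mem_unitary : ∀ {x y g}, G.s g ∈ U x → G.t g ∈ U y → val y x g ∈ unitary A
  smooth : ∀ x y, ContMDiffOn I₁ 𝓘(ℝ, A) ∞ (val y x) {g | G.s g ∈ U x ∧ G.t g ∈ U y}
  cocycle : ∀ {x y z g h}, G.s g = G.t h → G.s h ∈ U x → G.s g ∈ U y → G.t g ∈ U z →
    val z y g * val y x h = val z x (G.mul g h)

namespace UnitaryCocycle

/-- The cocycle with values in the product of two unitary groups given by two cocycles. -/
def prod (c₁ : UnitaryCocycle G A₁) (c₂ : UnitaryCocycle G A₂) :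
    UnitaryCocycle G (A₁ × A₂) where
  U x := c₁.U x ∩ c₂.U x
  isOpen_U x := (c₁.isOpen_U x).inter (c₂.isOpen_U x)
  mem_U x := ⟨c₁.mem_U x, c₂.mem_U x⟩
  val y x g := (c₁.val y x g, c₂.val y x g)
  mem_unitary hx hy :=
    have h₁ := c₁.mem_unitary hx.1 hy.1
    have h₂ := c₂.mem_unitary hx.2 hy.2
    ⟨Prod.ext h₁.1 h₂.1, Prod.ext h₁.2 h₂.2⟩
  smooth x y := ((c₁.smooth x y).mono fun _ hg => ⟨hg.1.1, hg.2.1⟩).prodMk_space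
    ((c₂.smooth x y).mono fun _ hg => ⟨hg.1.2, hg.2.2⟩)
  cocycle hgh hx hy hz :=
    Prod.ext (c₁.cocycle hgh hx.1 hy.1 hz.1) (c₂.cocycle hgh hx.2 hy.2 hz.2)

/-- A unitary cocycle that is injective on stabilizers, as a cocycle with values in the Lie group
`unitary A`. -/
def toFaithfulCocycle [StarModule ℝ A] [ContinuousStar A] [CompleteSpace A]
    [FiniteDimensional ℝ (Skew A)] (c : UnitaryCocycle G A)
    (faithful : ∀ x g, G.s g = G.t g → G.s g ∈ c.U x → c.val x x g = 1 → g = G.unit (G.s g)) :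
    FaithfulCocycle G (𝓡 (Module.finrank ℝ (Skew A))) (unitary A) where
  U := c.U
  isOpen_U := c.isOpen_U
  mem_U := c.mem_U
  val y x g := toUnitary (c.val y x g)
  smooth x y g hg := contMDiffWithinAt_of_coe_unitary <|
    (c.smooth x y g hg).congr (fun _ hh => coe_toUnitary (c.mem_unitary hh.1 hh.2))
      (coe_toUnitary (c.mem_unitary hg.1 hg.2))
  cocycle x y z g h hgh hx hy hz := Subtype.ext <| by
    rw [Submonoid.coe_mul, coe_toUnitary (c.mem_unitary hy hz),
      coe_toUnitary (c.mem_unitary hx (hgh ▸ hy)), c.cocycle hgh hx hy hz,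
      coe_toUnitary (c.mem_unitary (by rwa [G.s_mul hgh]) (by rwa [G.t_mul hgh]))]
  faithful x g hg hx hval := faithful x g hg hx <| by
    rw [← coe_toUnitary (c.mem_unitary hx (hg ▸ hx)), hval, OneMemClass.coe_one]

theorem exists_faithfulCocycle_of_prod {A₁ A₂ : Type}
    [NormedRing A₁] [NormedAlgebra ℝ A₁] [StarRing A₁] [StarModule ℝ A₁] [CStarRing A₁]
    [FiniteDimensional ℝ A₁]
    [NormedRing A₂] [NormedAlgebra ℝ A₂] [StarRing A₂] [StarModule ℝ A₂] [CStarRing A₂]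
    [FiniteDimensional ℝ A₂] (c₁ : UnitaryCocycle G A₁) (c₂ : UnitaryCocycle G A₂)
    (faithful : ∀ x g, G.s g = G.t g → G.s g ∈ c₁.U x → G.s g ∈ c₂.U x → c₁.val x x g = 1 →
      c₂.val x x g = 1 → g = G.unit (G.s g)) :
    ∃ (A : Type) (_ : NormedRing A) (_ : NormedAlgebra ℝ A) (_ : StarRing A) (_ : StarModule ℝ A)
      (_ : CStarRing A) (_ : FiniteDimensional ℝ A),
      Nonempty (FaithfulCocycle G (𝓡 (Module.finrank ℝ (Skew A))) (unitary A)) := by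
  have := FiniteDimensional.complete ℝ (A₁ × A₂)
  refine ⟨A₁ × A₂, inferInstance, inferInstance, inferInstance, inferInstance, inferInstance,
    inferInstance, ⟨(c₁.prod c₂).toFaithfulCocycle fun x g hg hx hone => ?_⟩⟩
  exact faithful x g hg hx.1 hx.2 (congrArg Prod.fst hone) (congrArg Prod.snd hone)

end UnitaryCocycle

end Unitary

section Permutations

variable {G : OrbifoldGroupoid I₀ I₁ G₀ G₁}

/-- The permutation cocycle of the ineffective stabilizers, represented by operators. -/
def OrbifoldGroupoid.IneffEnumeration.unitaryCocycle {N : ℕ} (e : G.IneffEnumeration N) :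
    UnitaryCocycle G (EuclideanSpace ℝ (Fin N) →L[ℝ] EuclideanSpace ℝ (Fin N)) where
  U := e.V
  isOpen_U := e.isOpen_V
  mem_U := e.mem_V
  val y x g := permUnitary (Fin N) (e.perm y x g)
  mem_unitary _ _ := (permUnitary (Fin N) _).2
  smooth x y g hg := contMDiffWithinAt_const.congr_of_eventuallyEq
    (mem_nhdsWithin_of_mem_nhds <| (e.eventually_perm_eq hg.1 hg.2).mono fun _ hh =>
      congrArg (fun σ => (permUnitary (Fin N) σ).1) hh)
    rfl
  cocycle hgh hx hy hz := by
    rw [← Submonoid.coe_mul, ← map_mul, e.perm_mul_perm hgh hx hy hz]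

end Permutations

variable [FiniteDimensional ℝ E₀] [I₀.Boundaryless]

local notation "𝔼" => EuclideanSpace ℝ (Fin (Module.finrank ℝ E₀))

namespace OrbifoldGroupoid

variable {G : OrbifoldGroupoid I₀ I₁ G₀ G₁}

namespace OrthonormalFrames

variable (f : OrthonormalFrames G) {x y z : G₀} {g h : G₁}

variable [IsManifold I₀ ∞ G₀]

/-- The cocycle of Jacobians of arrows, in orthonormal frames. -/
def unitaryCocycle : UnitaryCocycle G (𝔼 →L[ℝ] 𝔼) where
  U := f.U
  isOpen_U := f.isOpen_U
  mem_U := f.mem_U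
  val y x g := frameChange (A := 𝔼 →L[ℝ] 𝔼) (f.frame y (G.t g)) (G.jac y x g) (f.frame x (G.s g))
  mem_unitary hx hy := frameChange_mem_unitary (A := 𝔼 →L[ℝ] 𝔼) (f.isUnit_frame hy)
    (G.isUnit_jac ⟨f.U_subset _ hx, f.U_subset _ hy⟩) (f.isUnit_frame hx) (f.invariant hx hy)
  smooth x y g hg := contMDiffWithinAt_frameChange (A := 𝔼 →L[ℝ] 𝔼)
    ((f.contMDiffOn_frame y _ hg.2).comp g G.smooth_t.contMDiffAt.contMDiffWithinAt
      fun _ hh => hh.2)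
    ((G.contMDiffOn_jac x y).mono (fun _ hh => ⟨f.U_subset x hh.1, f.U_subset y hh.2⟩) g hg)
    ((f.contMDiffOn_frame x _ hg.1).comp g G.smooth_s.contMDiffAt.contMDiffWithinAt
      fun _ hh => hh.1)
    (f.isUnit_frame hg.1)
  cocycle {x y z g h} hgh hx hy hz := by
    rw [G.s_mul hgh, G.t_mul hgh,
      ← G.jac_mul_jac hgh (f.U_subset x hx) (f.U_subset y hy) (f.U_subset z hz), ← hgh]
    exact frameChange_mul_frameChange (A := 𝔼 →L[ℝ] 𝔼) (f.isUnit_frame hy)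

theorem isIneffective_of_unitaryCocycle_eq_one [T1Space G₀] (hg : G.s g = G.t g)
    (hx : G.s g ∈ f.U x) (hone : f.unitaryCocycle.val x x g = 1) : G.IsIneffective g := by
  change frameChange (A := 𝔼 →L[ℝ] 𝔼) (f.frame x (G.t g)) (G.jac x x g) (f.frame x (G.s g)) = 1
    at hone
  rw [← hg] at hone
  exact G.isIneffective_of_jac_eq_one (f.U_subset x hx) hg
    (eq_one_of_frameChange_eq_one (A := 𝔼 →L[ℝ] 𝔼) (f.isUnit_frame hx) hone)

end OrthonormalFrames

variable [FiniteDimensional ℝ E₁] [I₁.Boundaryless]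
  [IsManifold I₀ ∞ G₀] [IsManifold I₁ ∞ G₁] [T2Space G₀] [T2Space G₁]
  [SecondCountableTopology G₀] [SecondCountableTopology G₁]

variable (G) in
theorem exists_faithfulCocycle_unitary (hconn : G.toSmoothGroupoid.IsConnected)
    (hcenter : ∀ x : G₀, Subgroup.center (G.ineffectiveStabilizer x) = ⊥) :
    ∃ (A : Type) (_ : NormedRing A) (_ : NormedAlgebra ℝ A) (_ : StarRing A) (_ : StarModule ℝ A)
      (_ : CStarRing A) (_ : FiniteDimensional ℝ A),
      Nonempty (FaithfulCocycle G (𝓡 (Module.finrank ℝ (Skew A))) (unitary A)) := by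
  obtain ⟨N, hN⟩ := G.exists_ncard_ineff_eq hconn
  obtain ⟨f⟩ := nonempty_orthonormalFrames G
  obtain ⟨e⟩ := G.nonempty_ineffEnumeration hN
  refine UnitaryCocycle.exists_faithfulCocycle_of_prod (A₁ := 𝔼 →L[ℝ] 𝔼)
    (A₂ := EuclideanSpace ℝ (Fin N) →L[ℝ] EuclideanSpace ℝ (Fin N))
    f.unitaryCocycle e.unitaryCocycle fun x g hg hx hx' hframe hperm => ?_
  have hperm_one : e.perm x x g = 1 :=
    permUnitary_injective ((Subtype.ext hperm).trans (map_one _).symm)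
  exact eq_unit_of_conj_eq (hcenter _) (f.isIneffective_of_unitaryCocycle_eq_one hg hx hframe)
    fun _ ha => e.conj_eq_of_perm_eq_one hg hx' hperm_one ha

end OrbifoldGroupoid

end Cocycles

end OrbifoldPresentation

end

theorem mainTheorem2_general {E₀ E₁ : Type*}
    [NormedAddCommGroup E₀] [NormedSpace ℝ E₀] [FiniteDimensional ℝ E₀]
    [NormedAddCommGroup E₁] [NormedSpace ℝ E₁] [FiniteDimensional ℝ E₁]
    {H₀ H₁ : Type*} [TopologicalSpace H₀] [TopologicalSpace H₁]
    {I₀ : ModelWithCorners ℝ E₀ H₀} [I₀.Boundaryless]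
    {I₁ : ModelWithCorners ℝ E₁ H₁} [I₁.Boundaryless] {G₀ G₁ : Type u}
    [TopologicalSpace G₀] [ChartedSpace H₀ G₀] [IsManifold I₀ ∞ G₀]
    [T2Space G₀] [SecondCountableTopology G₀]
    [TopologicalSpace G₁] [ChartedSpace H₁ G₁] [IsManifold I₁ ∞ G₁]
    [T2Space G₁] [SecondCountableTopology G₁]
    (G : OrbifoldPresentation.OrbifoldGroupoid I₀ I₁ G₀ G₁)
    (hconn : G.toSmoothGroupoid.IsConnected)
    (hcenter : ∀ x : G₀, Subgroup.center (G.ineffectiveStabilizer x) = ⊥) :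
    ∃ (p : ℕ) (P : Type u) (_ : TopologicalSpace P)
      (_ : ChartedSpace (EuclideanSpace ℝ (Fin p)) P) (_ : IsManifold (𝓡 p) ∞ P)
      (_ : T2Space P) (_ : SecondCountableTopology P)
      (k : ℕ) (K : Type) (_ : Group K) (_ : TopologicalSpace K)
      (_ : ChartedSpace (EuclideanSpace ℝ (Fin k)) K) (_ : LieGroup (𝓡 k) ∞ K)
      (_ : T2Space K) (_ : SecondCountableTopology K) (_ : CompactSpace K)
      (α : OrbifoldPresentation.LieRightAction (𝓡 p) (𝓡 k) P K),
      OrbifoldPresentation.HSEquivalent G.toSmoothGroupoid α.translationGroupoid := by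
  obtain ⟨A, _, _, _, _, _, _, ⟨c⟩⟩ :=
    G.exists_faithfulCocycle_unitary hconn hcenter
  exact ⟨c.totalDim, c.Quot, inferInstance, inferInstance, inferInstance, inferInstance,
    inferInstance, _, _, inferInstance, inferInstance, inferInstance, inferInstance, inferInstance,
    inferInstance, inferInstance, c.quotAction, c.hsEquivalent⟩

theorem mainTheorem2 {n m : ℕ} {G₀ G₁ : Type u}
    [TopologicalSpace G₀] [ChartedSpace (EuclideanSpace ℝ (Fin n)) G₀] [IsManifold (𝓡 n) ∞ G₀]
    [T2Space G₀] [SecondCountableTopology G₀]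
    [TopologicalSpace G₁] [ChartedSpace (EuclideanSpace ℝ (Fin m)) G₁] [IsManifold (𝓡 m) ∞ G₁]
    [T2Space G₁] [SecondCountableTopology G₁]
    (G : OrbifoldPresentation.OrbifoldGroupoid (𝓡 n) (𝓡 m) G₀ G₁)
    (hconn : G.toSmoothGroupoid.IsConnected)
    (hcenter : ∀ x : G₀, Subgroup.center (G.ineffectiveStabilizer x) = ⊥) :
    ∃ (p : ℕ) (P : Type u) (_ : TopologicalSpace P)
      (_ : ChartedSpace (EuclideanSpace ℝ (Fin p)) P) (_ : IsManifold (𝓡 p) ∞ P)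
      (_ : T2Space P) (_ : SecondCountableTopology P)
      (k : ℕ) (K : Type) (_ : Group K) (_ : TopologicalSpace K)
      (_ : ChartedSpace (EuclideanSpace ℝ (Fin k)) K) (_ : LieGroup (𝓡 k) ∞ K)
      (_ : T2Space K) (_ : SecondCountableTopology K) (_ : CompactSpace K)
      (α : OrbifoldPresentation.LieRightAction (𝓡 p) (𝓡 k) P K),
      OrbifoldPresentation.HSEquivalent G.toSmoothGroupoid α.translationGroupoid :=
  mainTheorem2_general G hconn hcenter
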